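/- Let $(M_1,g_1)$ and $(M_2,g_2)$ be smooth, oriented Riemannian manifolds, possibly with boundary, of the same dimension $d\ge 1$, with volume forms $d\mathrm{Vol}_1$, $d\mathrm{Vol}_2$. For a smooth map $f:M_1\to M_2$ let $\operatorname{Det} df=\star^d\circ\Lambda^d df\circ\star^0$ and $\operatorname{Cof} df=(-1)^{d-1}\star^{d-1}\circ\Lambda^{d-1}df\circ\star^1\in\Gamma(T^*M_1\otimes f^*TM_2)$, where $\star$ denotes the fibrewise Hodge duals on $\Lambda_\bullet TM_1$ and $\Lambda_\bullet TM_2$. Let $\nabla^{f^*TM_2}$ be the pullback of the Levi-Civita connection of $M_2$. A smooth section $\tau$ of $f^*TM_2$ is the coderivative $\delta_{\nabla^{f^*TM_2}}\rho$ of an $f^*TM_2$-valued $1$-form $\rho$ if $$\int_{M_1}\langle\sigma,\tau\rangle\,d\mathrm{Vol}_1=\int_{M_1}\langle\nabla^{f^*TM_2}\sigma,\rho\rangle_{g_1,g_2}\,d\mathrm{Vol}_1$$ for all smooth compactly supported sections $\sigma$ of $f^*TM_2$ vanishing on $\partial M_1$. For compact $K\subseteq M_1$ (one may take $K=M_1$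 if $M_1$ is compact) put $E_K(f)=\int_K f^*d\mathrm{Vol}_2$. A variation of a smooth map $\varphi$ supported in $K$ is a family $\varphi_t:M_1\to M_2$, $|t|<\varepsilon$, smooth in $(t,p)$, with $\varphi_0=\varphi$ and $\varphi_t=\varphi$ on $\partial M_1$ and outside $K$; $\varphi$ is critical for $E$ if $\frac{d}{dt}\big|_{t=0}E_K(\varphi_t)=0$ for all compact $K$ and all such variations. Then: 1. For every smooth $f$, $f^*d\mathrm{Vol}_2=\operatorname{Det} df\,d\mathrm{Vol}_1$; for every compact $K$, $\operatorname{Det} df$ is integrable on $K$ and $E_K(f)=\int_K\operatorname{Det} df\,d\mathrm{Vol}_1$. 2. The Euler–Lagrange equation of $E$ is $\delta_{\nabla^{\varphi^*TM_2}}\operatorname{Cof} d\varphi=0$: for every smooth $\varphi$, the coderivative $\delta_{\nabla^{\varphi^*TM_2}}\operatorname{Cof} d\varphi$ exists and is unique; for every compact $K$ and every variation $\varphi_t$ of $\varphi$ supported in $K$, with $V=\partial_t\varphi_t|_{t=0}\in\Gamma(\varphi^*TM_2)$, the function $t\mapsto E_K(\varphi_t)$ is differentiable at $0$ and $$\frac{d}{dt}\Big|_{t=0}E_K(\varphi_t)=\int_{M_1}\big\langle\delta_{\nabla^{\varphi^*TM_2}}\operatorname{Cof}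 d\varphi,\,V\big\rangle\,d\mathrm{Vol}_1;$$ and $\varphi$ is critical for $E$ if and only if $\delta_{\nabla^{\varphi^*TM_2}}\operatorname{Cof} d\varphi=0$. 3. $E$ is a null-Lagrangian, i.e. every smooth map $\varphi:M_1\to M_2$ is critical for $E$. 4. Consequently every smooth map $f:M_1\to M_2$ satisfies the Riemannian Piola identity $\delta_{\nabla^{f^*TM_2}}\operatorname{Cof} df=0$. -/

import Mathlib

open Bundle Manifold MeasureTheory Set Module
open scoped ContDiff Topology

noncomputable section

namespace Piola

/-! ### Linear algebra: Hodge duals, determinant and cofactor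

The dimension is written `n + 1`.  The Hodge dual `⋆ : ⋀ᵏ V → ⋀ᵈ⁻ᵏ V` is normalised by
`α ∧ ⋆ β = ⟨α, β⟩ Vol`; only the degrees `0, 1, d - 1, d` are needed. -/

section LinearAlgebra

variable {n : ℕ}
  {V : Type*} [NormedAddCommGroup V] [InnerProductSpace ℝ V] [Fact (finrank ℝ V = n + 1)]
  {W : Type*} [NormedAddCommGroup W] [InnerProductSpace ℝ W] [Fact (finrank ℝ W = n + 1)]

/-- A positively oriented orthonormal basis. -/
def orientedBasis (o : Orientation ℝ V (Fin (n + 1))) : OrthonormalBasis (Fin (n + 1)) ℝ V :=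
  o.finOrthonormalBasis n.succ_pos Fact.out

/-- `⋆⁰ : ℝ → ⋀ᵈ V`, `1 ↦ e₀ ∧ … ∧ eₙ`. -/
def hodgeZero (o : Orientation ℝ V (Fin (n + 1))) : ℝ →ₗ[ℝ] ⋀[ℝ]^(n + 1) V :=
  LinearMap.toSpanSingleton ℝ _ (exteriorPower.ιMulti ℝ (n + 1) (orientedBasis o))

/-- `⋆ᵈ : ⋀ᵈ V → ℝ`, `v₀ ∧ … ∧ vₙ ↦ Vol(v₀, …, vₙ)`. -/
def hodgeTop (o : Orientation ℝ V (Fin (n + 1))) : ⋀[ℝ]^(n + 1) V →ₗ[ℝ] ℝ :=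
  exteriorPower.alternatingMapLinearEquiv o.volumeForm

/-- `⋆¹ : V → ⋀ᵈ⁻¹ V`, `eᵢ ↦ (-1)ⁱ e₀ ∧ … ∧ êᵢ ∧ … ∧ eₙ`. -/
def hodgeOne (o : Orientation ℝ V (Fin (n + 1))) : V →ₗ[ℝ] ⋀[ℝ]^n V :=
  ∑ i : Fin (n + 1), (-1 : ℝ) ^ (i : ℕ) •
    (innerₛₗ ℝ (orientedBasis o i)).smulRight
      (exteriorPower.ιMulti ℝ n fun j : Fin n => orientedBasis o (i.succAbove j))

/-- `⋆ᵈ⁻¹ : ⋀ᵈ⁻¹ V → V`, determined by `⟨⋆β, u⟩ = Vol(β, u) = (-1)ᵈ⁻¹ Vol(u, β)`. -/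
def hodgePred (o : Orientation ℝ V (Fin (n + 1))) : ⋀[ℝ]^n V →ₗ[ℝ] V :=
  ∑ i : Fin (n + 1), (-1 : ℝ) ^ n •
    (exteriorPower.alternatingMapLinearEquiv
      (o.volumeForm.curryLeft (orientedBasis o i))).smulRight (orientedBasis o i)

/-- `Det A = ⋆ᵈ ∘ ⋀ᵈ A ∘ ⋆⁰`. -/
def Det (oV : Orientation ℝ V (Fin (n + 1))) (oW : Orientation ℝ W (Fin (n + 1)))
    (A : V →ₗ[ℝ] W) : ℝ :=
  (hodgeTop oW ∘ₗ exteriorPower.map (n + 1) A ∘ₗ hodgeZero oV) 1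

/-- `Cof A = (-1)ᵈ⁻¹ ⋆ᵈ⁻¹ ∘ ⋀ᵈ⁻¹ A ∘ ⋆¹`. -/
def Cof (oV : Orientation ℝ V (Fin (n + 1))) (oW : Orientation ℝ W (Fin (n + 1)))
    (A : V →ₗ[ℝ] W) : V →ₗ[ℝ] W :=
  (-1 : ℝ) ^ n • (hodgePred oW ∘ₗ exteriorPower.map n A ∘ₗ hodgeOne oV)

/-- The inner product on `V* ⊗ W = Hom(V, W)` induced by those of `V` and `W`. -/
def homInner [FiniteDimensional ℝ V] (A B : V →ₗ[ℝ] W) : ℝ :=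
  ∑ i, inner ℝ (A (stdOrthonormalBasis ℝ V i)) (B (stdOrthonormalBasis ℝ V i))

end LinearAlgebra

/-! ### Riemannian geometry in charts -/

section Geometry

variable {n : ℕ} {H : Type*} [TopologicalSpace H]
  (I : ModelWithCorners ℝ (EuclideanSpace ℝ (Fin (n + 1))) H)
  {M : Type*} [TopologicalSpace M] [ChartedSpace H M]

instance tangentSpace_finiteDimensional (x : M) : FiniteDimensional ℝ (TangentSpace I x) :=
  inferInstanceAs (FiniteDimensional ℝ (EuclideanSpace ℝ (Fin (n + 1))))

instance tangentSpace_finrank (x : M) : Fact (finrank ℝ (TangentSpace I x) = n + 1) :=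
  ⟨(finrank_euclideanSpace_fin : finrank ℝ (EuclideanSpace ℝ (Fin (n + 1))) = n + 1)⟩

variable [IsManifold I ∞ M]

/-- The coordinate vector field `∂ᵢ` at `x` of the chart centred at `x₀`. -/
def coordVec (x₀ x : M) (i : Fin (n + 1)) : TangentSpace I x :=
  (trivializationAt (EuclideanSpace ℝ (Fin (n + 1))) (TangentSpace I) x₀).symmL ℝ x
    (EuclideanSpace.single i 1)

variable [RiemannianBundle (fun x : M => TangentSpace I x)]

/-- The matrix `gᵢⱼ` of the metric in the chart centred at `x₀`, at the coordinate point `y`. -/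
def gram (x₀ : M) (y : EuclideanSpace ℝ (Fin (n + 1))) :
    Matrix (Fin (n + 1)) (Fin (n + 1)) ℝ :=
  Matrix.of fun i j =>
    inner ℝ (coordVec I x₀ ((extChartAt I x₀).symm y) i) (coordVec I x₀ ((extChartAt I x₀).symm y) j)

/-- The partial derivative `∂ₖ gᵢⱼ` in the chart centred at `x₀`, at the coordinate point `y`. -/
def gramDeriv (x₀ : M) (y : EuclideanSpace ℝ (Fin (n + 1))) (k i j : Fin (n + 1)) : ℝ :=
  fderivWithin ℝ (fun z => gram I x₀ z i j) (range I) y (EuclideanSpace.single k 1)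

/-- The Christoffel symbol `Γᵏᵢⱼ = ½ gᵏˡ (∂ᵢ gⱼₗ + ∂ⱼ gᵢₗ - ∂ₗ gᵢⱼ)` of the Levi-Civita
connection in the chart centred at `x₀`, at the coordinate point `y`. -/
def christoffel (x₀ : M) (y : EuclideanSpace ℝ (Fin (n + 1))) (k i j : Fin (n + 1)) : ℝ :=
  (1 / 2) * ∑ l, (gram I x₀ y)⁻¹ k l *
    (gramDeriv I x₀ y i j l + gramDeriv I x₀ y j i l - gramDeriv I x₀ y l i j)

/-- The measure `√(det g) dx` on the domain of the chart centred at `x₀`. -/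
def chartVolume [MeasurableSpace M] (x₀ : M) : Measure M :=
  (((volume : Measure (EuclideanSpace ℝ (Fin (n + 1)))).restrict
      (extChartAt I x₀).target).withDensity
    fun y => ENNReal.ofReal (Real.sqrt (gram I x₀ y).det)).map (extChartAt I x₀).symm

/-- The Riemannian volume measure.  The measures `chartVolume I x₀` agree on the overlaps of the
chart domains, so their supremum is the measure obtained by glueing them. -/
def riemannianVolume [MeasurableSpace M] : Measure M := ⨆ x₀ : M, chartVolume I x₀

/-- A pointwise choice of orientations of the tangent spaces is an orientation of the manifold if
near every point `x₀` the coordinate frame of the chart centred at `x₀` is either everywhere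
positively or everywhere negatively oriented. -/
def IsOrientation (o : ∀ x : M, Orientation ℝ (TangentSpace I x) (Fin (n + 1))) : Prop :=
  ∀ x₀ : M, ∀ᶠ x in 𝓝 x₀,
    (0 < (o x).volumeForm (coordVec I x₀ x) ↔ 0 < (o x₀).volumeForm (coordVec I x₀ x₀))

/-- The integral over `K` of a form of top degree on an oriented Riemannian manifold. -/
def integralTopForm [MeasurableSpace M]
    (o : ∀ x : M, Orientation ℝ (TangentSpace I x) (Fin (n + 1))) (K : Set M)
    (η : ∀ x : M, TangentSpace I x [⋀^Fin (n + 1)]→ₗ[ℝ] ℝ) : ℝ :=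
  ∫ x in K, η x (orientedBasis (o x)) ∂(riemannianVolume I : Measure M)

end Geometry

/-! ### Maps between manifolds -/

section Maps

variable {n : ℕ}
  {H₁ : Type*} [TopologicalSpace H₁] (I₁ : ModelWithCorners ℝ (EuclideanSpace ℝ (Fin (n + 1))) H₁)
  {M₁ : Type*} [TopologicalSpace M₁] [ChartedSpace H₁ M₁] [IsManifold I₁ ∞ M₁]
  {H₂ : Type*} [TopologicalSpace H₂] (I₂ : ModelWithCorners ℝ (EuclideanSpace ℝ (Fin (n + 1))) H₂)
  {M₂ : Type*} [TopologicalSpace M₂] [ChartedSpace H₂ M₂] [IsManifold I₂ ∞ M₂]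

/-- The differential `df` at `p`. -/
def differential (f : M₁ → M₂) (p : M₁) : TangentSpace I₁ p →ₗ[ℝ] TangentSpace I₂ (f p) :=
  (mfderiv I₁ I₂ f p).toLinearMap

/-- Smoothness of a section of `f^*TM₂`. -/
def IsSmoothSection (f : M₁ → M₂) (ξ : ∀ p, TangentSpace I₂ (f p)) : Prop :=
  ContMDiff I₁ I₂.tangent ∞ (fun p => (⟨f p, ξ p⟩ : TangentBundle I₂ M₂))

/-- `ψ t`, `|t| < ε`, is a smooth variation of `φ` that is constant on `∂M₁` and outside `K`. -/
structure IsVariation (φ : M₁ → M₂) (K : Set M₁) (ε : ℝ) (ψ : ℝ → M₁ → M₂) : Prop where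
  smooth : ContMDiffOn (𝓘(ℝ, ℝ).prod I₁) I₂ ∞ (fun q : ℝ × M₁ => ψ q.1 q.2)
    (Ioo (-ε) ε ×ˢ univ)
  zero : ψ 0 = φ
  eq_on_boundary : ∀ t ∈ Ioo (-ε) ε, ∀ p ∈ I₁.boundary M₁, ψ t p = φ p
  eq_off : ∀ t ∈ Ioo (-ε) ε, ∀ p ∉ K, ψ t p = φ p

/-- `V = ∂ψ/∂t` at `t = 0`, as a section of `φ^*TM₂`. -/
def IsVariationField (φ : M₁ → M₂) (ψ : ℝ → M₁ → M₂) (V : ∀ p, TangentSpace I₂ (φ p)) : Prop :=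
  ∀ p, tangentMap 𝓘(ℝ, ℝ) I₂ (fun t : ℝ => ψ t p) ⟨0, (1 : ℝ)⟩ = ⟨φ p, V p⟩

/-- `φ` is a critical point of the functional `E`, where `E K` is the functional restricted to the
compact set `K`: its derivative vanishes along all smooth variations relative to `∂M₁` that are
constant outside `K`. -/
def IsCritical (E : Set M₁ → (M₁ → M₂) → ℝ) (φ : M₁ → M₂) : Prop :=
  ∀ (K : Set M₁) (ε : ℝ) (ψ : ℝ → M₁ → M₂), IsCompact K → 0 < ε → IsVariation I₁ I₂ φ K ε ψ →
    HasDerivAt (fun t => E K (ψ t)) 0 0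

/-- Every smooth map is a critical point. -/
def IsNullLagrangian (E : Set M₁ → (M₁ → M₂) → ℝ) : Prop :=
  ∀ φ : M₁ → M₂, ContMDiff I₁ I₂ ∞ φ → IsCritical I₁ I₂ E φ

variable [RiemannianBundle (fun x : M₁ => TangentSpace I₁ x)]
  [RiemannianBundle (fun x : M₂ => TangentSpace I₂ x)]

/-- The linear map `v ↦ Γᵏᵢⱼ vⁱ wʲ eₖ` of coordinate vectors, in the chart of `M₂` centred at `q`
and at the point `q`. -/
def christoffelMap (q : M₂) (w : EuclideanSpace ℝ (Fin (n + 1))) :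
    EuclideanSpace ℝ (Fin (n + 1)) →L[ℝ] EuclideanSpace ℝ (Fin (n + 1)) :=
  ∑ k, ∑ i, ∑ j, (christoffel I₂ q (extChartAt I₂ q q) k i j * w j) •
    (EuclideanSpace.proj i : EuclideanSpace ℝ (Fin (n + 1)) →L[ℝ] ℝ).smulRight
      (EuclideanSpace.single k (1 : ℝ))

/-- The covariant derivative `∇ξ` of a section `ξ` of `f^*TM₂` for the pullback of the Levi-Civita
connection of `M₂`: in the chart of `M₂` centred at `f p`,
`(∇_v ξ)ᵏ = dξᵏ(v) + Γᵏᵢⱼ(f p) (df v)ⁱ ξʲ`. -/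
def pullbackConnection (f : M₁ → M₂) (ξ : ∀ p, TangentSpace I₂ (f p)) (p : M₁) :
    TangentSpace I₁ p →ₗ[ℝ] TangentSpace I₂ (f p) :=
  letI e := trivializationAt (EuclideanSpace ℝ (Fin (n + 1)))
    (TangentSpace I₂ : M₂ → Type _) (f p)
  (e.symmL ℝ (f p)).toLinearMap ∘ₗ
    ((mvfderiv I₁ (fun p' => e.continuousLinearMapAt ℝ (f p') (ξ p')) p).toLinearMap +
      (christoffelMap I₂ (f p) (e.continuousLinearMapAt ℝ (f p) (ξ p))).toLinearMap ∘ₗ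
        (e.continuousLinearMapAt ℝ (f p)).toLinearMap ∘ₗ differential I₁ I₂ f p)

/-- `τ = δ ρ`: the smooth section `τ` of `f^*TM₂` is the coderivative of the `f^*TM₂`-valued
1-form `ρ`, that is `∫ ⟨σ, τ⟩ dVol₁ = ∫ ⟨∇σ, ρ⟩ dVol₁` for all smooth compactly supported
sections `σ` that vanish on the boundary. -/
def IsCoderivative [MeasurableSpace M₁] (f : M₁ → M₂)
    (ρ : ∀ p, TangentSpace I₁ p →ₗ[ℝ] TangentSpace I₂ (f p))
    (τ : ∀ p, TangentSpace I₂ (f p)) : Prop :=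
  IsSmoothSection I₁ I₂ f τ ∧
    ∀ σ : ∀ p, TangentSpace I₂ (f p), IsSmoothSection I₁ I₂ f σ →
      IsCompact (closure {p | σ p ≠ 0}) → (∀ p ∈ I₁.boundary M₁, σ p = 0) →
      ∫ p, inner ℝ (σ p) (τ p) ∂(riemannianVolume I₁ : Measure M₁) =
        ∫ p, homInner (pullbackConnection I₁ I₂ f σ p) (ρ p) ∂(riemannianVolume I₁ : Measure M₁)

variable (o₁ : ∀ x : M₁, Orientation ℝ (TangentSpace I₁ x) (Fin (n + 1)))
  (o₂ : ∀ x : M₂, Orientation ℝ (TangentSpace I₂ x) (Fin (n + 1)))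

/-- `Det df`. -/
def DetD (f : M₁ → M₂) (p : M₁) : ℝ := Det (o₁ p) (o₂ (f p)) (differential I₁ I₂ f p)

/-- `Cof df`. -/
def CofD (f : M₁ → M₂) (p : M₁) : TangentSpace I₁ p →ₗ[ℝ] TangentSpace I₂ (f p) :=
  Cof (o₁ p) (o₂ (f p)) (differential I₁ I₂ f p)

/-- The form `f^*dVol₂`. -/
def pullbackVolume (f : M₁ → M₂) (p : M₁) : TangentSpace I₁ p [⋀^Fin (n + 1)]→ₗ[ℝ] ℝ :=
  ((o₂ (f p)).volumeForm).compLinearMap (differential I₁ I₂ f p)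

/-- The functional `E(f) = ∫_K f^*dVol₂`. -/
def volumeFunctional [MeasurableSpace M₁] (K : Set M₁) (f : M₁ → M₂) : ℝ :=
  integralTopForm I₁ o₁ K (pullbackVolume I₁ I₂ o₂ f)

end Maps

end Piola

end

set_option linter.unusedSectionVars false

noncomputable section

namespace Piola

/-! ### Determinant and cofactor in terms of the volume forms -/

section LinearAlgebra

variable {n : ℕ}
  {V : Type*} [NormedAddCommGroup V] [InnerProductSpace ℝ V] [Fact (finrank ℝ V = n + 1)]
  {W : Type*} [NormedAddCommGroup W] [InnerProductSpace ℝ W] [Fact (finrank ℝ W = n + 1)]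

/-! The pairing of `Cof df` with `∇σ` is a divergence, so every assertion follows from Stokes'
theorem. For a section `σ` of `f^*TM₂`, replacing one entry `df(vᵢ)` of `dVol₂(df v₀, …, df vₙ)` by
`∇_{vᵢ}σ` and summing over `i` gives `⟨∇σ, Cof df⟩ dVol₁` (`sum_volumeForm_update`). Because the
Levi-Civita connection is torsion free and `dVol₂` is parallel, this form is the exterior derivative
of the pullback of `ι_σ dVol₂` along `f`. If `σ` has compact support and vanishes on `∂M₁`, its
integral is zero. Hence `0` is a coderivative of `Cof df`, and it is the only one, since test
sections separate smooth sections.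

In charts, let `F` represent `f`, let `S` represent `σ`, and put `G = √det g₂`. The flux is `Xⁱ =
±G(F) det(∂₀F, …, S, …, ∂ₙF)` with `S` in slot `i`. In its divergence the second derivatives of `F`
cancel by antisymmetry of the determinant, and Cramer's rule collects the derivatives of `G`
(`sum_fderiv_flux`). What remains is `chartVariation`. The covariant derivative leads to the same
expression (`homInner_pullbackConnection_CofD`), because the trace of the Christoffel symbols is the
logarithmic derivative of `G` (`fderivWithin_density`). The connection at `p` is given in the chart
centred at `f p`, so the comparison is made pointwise in that chart and needs no transformation law
for Christoffel symbols.

The integral is computed in `integral_homInner_eq_zero_of_chart` for sections supported in one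
chart, and globalised by a partition of unity. The Euclidean input is
`integral_fderivWithin_convex_eq_zero`, whose closed convex domain also covers boundaries and
corners.

For the first variation, `chartVariation` is also the `t`-derivative of `G(F_t) det DF_t`, by
symmetry of mixed partials. Thus `Det dφ_t` has derivative `⟨∇V, Cof dφ⟩` at interior points, which
have full measure. Differentiation under the integral and the divergence theorem then give
derivative zero for `E`. -/

lemma volumeForm_eq_det (o : Orientation ℝ V (Fin (n + 1))) :
    o.volumeForm = (orientedBasis o).toBasis.det :=
  o.volumeForm_robust _ (o.finOrthonormalBasis_orientation _ _)

lemma volumeForm_orientedBasis (o : Orientation ℝ V (Fin (n + 1))) :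
    o.volumeForm (orientedBasis o) = 1 := by
  rw [volumeForm_eq_det, ← OrthonormalBasis.coe_toBasis, Basis.det_self]

/-- The volume form as a continuous multilinear map. -/
def volumeCM (o : Orientation ℝ V (Fin (n + 1))) :
    ContinuousMultilinearMap ℝ (fun _ : Fin (n + 1) => V) ℝ :=
  o.volumeForm.toMultilinearMap.mkContinuous 1 fun v => by
    simpa using o.abs_volumeForm_apply_le v

@[simp] lemma volumeCM_apply (o : Orientation ℝ V (Fin (n + 1))) (v : Fin (n + 1) → V) :
    volumeCM o v = o.volumeForm v := rfl

lemma Det_eq (oV : Orientation ℝ V (Fin (n + 1))) (oW : Orientation ℝ W (Fin (n + 1)))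
    (A : V →ₗ[ℝ] W) : Det oV oW A = oW.volumeForm (A ∘ orientedBasis oV) := by
  simp [Det, hodgeTop, hodgeZero]

/-- Alternating forms of top degree form a line, so the factor can be read off on an oriented
orthonormal basis. Applied to `df`, this is the identity between `f^*dVol₂` and `Det df dVol₁`. -/
lemma volumeForm_compLinearMap (oV : Orientation ℝ V (Fin (n + 1)))
    (oW : Orientation ℝ W (Fin (n + 1))) (A : V →ₗ[ℝ] W) :
    oW.volumeForm.compLinearMap A = Det oV oW A • oV.volumeForm := by
  rw [AlternatingMap.eq_smul_basis_det (orientedBasis oV).toBasis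
    (oW.volumeForm.compLinearMap A), ← volumeForm_eq_det, Det_eq]
  congr 1

lemma sum_inner_eq_trace [FiniteDimensional ℝ V] [FiniteDimensional ℝ W] {ι : Type*} [Fintype ι]
    (b : OrthonormalBasis ι ℝ V) (A B : V →ₗ[ℝ] W) :
    ∑ i, inner ℝ (A (b i)) (B (b i)) = LinearMap.trace ℝ V (A.adjoint ∘ₗ B) := by
  rw [LinearMap.trace_eq_sum_inner _ b]
  simp [LinearMap.adjoint_inner_right]

/-- Each such sum is the trace of `A.adjoint ∘ₗ B`, hence independent of the orthonormal basis. The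
pairing may therefore be evaluated in the oriented basis, where `Cof` is explicit. -/
lemma homInner_eq_sum [FiniteDimensional ℝ V] [FiniteDimensional ℝ W] {ι : Type*} [Fintype ι]
    (b : OrthonormalBasis ι ℝ V) (A B : V →ₗ[ℝ] W) :
    homInner A B = ∑ i, inner ℝ (A (b i)) (B (b i)) := by
  rw [sum_inner_eq_trace b, homInner, sum_inner_eq_trace]

/-- The sign `(-1)ⁿ` in `Cof` cancels the one in `hodgePred`, while the `(-1)ⁱ` of `hodgeOne` is
exactly the sign of moving `w` from the first slot to slot `i`. -/
lemma Cof_orientedBasis (oV : Orientation ℝ V (Fin (n + 1))) (oW : Orientation ℝ W (Fin (n + 1)))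
    (B : V →ₗ[ℝ] W) (i : Fin (n + 1)) (w : W) :
    inner ℝ w (Cof oV oW B (orientedBasis oV i)) =
      oW.volumeForm (Function.update (B ∘ orientedBasis oV) i w) := by
  have h1 : hodgeOne oV (orientedBasis oV i) = (-1 : ℝ) ^ (i : ℕ) •
      exteriorPower.ιMulti ℝ n fun j : Fin n => orientedBasis oV (i.succAbove j) := by
    simp only [hodgeOne, LinearMap.sum_apply, LinearMap.smul_apply, LinearMap.smulRight_apply,
      innerₛₗ_apply_apply, OrthonormalBasis.inner_eq_ite]
    simp
  have h2 : ∀ v : Fin n → W, inner ℝ w (hodgePred oW (exteriorPower.ιMulti ℝ n v)) =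
      (-1 : ℝ) ^ n * oW.volumeForm (Matrix.vecCons w v) := by
    intro v
    conv_rhs => rw [← (orientedBasis oW).sum_repr' w]
    simp only [hodgePred, LinearMap.sum_apply, LinearMap.smul_apply, LinearMap.smulRight_apply,
      exteriorPower.alternatingMapLinearEquiv_apply_ιMulti, inner_sum, inner_smul_right]
    let L : W →ₗ[ℝ] ℝ :=
      { toFun := fun u => oW.volumeForm (Matrix.vecCons u v)
        map_add' := oW.volumeForm.map_vecCons_add v
        map_smul' := oW.volumeForm.map_vecCons_smul v }
    change _ = (-1) ^ n * L _
    rw [map_sum, Finset.mul_sum]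
    simp only [map_smul, smul_eq_mul]
    refine Finset.sum_congr rfl fun k _ => ?_
    change _ * (L _ * _) = _
    rw [real_inner_comm]; ring
  have h3 : Function.update (B ∘ orientedBasis oV) i w =
      i.insertNth w (fun j : Fin n => B (orientedBasis oV (i.succAbove j))) := by
    rw [Fin.eq_insertNth_iff]
    exact ⟨by simp, by ext j; simp [Fin.removeNth, Fin.succAbove_ne]⟩
  rw [h3, AlternatingMap.map_insertNth]
  simp only [Cof, LinearMap.smul_apply, LinearMap.comp_apply, h1, map_smul, inner_smul_right,
    exteriorPower.map_apply_ιMulti, h2]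
  have : ((-1 : ℝ) ^ n) * ((-1) ^ n) = 1 := by rw [← mul_pow]; simp
  simp only [Function.comp_def]
  linear_combination ((-1 : ℝ) ^ (i : ℕ) *
    oW.volumeForm (Matrix.vecCons w fun j : Fin n => B (orientedBasis oV (i.succAbove j)))) * this

lemma homInner_Cof [FiniteDimensional ℝ V] (oV : Orientation ℝ V (Fin (n + 1)))
    (oW : Orientation ℝ W (Fin (n + 1))) (A B : V →ₗ[ℝ] W) :
    homInner A (Cof oV oW B) = ∑ i, oW.volumeForm
      (Function.update (B ∘ orientedBasis oV) i (A (orientedBasis oV i))) := by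
  have : FiniteDimensional ℝ W := .of_fact_finrank_eq_succ n
  simp [homInner_eq_sum (orientedBasis oV), Cof_orientedBasis]

/-- The derivative of a volume form along a line. -/
lemma hasDerivAt_volumeForm_add_smul (o : Orientation ℝ W (Fin (n + 1))) (a b : Fin (n + 1) → W) :
    HasDerivAt (fun t : ℝ => o.volumeForm (fun i => b i + t • a i))
      (∑ i, o.volumeForm (Function.update b i (a i))) 0 := by
  have h : ∀ i, HasFDerivAt (fun t : ℝ => b i + t • a i)
      (ContinuousLinearMap.toSpanSingleton ℝ (a i)) 0 := fun i => by
    have := ((hasDerivAt_id (0 : ℝ)).smul_const (a i)).const_add (b i)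
    simpa [hasDerivAt_iff_hasFDerivAt] using this
  have := (HasFDerivAt.multilinear_comp (f := volumeCM o) h).hasDerivAt
  simpa using this

/-- The variation of a volume form pulled back by a linear map. -/
lemma sum_volumeForm_update [FiniteDimensional ℝ V] (oV : Orientation ℝ V (Fin (n + 1)))
    (oW : Orientation ℝ W (Fin (n + 1))) (A B : V →ₗ[ℝ] W) (v : Fin (n + 1) → V) :
    ∑ i, oW.volumeForm (Function.update (B ∘ v) i (A (v i))) =
      homInner A (Cof oV oW B) * oV.volumeForm v := by
  -- Differentiate `vol_W((B + tA) v) = Det(B + tA) vol_V(v)` at `t = 0`. The derivative of `Det` is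
  -- computed on the oriented basis and does not depend on `v`, so an arbitrary frame is allowed.
  have h1 := hasDerivAt_volumeForm_add_smul oW (A ∘ v) (B ∘ v)
  have h2 := (hasDerivAt_volumeForm_add_smul oW (A ∘ orientedBasis oV)
    (B ∘ orientedBasis oV)).mul_const (oV.volumeForm v)
  rw [homInner_Cof oV]
  refine h1.unique (h2.congr_of_eventuallyEq (.of_forall fun t => ?_))
  have := DFunLike.congr_fun (volumeForm_compLinearMap oV oW (B + t • A)) v
  rw [Det_eq] at this
  simpa [Function.comp_def] using this

/-- The Gram matrix is `Pᵀ P`, with `P` the matrix of coordinates of `v` in the oriented orthonormal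
basis. -/
lemma abs_volumeForm_eq_sqrt (o : Orientation ℝ V (Fin (n + 1))) (v : Fin (n + 1) → V) :
    |o.volumeForm v| = Real.sqrt (Matrix.of fun i j => inner ℝ (v i) (v j)).det := by
  have : (Matrix.of fun i j => inner ℝ (v i) (v j)) =
      ((orientedBasis o).toBasis.toMatrix v).transpose * (orientedBasis o).toBasis.toMatrix v := by
    ext i j
    rw [Matrix.mul_apply, Matrix.of_apply, ← (orientedBasis o).sum_inner_mul_inner]
    refine Finset.sum_congr rfl fun k _ => ?_
    simp [Basis.toMatrix_apply, OrthonormalBasis.repr_apply_apply, real_inner_comm]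
  rw [this, Matrix.det_mul, Matrix.det_transpose, Real.sqrt_mul_self_eq_abs, volumeForm_eq_det,
    Basis.det_apply]

end LinearAlgebra

/-! ### Calculus in coordinates -/

section Calculus

/-- Integral of a directional derivative over a closed convex set: it vanishes if the function has
compact support and is zero on the frontier. -/
theorem integral_fderivWithin_convex_eq_zero {E : Type*} [NormedAddCommGroup E] [NormedSpace ℝ E]
    [FiniteDimensional ℝ E] [MeasurableSpace E] [BorelSpace E] (μ : Measure E) [μ.IsAddHaarMeasure]
    {C k : Set E} (hC : Convex ℝ C) (hCc : IsClosed C) (hCi : (interior C).Nonempty)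
    (hk : IsCompact k) {g : E → ℝ} (hg : ContDiffOn ℝ 1 g C) (hgk : ∀ x ∈ C, x ∉ k → g x = 0)
    (hgf : ∀ x ∈ frontier C, g x = 0) (v : E) :
    IntegrableOn (fun x => fderivWithin ℝ g C x v) C μ ∧
      ∫ x in C, fderivWithin ℝ g C x v ∂μ = 0 := by
  have hu : UniqueDiffOn ℝ C := uniqueDiffOn_convex hC hCi
  have hcont : ContinuousOn (fderivWithin ℝ g C) C := hg.continuousOn_fderivWithin hu le_rfl
  have hzero : ∀ x ∈ C, x ∉ k → fderivWithin ℝ g C x = 0 := by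
    intro x hx hxk
    have : g =ᶠ[𝓝[C] x] fun _ => (0 : ℝ) := by
      filter_upwards [self_mem_nhdsWithin, mem_nhdsWithin_of_mem_nhds
        (hk.isClosed.isOpen_compl.mem_nhds hxk)] with y hy hyk using hgk y hy hyk
    rw [this.fderivWithin_eq (hgk x hx hxk)]
    simp
  have hkC : IsCompact (k ∩ C) := hk.inter_right hCc
  -- The derivative vanishes off `k` and is bounded on the compact set `k ∩ C`; by convexity a bound
  -- on the derivative is a Lipschitz constant.
  obtain ⟨L, hL⟩ : ∃ L : NNReal, ∀ x ∈ C, ‖fderivWithin ℝ g C x‖₊ ≤ L := by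
    obtain ⟨B, hB⟩ := hkC.exists_bound_of_continuousOn (hcont.mono inter_subset_right)
    refine ⟨B.toNNReal, fun x hx => ?_⟩
    by_cases hxk : x ∈ k
    · exact NNReal.le_toNNReal_of_coe_le (hB x ⟨hxk, hx⟩)
    · simp [hzero x hx hxk]
  have hLip : LipschitzOnWith L g C :=
    hC.lipschitzOnWith_of_nnnorm_fderivWithin_le (hg.differentiableOn one_ne_zero) hL
  -- the extension by zero
  have hcross : ∀ x ∈ C, ∀ y ∉ C, ‖C.indicator g x - C.indicator g y‖ ≤ L * ‖x - y‖ := by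
    intro x hx y hy
    have hseg : (segment ℝ x y ∩ frontier C).Nonempty := by
      by_contra hne
      have hsub : ∀ z ∈ segment ℝ x y, z ∈ C → z ∈ interior C := fun z hz hzC => by
        by_contra hzi
        exact hne ⟨z, hz, by rw [hCc.frontier_eq]; exact ⟨hzC, hzi⟩⟩
      obtain ⟨z, -, hz1, hz2⟩ := (convex_segment x y).isPreconnected (interior C) Cᶜ
        isOpen_interior hCc.isOpen_compl
        (fun z hz => (em (z ∈ C)).imp (hsub z hz) id)
        ⟨x, left_mem_segment ℝ x y, hsub x (left_mem_segment ℝ x y) hx⟩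
        ⟨y, right_mem_segment ℝ x y, hy⟩
      exact hz2 (interior_subset hz1)
    obtain ⟨z, hz, hzf⟩ := hseg
    have hzC : z ∈ C := hCc.frontier_subset hzf
    have h1 := hLip.norm_sub_le hx hzC
    rw [hgf z hzf, sub_zero] at h1
    rw [indicator_of_mem hx, indicator_of_notMem hy, sub_zero]
    refine h1.trans (mul_le_mul_of_nonneg_left ?_ L.2)
    obtain ⟨a, b, ha, hb, hab, rfl⟩ := hz
    have : x - (a • x + b • y) = b • (x - y) := by
      rw [show a = 1 - b by linarith]; module
    rw [this, norm_smul, Real.norm_of_nonneg hb]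
    exact mul_le_of_le_one_left (norm_nonneg _) (by linarith)
  have hLip' : LipschitzWith L (C.indicator g) := by
    refine LipschitzWith.of_dist_le_mul fun x y => ?_
    rw [dist_eq_norm, dist_eq_norm]
    by_cases hx : x ∈ C <;> by_cases hy : y ∈ C
    · rw [indicator_of_mem hx, indicator_of_mem hy]; exact hLip.norm_sub_le hx hy
    · exact hcross x hx y hy
    · rw [norm_sub_rev, norm_sub_rev x]; exact hcross y hy x hx
    · rw [indicator_of_notMem hx, indicator_of_notMem hy]; simp; positivity
  have hsupp : HasCompactSupport (C.indicator g) := by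
    refine HasCompactSupport.intro hk fun x hx => ?_
    by_cases hxC : x ∈ C
    · rw [indicator_of_mem hxC, hgk x hxC hx]
    · exact indicator_of_notMem hxC _
  constructor
  · have h1 : IntegrableOn (fun x => fderivWithin ℝ g C x v) (k ∩ C) μ :=
      ContinuousOn.integrableOn_compact hkC
        ((hcont.mono inter_subset_right).clm_apply continuousOn_const)
    refine h1.of_forall_sdiff_eq_zero hCc.measurableSet fun x hx => ?_
    rw [hzero x hx.1 fun h => hx.2 ⟨h, hx.1⟩]
    rfl
  · have hconst : ∀ (c : ℝ) (x w : E), lineDeriv ℝ (fun _ => c) x w = 0 := by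
      intro c x w; simp [lineDeriv]
    -- Integration by parts for Lipschitz functions against the constant `1`. The formula reverses
    -- the direction on the other factor, hence `-v`.
    have key := LipschitzWith.integral_lineDeriv_mul_eq (μ := μ) (C := 0) (f := fun _ : E => (1 : ℝ))
      (LipschitzWith.const 1) hLip' hsupp (-v)
    simp only [hconst, zero_mul, integral_zero, neg_neg, mul_one] at key
    rw [key, ← integral_indicator hCc.measurableSet]
    refine integral_congr_ae ?_
    -- The frontier of a convex set is null; off it the line derivative of the extension is either
    -- the derivative of `g` or zero.
    have hnull : μ (frontier C) = 0 := hC.addHaar_frontier μ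
    filter_upwards [compl_mem_ae_iff.2 hnull] with x hx
    by_cases hxC : x ∈ C
    · have hxi : x ∈ interior C := by
        by_contra h
        exact hx (by rw [hCc.frontier_eq]; exact ⟨hxC, h⟩)
      have hn : C ∈ 𝓝 x := mem_interior_iff_mem_nhds.1 hxi
      have hd : DifferentiableAt ℝ g x :=
        (hg.differentiableOn one_ne_zero x hxC).differentiableAt hn
      have he : C.indicator g =ᶠ[𝓝 x] g := by
        filter_upwards [hn] with y hy using indicator_of_mem hy g
      rw [indicator_of_mem hxC, fderivWithin_of_mem_nhds hn, he.lineDeriv_eq,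
        hd.lineDeriv_eq_fderiv]
    · have he : C.indicator g =ᶠ[𝓝 x] fun _ => (0 : ℝ) := by
        filter_upwards [hCc.isOpen_compl.mem_nhds hxC] with y hy using indicator_of_notMem hy g
      rw [indicator_of_notMem hxC, he.lineDeriv_eq]
      exact (hconst 0 x v).symm

lemma hasFDerivWithinAt_clm_apply_const {P E F : Type*} [NormedAddCommGroup P] [NormedSpace ℝ P]
    [NormedAddCommGroup E] [NormedSpace ℝ E] [NormedAddCommGroup F] [NormedSpace ℝ F]
    {c : P → E →L[ℝ] F} {c' : P →L[ℝ] E →L[ℝ] F} {s : Set P} {x : P}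
    (hc : HasFDerivWithinAt c c' s x) (v : E) :
    HasFDerivWithinAt (fun y => c y v) (c'.flip v) s x :=
  (ContinuousLinearMap.apply ℝ F v).hasFDerivAt.comp_hasFDerivWithinAt x hc

variable {n : ℕ}

instance euclideanSpace_finrank :
    Fact (finrank ℝ (EuclideanSpace ℝ (Fin (n + 1))) = n + 1) := ⟨finrank_euclideanSpace_fin⟩

/-- The standard orientation of Euclidean space. -/
def stdOrientation (n : ℕ) : Orientation ℝ (EuclideanSpace ℝ (Fin (n + 1))) (Fin (n + 1)) :=
  (EuclideanSpace.basisFun (Fin (n + 1)) ℝ).toBasis.orientation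

/-- The determinant as an alternating form on Euclidean space. -/
def stdVol (n : ℕ) : EuclideanSpace ℝ (Fin (n + 1)) [⋀^Fin (n + 1)]→ₗ[ℝ] ℝ :=
  (stdOrientation n).volumeForm

/-- The determinant as a continuous multilinear form on Euclidean space. -/
def stdVolCM (n : ℕ) :
    ContinuousMultilinearMap ℝ (fun _ : Fin (n + 1) => EuclideanSpace ℝ (Fin (n + 1))) ℝ :=
  volumeCM (stdOrientation n)

lemma stdVolCM_apply (v : Fin (n + 1) → EuclideanSpace ℝ (Fin (n + 1))) :
    stdVolCM n v = stdVol n v := rfl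

lemma stdVol_eq_det : stdVol n = (EuclideanSpace.basisFun (Fin (n + 1)) ℝ).toBasis.det :=
  (stdOrientation n).volumeForm_robust _ rfl

lemma stdVol_single : stdVol n (fun i => EuclideanSpace.single i 1) = 1 := by
  rw [stdVol_eq_det]
  convert (EuclideanSpace.basisFun (Fin (n + 1)) ℝ).toBasis.det_self
  simp

/-- The Cramer rule. -/
lemma sum_stdVol_update_mul (l : EuclideanSpace ℝ (Fin (n + 1)) →ₗ[ℝ] ℝ)
    (v : Fin (n + 1) → EuclideanSpace ℝ (Fin (n + 1))) (w : EuclideanSpace ℝ (Fin (n + 1))) :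
    ∑ i, l (v i) * stdVol n (Function.update v i w) = l w * stdVol n v := by
  set b := (EuclideanSpace.basisFun (Fin (n + 1)) ℝ).toBasis
  -- The vector form of Cramer's rule comes from the adjugate identity and so needs no invertibility
  -- of `v`.
  have h : ∑ i, stdVol n (Function.update v i w) • v i = stdVol n v • w := by
    apply b.repr.injective
    ext k
    have := congrFun ((b.toMatrix v).mulVec_cramer (b.repr w)) k
    simp only [Matrix.mulVec, dotProduct, Matrix.cramer_apply, Pi.smul_apply, smul_eq_mul] at this
    simp only [map_sum, map_smul, Finsupp.coe_finsetSum, Finset.sum_apply, Finsupp.smul_apply,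
      smul_eq_mul, stdVol_eq_det, Basis.det_apply, Basis.toMatrix_update]
    rw [← this]
    refine Finset.sum_congr rfl fun i _ => ?_
    rw [mul_comm]; rfl
  have h' := congrArg l h
  simp only [map_sum, map_smul, smul_eq_mul] at h'
  rw [mul_comm (l w), ← h']
  exact Finset.sum_congr rfl fun i _ => mul_comm _ _

/-- Off the diagonal, exchanging `i` and `j` swaps the two columns holding `w` and `A i j`, so these
terms cancel in pairs. On the diagonal the second update overwrites `w` by `B i`. In the application
`A` is the Hessian of `F`, `w` is `S`, and `B i` is `∂ᵢS`. -/
lemma sum_sum_stdVol_update_update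
    (v : Fin (n + 1) → EuclideanSpace ℝ (Fin (n + 1))) (w : EuclideanSpace ℝ (Fin (n + 1)))
    (A : Fin (n + 1) → Fin (n + 1) → EuclideanSpace ℝ (Fin (n + 1)))
    (hA : ∀ i j, A i j = A j i) (B : Fin (n + 1) → EuclideanSpace ℝ (Fin (n + 1))) :
    ∑ i, ∑ j, stdVol n (Function.update (Function.update v i w) j (if j = i then B i else A i j)) =
      ∑ i, stdVol n (Function.update v i (B i)) := by
  set T : Fin (n + 1) → Fin (n + 1) → ℝ := fun i j =>
    if j = i then 0 else stdVol n (Function.update (Function.update v i w) j (A i j)) with hT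
  have hanti : ∀ i j, T i j = - T j i := by
    intro i j
    by_cases hij : j = i
    · simp [hT, hij]
    · simp only [hT, if_neg hij, if_neg (Ne.symm hij)]
      rw [← AlternatingMap.map_swap _ _ hij]
      congr 1
      ext k
      rw [hA j i]
      by_cases h1 : k = i
      · subst h1; simp [Ne.symm hij, hij]
      · by_cases h2 : k = j
        · subst h2; simp
        · simp [Equiv.swap_apply_of_ne_of_ne h2 h1, h1, h2]
  have hsum : ∑ i, ∑ j, T i j = 0 := by
    have h1 : ∑ i, ∑ j, T i j = ∑ i, ∑ j, - T i j := by
      rw [Finset.sum_comm]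
      exact Finset.sum_congr rfl fun i _ => Finset.sum_congr rfl fun j _ => hanti j i
    simp only [Finset.sum_neg_distrib] at h1
    linarith
  have : ∀ i j, stdVol n (Function.update (Function.update v i w) j
      (if j = i then B i else A i j)) =
      T i j + if j = i then stdVol n (Function.update v i (B i)) else 0 := by
    intro i j
    by_cases hij : j = i
    · subst hij; simp [hT]
    · simp [hT, hij]
  simp only [this, Finset.sum_add_distrib, hsum]
  simp

variable {E' : Type*} [NormedAddCommGroup E'] [NormedSpace ℝ E']

/-- Differentiability of `G` is required only within a set `R` that contains the nearby values of
`F`. In the application `R` is the range of the target model: an interior point of `M₁` may be sent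
to `∂M₂`, where `√det g₂` is controlled only from one side. -/
lemma hasFDerivWithinAt_mul_stdVol {P : Type*} [NormedAddCommGroup P] [NormedSpace ℝ P]
    {s : Set P} {x : P} {F : P → E'} {F' : P →L[ℝ] E'} {G : E' → ℝ} {G' : E' →L[ℝ] ℝ} {R : Set E'}
    {u : Fin (n + 1) → P → EuclideanSpace ℝ (Fin (n + 1))}
    {u' : Fin (n + 1) → P →L[ℝ] EuclideanSpace ℝ (Fin (n + 1))}
    (hG : HasFDerivWithinAt G G' R (F x)) (hF : HasFDerivWithinAt F F' s x)
    (hR : ∀ᶠ z in 𝓝[s] x, F z ∈ R) (hu : ∀ i, HasFDerivWithinAt (u i) (u' i) s x) :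
    HasFDerivWithinAt (fun z => G (F z) * stdVol n (fun i => u i z))
      (G (F x) • (∑ i, ((stdVolCM n).toContinuousLinearMap (fun j => u j x) i) ∘L (u' i)) +
        stdVol n (fun i => u i x) • (G' ∘L F')) s x := by
  have h1 : HasFDerivWithinAt (fun z => G (F z)) (G' ∘L F') s x := by
    have hF' : HasFDerivWithinAt F F' (s ∩ F ⁻¹' R) x := hF.mono inter_subset_left
    have := hG.comp x hF' (fun z hz => hz.2)
    refine this.mono_of_mem_nhdsWithin ?_
    exact Filter.inter_mem self_mem_nhdsWithin hR
  exact h1.mul (HasFDerivWithinAt.multilinear_comp (f := stdVolCM n) hu)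

/-- The divergence of the flux `Xⁱ = G(F) det(∂₀F, …, S, …, ∂ₙF)`. -/
theorem sum_fderiv_flux {F S : EuclideanSpace ℝ (Fin (n + 1)) → EuclideanSpace ℝ (Fin (n + 1))}
    {G : EuclideanSpace ℝ (Fin (n + 1)) → ℝ} {G' : EuclideanSpace ℝ (Fin (n + 1)) →L[ℝ] ℝ}
    {R : Set (EuclideanSpace ℝ (Fin (n + 1)))} {x : EuclideanSpace ℝ (Fin (n + 1))}
    (hF : ContDiffAt ℝ 2 F x) (hS : DifferentiableAt ℝ S x)
    (hG : HasFDerivWithinAt G G' R (F x)) (hR : ∀ᶠ z in 𝓝 x, F z ∈ R) :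
    ∑ i, fderiv ℝ (fun z => G (F z) * stdVol n (Function.update
        (fun j => fderiv ℝ F z (EuclideanSpace.single j 1)) i (S z))) x (EuclideanSpace.single i 1) =
      G' (S x) * stdVol n (fun j => fderiv ℝ F x (EuclideanSpace.single j 1)) +
        G (F x) * ∑ i, stdVol n (Function.update
          (fun j => fderiv ℝ F x (EuclideanSpace.single j 1)) i
          (fderiv ℝ S x (EuclideanSpace.single i 1))) := by
  set e : Fin (n + 1) → EuclideanSpace ℝ (Fin (n + 1)) := fun j => EuclideanSpace.single j 1 with he
  have hFd : HasFDerivAt F (fderiv ℝ F x) x := (hF.differentiableAt two_ne_zero).hasFDerivAt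
  have hDF : DifferentiableAt ℝ (fderiv ℝ F) x :=
    (hF.fderiv_right (m := 1) (by norm_num)).differentiableAt one_ne_zero
  have hsymm : IsSymmSndFDerivAt ℝ F x := hF.isSymmSndFDerivAt (by simp)
  -- In the direction `eᵢ`, column `i` contributes `∂ᵢS`, column `j ≠ i` contributes `∂ᵢ∂ⱼF`, and
  -- the factor `G(F)` contributes `G'(∂ᵢF)`.
  have hX : ∀ i, fderiv ℝ (fun z => G (F z) * stdVol n (Function.update
      (fun j => fderiv ℝ F z (e j)) i (S z))) x (e i) =
      G (F x) * ∑ j, stdVol n (Function.update (Function.update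
        (fun j => fderiv ℝ F x (e j)) i (S x)) j (if j = i then fderiv ℝ S x (e i) else
          fderiv ℝ (fderiv ℝ F) x (e i) (e j))) +
      G' (fderiv ℝ F x (e i)) * stdVol n (Function.update
        (fun j => fderiv ℝ F x (e j)) i (S x)) := by
    intro i
    have hu : ∀ j, HasFDerivWithinAt (fun z => Function.update (fun j => fderiv ℝ F z (e j)) i (S z) j)
        (if j = i then fderiv ℝ S x else (fderiv ℝ (fderiv ℝ F) x).flip (e j)) univ x := by
      intro j
      by_cases hij : j = i
      · subst hij; simpa using hS.hasFDerivAt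
      · simp only [Function.update_of_ne hij, if_neg hij]
        exact hasFDerivWithinAt_clm_apply_const hDF.hasFDerivAt.hasFDerivWithinAt (e j)
    have := hasFDerivWithinAt_mul_stdVol hG hFd.hasFDerivWithinAt (by simpa using hR) hu
    rw [hasFDerivWithinAt_univ] at this
    rw [this.fderiv]
    simp only [add_apply, smul_apply,
      sum_apply, ContinuousLinearMap.comp_apply, smul_eq_mul]
    congr 1
    · congr 1
      refine Finset.sum_congr rfl fun j _ => ?_
      simp only [ContinuousMultilinearMap.toContinuousLinearMap_apply, stdVolCM_apply]
      congr 2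
      split_ifs <;> rfl
    · rw [mul_comm]
  -- Summed over `i`, the Hessian terms cancel, and Cramer's rule turns the sum of the `G'(∂ᵢF)`
  -- terms into `G'(S) det DF`.
  rw [Finset.sum_congr rfl fun i _ => hX i, Finset.sum_add_distrib, ← Finset.mul_sum,
    sum_sum_stdVol_update_update _ _ (fun i j => fderiv ℝ (fderiv ℝ F) x (e i) (e j))
      (fun i j => hsymm _ _) (fun i => fderiv ℝ S x (e i)),
    show ∑ i, G' (fderiv ℝ F x (e i)) * stdVol n (Function.update
        (fun j => fderiv ℝ F x (e j)) i (S x)) = _ from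
      sum_stdVol_update_mul G'.toLinearMap (fun j => fderiv ℝ F x (e j)) (S x)]
  rw [add_comm]; rfl

/-- The derivative of `G(F) det(∂₀F, …, ∂ₙF)` in a one-parameter family. -/
theorem hasDerivAt_mul_stdVol_family
    {F : ℝ → EuclideanSpace ℝ (Fin (n + 1)) → EuclideanSpace ℝ (Fin (n + 1))}
    {S : EuclideanSpace ℝ (Fin (n + 1)) → EuclideanSpace ℝ (Fin (n + 1))}
    {G : EuclideanSpace ℝ (Fin (n + 1)) → ℝ} {G' : EuclideanSpace ℝ (Fin (n + 1)) →L[ℝ] ℝ}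
    {R : Set (EuclideanSpace ℝ (Fin (n + 1)))} {x : EuclideanSpace ℝ (Fin (n + 1))}
    (hF : ContDiffAt ℝ 2 (fun q : ℝ × EuclideanSpace ℝ (Fin (n + 1)) => F q.1 q.2) (0, x))
    (hS : ∀ᶠ z in 𝓝 x, HasDerivAt (fun t => F t z) (S z) 0)
    (hG : HasFDerivWithinAt G G' R (F 0 x)) (hR : ∀ᶠ t in 𝓝 (0 : ℝ), F t x ∈ R) :
    HasDerivAt (fun t => G (F t x) * stdVol n
        (fun j => fderiv ℝ (F t) x (EuclideanSpace.single j 1)))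
      (G' (S x) * stdVol n (fun j => fderiv ℝ (F 0) x (EuclideanSpace.single j 1)) +
        G (F 0 x) * ∑ i, stdVol n (Function.update
          (fun j => fderiv ℝ (F 0) x (EuclideanSpace.single j 1)) i
          (fderiv ℝ S x (EuclideanSpace.single i 1)))) 0 := by
  set e : Fin (n + 1) → EuclideanSpace ℝ (Fin (n + 1)) := fun j => EuclideanSpace.single j 1 with he
  set Φ : ℝ × EuclideanSpace ℝ (Fin (n + 1)) → EuclideanSpace ℝ (Fin (n + 1)) :=
    fun q => F q.1 q.2 with hΦ
  have hDΦ : DifferentiableAt ℝ (fderiv ℝ Φ) (0, x) :=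
    (hF.fderiv_right (m := 1) (by norm_num)).differentiableAt one_ne_zero
  -- Symmetry in the joint variable `(t, x)` is what identifies `∂ₜ∂ⱼF` with `∂ⱼS`.
  have hsymm : IsSymmSndFDerivAt ℝ Φ (0, x) := hF.isSymmSndFDerivAt (by simp)
  have hdiff : ∀ᶠ q in 𝓝 ((0 : ℝ), x), DifferentiableAt ℝ Φ q := by
    filter_upwards [(hF.of_le one_le_two).eventually (by simp)] with q hq
    exact hq.differentiableAt one_ne_zero
  have hL : ∀ t : ℝ, HasFDerivAt (fun z : EuclideanSpace ℝ (Fin (n + 1)) => (t, z))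
      (ContinuousLinearMap.inr ℝ ℝ _) x := fun t => hasFDerivAt_prodMk_right t x
  have htx : ∀ᶠ t in 𝓝 (0 : ℝ), fderiv ℝ (F t) x =
      fderiv ℝ Φ (t, x) ∘L ContinuousLinearMap.inr ℝ ℝ _ := by
    have : Filter.Tendsto (fun t : ℝ => (t, x)) (𝓝 0) (𝓝 (0, x)) :=
      (Continuous.prodMk_left x).tendsto 0
    filter_upwards [this.eventually hdiff] with t ht
    exact (ht.hasFDerivAt.comp x (hL t)).fderiv
  have hzx : S =ᶠ[𝓝 x] fun z => fderiv ℝ Φ (0, z) (1, 0) := by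
    have : Filter.Tendsto (fun z => ((0 : ℝ), z)) (𝓝 x) (𝓝 (0, x)) :=
      (Continuous.prodMk_right (0 : ℝ)).tendsto x
    filter_upwards [this.eventually hdiff, hS] with z hz hSz
    have := hz.hasFDerivAt.comp_hasDerivAt (0 : ℝ)
      ((hasDerivAt_id (0 : ℝ)).prodMk (hasDerivAt_const (0 : ℝ) z))
    exact hSz.unique this
  have hSx : fderiv ℝ S x = (fderiv ℝ (fderiv ℝ Φ) (0, x) ∘L ContinuousLinearMap.inr ℝ ℝ _).flip
      (1, 0) := by
    rw [hzx.fderiv_eq]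
    have h1 := hDΦ.hasFDerivAt.comp x (hL 0)
    exact (hasFDerivWithinAt_univ.1
      (hasFDerivWithinAt_clm_apply_const h1.hasFDerivWithinAt (1, 0))).fderiv
  have hline : HasFDerivAt (fun t : ℝ => (t, x)) (ContinuousLinearMap.inl ℝ ℝ _) 0 :=
    hasFDerivAt_prodMk_left 0 x
  have hu : ∀ j, HasFDerivWithinAt (fun t : ℝ => fderiv ℝ (F t) x (e j))
      ((fderiv ℝ (fderiv ℝ Φ) (0, x) ∘L ContinuousLinearMap.inl ℝ ℝ _).flip (0, e j)) univ 0 := by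
    intro j
    have h1 := hDΦ.hasFDerivAt.comp (0 : ℝ) hline
    have h2 := hasFDerivWithinAt_clm_apply_const h1.hasFDerivWithinAt (s := univ) (0, e j)
    rw [hasFDerivWithinAt_univ] at h2 ⊢
    refine h2.congr_of_eventuallyEq ?_
    filter_upwards [htx] with t ht
    rw [ht]; simp
  have hFt : HasFDerivAt (fun t => F t x) (fderiv ℝ Φ (0, x) ∘L ContinuousLinearMap.inl ℝ ℝ _) 0 :=
    HasFDerivAt.comp (g := Φ) (0 : ℝ) hdiff.self_of_nhds.hasFDerivAt hline
  have := hasFDerivWithinAt_mul_stdVol (F := fun t => F t x) hG hFt.hasFDerivWithinAt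
    (by simpa using hR) hu
  rw [hasFDerivWithinAt_univ] at this
  convert this.hasDerivAt using 1
  simp only [add_apply, smul_apply,
      sum_apply, ContinuousLinearMap.comp_apply, smul_eq_mul,
      ContinuousMultilinearMap.toContinuousLinearMap_apply, stdVolCM_apply, hSx,
      ContinuousLinearMap.flip_apply, ContinuousLinearMap.inl_apply, ContinuousLinearMap.inr_apply,
      hzx.self_of_nhds]
  rw [add_comm, mul_comm (G' _)]
  congr 2
  refine Finset.sum_congr rfl fun j _ => ?_
  rw [hsymm]

end Calculus

/-! ### The tangent bundle in charts -/

section Charts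

variable {n : ℕ} {H : Type*} [TopologicalSpace H]
  (I : ModelWithCorners ℝ (EuclideanSpace ℝ (Fin (n + 1))) H)
  {M : Type*} [TopologicalSpace M] [ChartedSpace H M] [IsManifold I ∞ M]

/-- The coordinates of a tangent vector at `p` in the chart centred at `q`. -/
def coords (q p : M) : TangentSpace I p →L[ℝ] EuclideanSpace ℝ (Fin (n + 1)) :=
  (trivializationAt (EuclideanSpace ℝ (Fin (n + 1))) (TangentSpace I) q).continuousLinearMapAt ℝ p

/-- The tangent vector at `p` with given coordinates in the chart centred at `q`. -/
def ofCoords (q p : M) : EuclideanSpace ℝ (Fin (n + 1)) →L[ℝ] TangentSpace I p :=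
  (trivializationAt (EuclideanSpace ℝ (Fin (n + 1))) (TangentSpace I) q).symmL ℝ p

variable {I} {q p : M}

lemma mem_baseSet (hp : p ∈ (extChartAt I q).source) :
    p ∈ (trivializationAt (EuclideanSpace ℝ (Fin (n + 1))) (TangentSpace I) q).baseSet := by
  simpa using hp

lemma coords_eq (hp : p ∈ (extChartAt I q).source) (v : TangentSpace I p) :
    coords I q p v = (trivializationAt (EuclideanSpace ℝ (Fin (n + 1))) (TangentSpace I) q ⟨p, v⟩).2 := by
  rw [coords, Bundle.Trivialization.continuousLinearMapAt_apply,
    Bundle.Trivialization.coe_linearMapAt_of_mem _ (mem_baseSet hp)]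

lemma coords_ofCoords (hp : p ∈ (extChartAt I q).source) (v : EuclideanSpace ℝ (Fin (n + 1))) :
    coords I q p (ofCoords I q p v) = v :=
  Bundle.Trivialization.continuousLinearMapAt_symmL _ (mem_baseSet hp) v

lemma ofCoords_coords (hp : p ∈ (extChartAt I q).source) (v : TangentSpace I p) :
    ofCoords I q p (coords I q p v) = v :=
  Bundle.Trivialization.symmL_continuousLinearMapAt _ (mem_baseSet hp) v

lemma ofCoords_single (i : Fin (n + 1)) :
    ofCoords I q p (EuclideanSpace.single i 1) = coordVec I q p i := rfl

lemma contMDiffOn_coordVec (i : Fin (n + 1)) :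
    ContMDiffOn I I.tangent ∞ (fun p : M => (⟨p, coordVec I q p i⟩ : TangentBundle I M))
      (extChartAt I q).source := by
  set e := trivializationAt (EuclideanSpace ℝ (Fin (n + 1))) (TangentSpace I : M → Type _) q
  have : MapsTo (fun p : M => (⟨p, coordVec I q p i⟩ : TangentBundle I M))
      (extChartAt I q).source e.source := by
    intro p hp
    rw [e.mem_source]
    exact mem_baseSet hp
  refine (e.contMDiffOn_iff this).2 ⟨contMDiffOn_id, ?_⟩
  refine contMDiffOn_const (c := EuclideanSpace.single i (1 : ℝ)) |>.congr fun p hp => ?_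
  rw [← coords_eq hp, ← ofCoords_single, coords_ofCoords hp]

variable [RiemannianBundle (fun x : M => TangentSpace I x)]

/-- Evaluation of a volume form in coordinates. -/
lemma volumeForm_eq_stdVol (hp : p ∈ (extChartAt I q).source)
    (o : Orientation ℝ (TangentSpace I p) (Fin (n + 1))) (w : Fin (n + 1) → TangentSpace I p) :
    o.volumeForm w = o.volumeForm (coordVec I q p) * stdVol n (fun j => coords I q p (w j)) := by
  have h := AlternatingMap.eq_smul_basis_det (EuclideanSpace.basisFun (Fin (n + 1)) ℝ).toBasis
    (o.volumeForm.compLinearMap (ofCoords I q p).toLinearMap)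
  have h2 := DFunLike.congr_fun h (fun j => coords I q p (w j))
  rw [← stdVol_eq_det] at h2
  simpa [ofCoords_coords hp, ofCoords_single] using h2

lemma volumeForm_coordVec_ne_zero (hp : p ∈ (extChartAt I q).source)
    (o : Orientation ℝ (TangentSpace I p) (Fin (n + 1))) :
    o.volumeForm (coordVec I q p) ≠ 0 := by
  intro h
  have := volumeForm_eq_stdVol hp o (orientedBasis o)
  rw [h, volumeForm_orientedBasis, zero_mul] at this
  exact one_ne_zero this

variable (I) in
/-- The density `√(det g)` of the Riemannian volume in the chart centred at `q`. -/
def density (q : M) (y : EuclideanSpace ℝ (Fin (n + 1))) : ℝ := Real.sqrt (gram I q y).det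

lemma abs_volumeForm_coordVec (hp : p ∈ (extChartAt I q).source)
    (o : Orientation ℝ (TangentSpace I p) (Fin (n + 1))) :
    |o.volumeForm (coordVec I q p)| = density I q (extChartAt I q p) := by
  rw [abs_volumeForm_eq_sqrt, density, gram, (extChartAt I q).left_inv hp]

lemma density_pos {y : EuclideanSpace ℝ (Fin (n + 1))} (hy : y ∈ (extChartAt I q).target) :
    0 < density I q y := by
  have hp := (extChartAt I q).map_target hy
  -- Any orientation of this single tangent space will do, because only the absolute value of its
  -- volume form enters.
  let o : Orientation ℝ (TangentSpace I ((extChartAt I q).symm y)) (Fin (n + 1)) :=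
    (stdOrthonormalBasis ℝ (TangentSpace I ((extChartAt I q).symm y))).toBasis.reindex
      (finCongr Fact.out) |>.orientation
  rw [← (extChartAt I q).right_inv hy, ← abs_volumeForm_coordVec hp o]
  exact abs_pos.2 (volumeForm_coordVec_ne_zero hp o)

lemma det_gram_pos {y : EuclideanSpace ℝ (Fin (n + 1))} (hy : y ∈ (extChartAt I q).target) :
    0 < (gram I q y).det :=
  Real.sqrt_pos.1 (density_pos hy)

/-- The size of the volume form on the coordinate frame is the density, and `IsOrientation` makes
its sign locally constant. Coordinate computations thus see the orientation only through one number
`±1`. -/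
lemma exists_sign {o : ∀ x : M, Orientation ℝ (TangentSpace I x) (Fin (n + 1))}
    (ho : IsOrientation I o) (q : M) :
    ∃ s : ℝ, (s = 1 ∨ s = -1) ∧ ∀ᶠ p in 𝓝 q,
      (o p).volumeForm (coordVec I q p) = s * density I q (extChartAt I q p) := by
  have hsrc := extChartAt_source_mem_nhds (I := I) q
  by_cases h : 0 < (o q).volumeForm (coordVec I q q)
  · refine ⟨1, .inl rfl, ?_⟩
    filter_upwards [ho q, hsrc] with p hp hps
    rw [← abs_volumeForm_coordVec hps (o p), abs_of_pos (hp.2 h), one_mul]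
  · refine ⟨-1, .inr rfl, ?_⟩
    filter_upwards [ho q, hsrc] with p hp hps
    rw [← abs_volumeForm_coordVec hps (o p), abs_of_nonpos (not_lt.1 fun h' => h (hp.1 h'))]
    ring

variable [IsContMDiffRiemannianBundle I ∞ (EuclideanSpace ℝ (Fin (n + 1)))
      (fun x : M => TangentSpace I x)]

lemma contDiffOn_gram (i j : Fin (n + 1)) :
    ContDiffOn ℝ ∞ (fun y => gram I q y i j) (extChartAt I q).target := by
  rw [← contMDiffOn_iff_contDiffOn]
  have h := (contMDiffOn_coordVec (I := I) (q := q) i).inner_bundle (contMDiffOn_coordVec j)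
  exact h.comp (contMDiffOn_extChartAt_symm q) fun y hy => (extChartAt I q).map_target hy

lemma contDiffOn_det_gram :
    ContDiffOn ℝ ∞ (fun y => (gram I q y).det) (extChartAt I q).target := by
  simp only [Matrix.det_apply']
  exact ContDiffOn.sum fun σ _ => contDiffOn_const.mul
    (contDiffOn_prod fun i _ => contDiffOn_gram _ _)

lemma contDiffOn_density : ContDiffOn ℝ ∞ (density I q) (extChartAt I q).target :=
  contDiffOn_det_gram.sqrt fun _ hy => (det_gram_pos hy).ne'

end Charts

/-! ### The trace of the Christoffel symbols -/

section Christoffel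

variable {n : ℕ}

/-- The Jacobi formula for the derivative of a determinant. -/
lemma hasFDerivWithinAt_det {P : Type*} [NormedAddCommGroup P] [NormedSpace ℝ P] {s : Set P} {x : P}
    {A : P → Matrix (Fin (n + 1)) (Fin (n + 1)) ℝ} {A' : Fin (n + 1) → Fin (n + 1) → P →L[ℝ] ℝ}
    (hA : ∀ i j, HasFDerivWithinAt (fun y => A y i j) (A' i j) s x) :
    HasFDerivWithinAt (fun y => (A y).det) (∑ i, ∑ j, (A x).adjugate j i • A' i j) s x := by
  have hrow : ∀ i, HasFDerivWithinAt (fun y => WithLp.toLp 2 (A y i))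
      (∑ j, (A' i j).smulRight (EuclideanSpace.single j (1 : ℝ))) s x := by
    intro i
    have h : HasFDerivWithinAt (fun y => ∑ j, A y i j • EuclideanSpace.single j (1 : ℝ))
        (∑ j, (A' i j).smulRight (EuclideanSpace.single j (1 : ℝ))) s x :=
      HasFDerivWithinAt.fun_sum fun j _ => (hA i j).smul_const _
    refine h.congr_of_eventuallyEq (.of_forall fun y => ?_) ?_ <;>
    · ext k
      simp [Finset.sum_apply, Pi.single_apply]
  have hdet : ∀ B : Matrix (Fin (n + 1)) (Fin (n + 1)) ℝ,
      B.det = stdVol n (fun i => WithLp.toLp 2 (B i)) := by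
    intro B
    rw [stdVol_eq_det, Basis.det_apply, ← Matrix.det_transpose]
    congr 1
  have := HasFDerivWithinAt.multilinear_comp (f := stdVolCM n) hrow
  simp only [stdVolCM_apply, ← hdet] at this
  refine this.congr_fderiv ?_
  ext w
  simp only [sum_apply, smul_apply, ContinuousLinearMap.comp_apply,
    ContinuousMultilinearMap.toContinuousLinearMap_apply, stdVolCM_apply, smul_eq_mul,
    ContinuousLinearMap.smulRight_apply]
  refine Finset.sum_congr rfl fun i _ => ?_
  -- Replacing row `i` by its derivative produces a Cramer determinant, whose expansion has the
  -- adjugate entries as coefficients.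
  have h1 : (fun k => WithLp.toLp 2 ((A x).updateRow i (fun j => A' i j w) k)) =
      Function.update (fun k => WithLp.toLp 2 (A x k)) i
        (∑ j, A' i j w • EuclideanSpace.single j (1 : ℝ)) := by
    funext k
    by_cases hk : k = i
    · subst hk
      ext l
      simp [Finset.sum_apply, Pi.single_apply]
    · simp [hk]
  rw [← h1, ← hdet, ← Matrix.cramer_transpose_apply, Matrix.cramer_eq_adjugate_mulVec,
    ← Matrix.adjugate_transpose]
  simp [Matrix.mulVec, dotProduct]

/-- This is the derivative of `det(1 + tT) det v` at `t = 0`. The common factor is found on the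
standard frame, where Cramer's rule gives the diagonal entries of `T`. -/
lemma sum_stdVol_update_clm (T : EuclideanSpace ℝ (Fin (n + 1)) →ₗ[ℝ] EuclideanSpace ℝ (Fin (n + 1)))
    (v : Fin (n + 1) → EuclideanSpace ℝ (Fin (n + 1))) :
    ∑ i, stdVol n (Function.update v i (T (v i))) =
      (∑ i, T (EuclideanSpace.single i 1) i) * stdVol n v := by
  have h := sum_volumeForm_update (stdOrientation n) (stdOrientation n) T LinearMap.id v
  have h0 := sum_volumeForm_update (stdOrientation n) (stdOrientation n) T LinearMap.id
    (fun i => EuclideanSpace.single i 1)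
  simp only [LinearMap.id_coe, CompTriple.comp_eq] at h h0
  change ∑ i, stdVol n _ = _ * stdVol n _ at h
  change ∑ i, stdVol n _ = _ * stdVol n _ at h0
  rw [stdVol_single, mul_one] at h0
  rw [h, ← h0]
  congr 1
  refine Finset.sum_congr rfl fun i _ => ?_
  have hc := sum_stdVol_update_mul (EuclideanSpace.proj i : EuclideanSpace ℝ (Fin (n + 1)) →L[ℝ] ℝ).toLinearMap
    (fun i => EuclideanSpace.single i 1) (T (EuclideanSpace.single i 1))
  rw [stdVol_single, mul_one] at hc
  have : ∀ x : Fin (n + 1), (EuclideanSpace.proj i : EuclideanSpace ℝ (Fin (n + 1)) →L[ℝ] ℝ).toLinearMap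
      (EuclideanSpace.single x (1 : ℝ)) = if i = x then 1 else 0 := by
    intro x; simp
  simp only [this] at hc
  simpa using hc

variable {H : Type*} [TopologicalSpace H]
  {I : ModelWithCorners ℝ (EuclideanSpace ℝ (Fin (n + 1))) H}
  {M : Type*} [TopologicalSpace M] [ChartedSpace H M] [IsManifold I ∞ M]
  [RiemannianBundle (fun x : M => TangentSpace I x)]

lemma gram_comm (q : M) (y : EuclideanSpace ℝ (Fin (n + 1))) (i j : Fin (n + 1)) :
    gram I q y i j = gram I q y j i := by
  simp only [gram, Matrix.of_apply]
  exact real_inner_comm _ _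

lemma gramDeriv_comm (q : M) (y : EuclideanSpace ℝ (Fin (n + 1))) (k i j : Fin (n + 1)) :
    gramDeriv I q y k i j = gramDeriv I q y k j i := by
  simp only [gramDeriv, gram_comm q _ i j]

lemma gram_inv_comm (q : M) (y : EuclideanSpace ℝ (Fin (n + 1))) (i j : Fin (n + 1)) :
    (gram I q y)⁻¹ i j = (gram I q y)⁻¹ j i := by
  have h : (gram I q y).transpose = gram I q y := by
    ext i j; exact gram_comm q y j i
  conv_lhs => rw [← h, ← Matrix.transpose_nonsing_inv]
  rfl

/-- In the contraction `Γᵏₖⱼ` the terms with `∂ₖ gⱼₗ` and `∂ₗ gₖⱼ` cancel by symmetry of `gᵏˡ`. Only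
`½ gᵏˡ ∂ⱼ gₖₗ` is left, the form that Jacobi's formula produces. -/
lemma christoffelMap_trace (q : M) (w : EuclideanSpace ℝ (Fin (n + 1))) :
    ∑ k, christoffelMap I q w (EuclideanSpace.single k 1) k =
      (1 / 2) * ∑ j, w j * ∑ k, ∑ l, (gram I q (extChartAt I q q))⁻¹ k l *
        gramDeriv I q (extChartAt I q q) j k l := by
  set y := extChartAt I q q
  have h1 : ∀ k, christoffelMap I q w (EuclideanSpace.single k 1) k =
      ∑ j, christoffel I q y k k j * w j := by
    intro k
    simp [christoffelMap, Pi.single_apply, Finset.sum_apply, y]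
  have h2 : ∀ j, ∑ k, christoffel I q y k k j = (1 / 2) * ∑ k, ∑ l, (gram I q y)⁻¹ k l *
      gramDeriv I q y j k l := by
    intro j
    have hswap : ∑ k, ∑ l, (gram I q y)⁻¹ k l * gramDeriv I q y k j l =
        ∑ k, ∑ l, (gram I q y)⁻¹ k l * gramDeriv I q y l k j := by
      rw [Finset.sum_comm]
      refine Finset.sum_congr rfl fun k _ => Finset.sum_congr rfl fun l _ => ?_
      rw [gram_inv_comm, gramDeriv_comm]
    simp only [christoffel, ← Finset.mul_sum, mul_sub, mul_add, Finset.sum_sub_distrib,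
      Finset.sum_add_distrib, hswap]
    ring
  simp only [h1]
  rw [Finset.sum_comm]
  simp only [← Finset.sum_mul, h2, Finset.mul_sum]
  refine Finset.sum_congr rfl fun j _ => ?_
  simp only [Finset.sum_mul]
  refine Finset.sum_congr rfl fun k _ => Finset.sum_congr rfl fun l _ => ?_
  ring

variable [IsContMDiffRiemannianBundle I ∞ (EuclideanSpace ℝ (Fin (n + 1)))
      (fun x : M => TangentSpace I x)]

/-- The logarithmic derivative of `√(det g)` is the trace of the Christoffel symbols. -/
theorem fderivWithin_density (q : M) (w : EuclideanSpace ℝ (Fin (n + 1))) :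
    fderivWithin ℝ (density I q) (range I) (extChartAt I q q) w =
      (∑ k, christoffelMap I q w (EuclideanSpace.single k 1) k) *
        density I q (extChartAt I q q) := by
  set y := extChartAt I q q with hy
  have hyt : y ∈ (extChartAt I q).target := mem_extChartAt_target q
  have hu := I.uniqueDiffOn.uniqueDiffWithinAt (extChartAt_target_subset_range q hyt)
  have hg : ∀ i j, HasFDerivWithinAt (fun z => gram I q z i j)
      (fderivWithin ℝ (fun z => gram I q z i j) (range I) y) (range I) y := by
    intro i j
    have := ((contDiffOn_gram (I := I) (q := q) i j).differentiableOn (by simp) y hyt)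
    exact (this.mono_of_mem_nhdsWithin (extChartAt_target_mem_nhdsWithin q)).hasFDerivWithinAt
  have hpos := det_gram_pos hyt
  have hd := (hasFDerivWithinAt_det hg).sqrt hpos.ne'
  have hw : ∀ i j, fderivWithin ℝ (fun z => gram I q z i j) (range I) y w =
      ∑ k, w k * gramDeriv I q y k i j := by
    intro i j
    conv_lhs => rw [← (EuclideanSpace.basisFun (Fin (n + 1)) ℝ).sum_repr w]
    simp [gramDeriv]
  rw [show density I q = fun z => Real.sqrt (gram I q z).det from rfl, hd.fderivWithin hu,
    christoffelMap_trace]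
  simp only [smul_apply, sum_apply, smul_eq_mul, hw, ← hy]
  -- Symmetry of the inverse metric absorbs the index exchange in Jacobi's formula.
  have hinv : ∀ i j, (gram I q y).adjugate j i = (gram I q y).det * (gram I q y)⁻¹ i j := by
    intro i j
    rw [gram_inv_comm, Matrix.inv_def]
    simp [hpos.ne']
  have hs : Real.sqrt (gram I q y).det * Real.sqrt (gram I q y).det = (gram I q y).det :=
    Real.mul_self_sqrt hpos.le
  have hsum : ∑ i, ∑ j, (gram I q y).adjugate j i * ∑ k, w k * gramDeriv I q y k i j =
      (gram I q y).det * ∑ j, w j * ∑ k, ∑ l, (gram I q y)⁻¹ k l * gramDeriv I q y j k l := by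
    simp only [hinv, Finset.mul_sum]
    rw [Finset.sum_congr rfl fun i _ => Finset.sum_comm, Finset.sum_comm]
    refine Finset.sum_congr rfl fun j _ => Finset.sum_congr rfl fun k _ =>
      Finset.sum_congr rfl fun l _ => ?_
    ring
  rw [hsum, ← hs]
  have := Real.sqrt_pos.2 hpos
  rw [Real.mul_self_sqrt hpos.le]
  field_simp
  rw [Real.sq_sqrt hpos.le]

end Christoffel

/-! ### Maps in charts -/

section MapsInCharts

variable {n : ℕ}
  {H₁ : Type*} [TopologicalSpace H₁] {I₁ : ModelWithCorners ℝ (EuclideanSpace ℝ (Fin (n + 1))) H₁}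
  {M₁ : Type*} [TopologicalSpace M₁] [ChartedSpace H₁ M₁] [IsManifold I₁ ∞ M₁]
  {H₂ : Type*} [TopologicalSpace H₂] {I₂ : ModelWithCorners ℝ (EuclideanSpace ℝ (Fin (n + 1))) H₂}
  {M₂ : Type*} [TopologicalSpace M₂] [ChartedSpace H₂ M₂] [IsManifold I₂ ∞ M₂]

/-- The trivialisation of the tangent bundle at `x₀` is the differential of the chart. This links
`coordVec` and `ofCoords` with actual derivatives in coordinates. -/
lemma hasMFDerivWithinAt_extChartAt_symm {x₀ : M₁} {y : EuclideanSpace ℝ (Fin (n + 1))}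
    (hy : y ∈ (extChartAt I₁ x₀).target) :
    HasMFDerivWithinAt 𝓘(ℝ, EuclideanSpace ℝ (Fin (n + 1))) I₁ (extChartAt I₁ x₀).symm (range I₁)
      y (ofCoords I₁ x₀ ((extChartAt I₁ x₀).symm y)) := by
  have : IsManifold I₁ 1 M₁ := .of_le (n := ∞) (by simp)
  have h := (mdifferentiableWithinAt_extChartAt_symm (I := I₁) hy).hasMFDerivWithinAt
  have hp := (extChartAt I₁ x₀).map_target hy
  rw [ofCoords, TangentBundle.symmL_trivializationAt (by simpa using hp),
    (extChartAt I₁ x₀).right_inv hy]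
  exact h

lemma hasMFDerivAt_extChartAt_coords {q p : M₂} (hp : p ∈ (extChartAt I₂ q).source) :
    HasMFDerivAt I₂ 𝓘(ℝ, EuclideanSpace ℝ (Fin (n + 1))) (extChartAt I₂ q) p (coords I₂ q p) := by
  have : IsManifold I₂ 1 M₂ := .of_le (n := ∞) (by simp)
  have h := (mdifferentiableAt_extChartAt (I := I₂) (x := q) (y := p) (by simpa using hp)).hasMFDerivAt
  rw [coords, TangentBundle.continuousLinearMapAt_trivializationAt (by simpa using hp)]
  exact h

/-- The derivative of a vector-valued function in the chart centred at `x₀`. -/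
lemma hasFDerivWithinAt_comp_extChartAt_symm {F : Type*} [NormedAddCommGroup F] [NormedSpace ℝ F]
    {g : M₁ → F} {x₀ p : M₁} {y : EuclideanSpace ℝ (Fin (n + 1))}
    (hy : y ∈ (extChartAt I₁ x₀).target) (hp : (extChartAt I₁ x₀).symm y = p)
    (hg : MDifferentiableAt I₁ 𝓘(ℝ, F) g p) :
    HasFDerivWithinAt (fun y => g ((extChartAt I₁ x₀).symm y))
      (mvfderiv I₁ g p ∘L ofCoords I₁ x₀ p) (range I₁) y := by
  subst hp
  refine hasMFDerivWithinAt_iff_hasFDerivWithinAt.1 ?_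
  exact hg.hasMFDerivAt.comp_hasMFDerivWithinAt _ (hasMFDerivWithinAt_extChartAt_symm hy)

/-- The derivative of a map between manifolds in charts. -/
lemma hasFDerivWithinAt_chart {f : M₁ → M₂} {x₀ p : M₁} {q : M₂}
    {y : EuclideanSpace ℝ (Fin (n + 1))} (hy : y ∈ (extChartAt I₁ x₀).target)
    (hp : (extChartAt I₁ x₀).symm y = p) (hq : f p ∈ (extChartAt I₂ q).source)
    (hf : MDifferentiableAt I₁ I₂ f p) :
    HasFDerivWithinAt (fun y => extChartAt I₂ q (f ((extChartAt I₁ x₀).symm y)))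
      (coords I₂ q (f p) ∘L mfderiv I₁ I₂ f p ∘L ofCoords I₁ x₀ p) (range I₁) y := by
  subst hp
  refine hasMFDerivWithinAt_iff_hasFDerivWithinAt.1 ?_
  exact ((hasMFDerivAt_extChartAt_coords hq).comp _ hf.hasMFDerivAt).comp_hasMFDerivWithinAt _
    (hasMFDerivWithinAt_extChartAt_symm hy)

end MapsInCharts

/-! ### The covariant derivative and the cofactor in charts -/

section Pointwise

variable {n : ℕ}
  {H₁ : Type*} [TopologicalSpace H₁] {I₁ : ModelWithCorners ℝ (EuclideanSpace ℝ (Fin (n + 1))) H₁}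
  {M₁ : Type*} [TopologicalSpace M₁] [ChartedSpace H₁ M₁] [IsManifold I₁ ∞ M₁]
  {H₂ : Type*} [TopologicalSpace H₂] {I₂ : ModelWithCorners ℝ (EuclideanSpace ℝ (Fin (n + 1))) H₂}
  {M₂ : Type*} [TopologicalSpace M₂] [ChartedSpace H₂ M₂] [IsManifold I₂ ∞ M₂]

variable (I₁ I₂) in
/-- A map in the charts centred at `x₀` and `q`. -/
def chartMap (f : M₁ → M₂) (x₀ : M₁) (q : M₂) (y : EuclideanSpace ℝ (Fin (n + 1))) :
    EuclideanSpace ℝ (Fin (n + 1)) :=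
  extChartAt I₂ q (f ((extChartAt I₁ x₀).symm y))

variable (I₁ I₂) in
/-- A vector field along a map in the charts centred at `x₀` and `q`. -/
def chartSection (f : M₁ → M₂) (σ : ∀ p, TangentSpace I₂ (f p)) (x₀ : M₁) (q : M₂)
    (y : EuclideanSpace ℝ (Fin (n + 1))) : EuclideanSpace ℝ (Fin (n + 1)) :=
  coords I₂ q (f ((extChartAt I₁ x₀).symm y)) (σ ((extChartAt I₁ x₀).symm y))

variable {f : M₁ → M₂} {σ : ∀ p, TangentSpace I₂ (f p)} {x₀ p : M₁} {q : M₂}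
  {y : EuclideanSpace ℝ (Fin (n + 1))}

lemma coords_mfderiv_coordVec (hy : y ∈ (extChartAt I₁ x₀).target)
    (hp : (extChartAt I₁ x₀).symm y = p) (hq : f p ∈ (extChartAt I₂ q).source)
    (hf : MDifferentiableAt I₁ I₂ f p) (j : Fin (n + 1)) :
    coords I₂ q (f p) (mfderiv I₁ I₂ f p (coordVec I₁ x₀ p j)) =
      fderivWithin ℝ (chartMap I₁ I₂ f x₀ q) (range I₁) y (EuclideanSpace.single j 1) := by
  have h := (hasFDerivWithinAt_chart hy hp hq hf).fderivWithin
    (I₁.uniqueDiffOn.uniqueDiffWithinAt (extChartAt_target_subset_range x₀ hy))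
  exact (DFunLike.congr_fun h (EuclideanSpace.single j 1)).symm

lemma IsSmoothSection.contMDiffAt_coords (hσ : IsSmoothSection I₁ I₂ f σ)
    (hq : f p ∈ (extChartAt I₂ q).source) :
    ContMDiffAt I₁ 𝓘(ℝ, EuclideanSpace ℝ (Fin (n + 1))) ∞
      (fun p' => coords I₂ q (f p') (σ p')) p := by
  set e := trivializationAt (EuclideanSpace ℝ (Fin (n + 1))) (TangentSpace I₂ : M₂ → Type _) q
  have hmem : (⟨f p, σ p⟩ : TangentBundle I₂ M₂) ∈ e.source := by
    rw [e.mem_source]; exact mem_baseSet hq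
  have h := (e.contMDiffAt_iff (f := fun p' => (⟨f p', σ p'⟩ : TangentBundle I₂ M₂)) hmem).1 (hσ p)
  refine h.2.congr_of_eventuallyEq ?_
  have hc : ContinuousAt f p := h.1.continuousAt
  filter_upwards [hc.preimage_mem_nhds (extChartAt_source_mem_nhds' hq)] with p' hp'
  exact coords_eq hp' _

variable [RiemannianBundle (fun x : M₁ => TangentSpace I₁ x)]
  [RiemannianBundle (fun x : M₂ => TangentSpace I₂ x)]
  {o₁ : ∀ x : M₁, Orientation ℝ (TangentSpace I₁ x) (Fin (n + 1))}
  {o₂ : ∀ x : M₂, Orientation ℝ (TangentSpace I₂ x) (Fin (n + 1))}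

lemma pullbackConnection_apply (v : TangentSpace I₁ p) :
    pullbackConnection I₁ I₂ f σ p v = ofCoords I₂ (f p) (f p)
      (mvfderiv I₁ (fun p' => coords I₂ (f p) (f p') (σ p')) p v +
        christoffelMap I₂ (f p) (coords I₂ (f p) (f p) (σ p))
          (coords I₂ (f p) (f p) (mfderiv I₁ I₂ f p v))) := rfl

variable [IsContMDiffRiemannianBundle I₂ ∞ (EuclideanSpace ℝ (Fin (n + 1)))
      (fun x : M₂ => TangentSpace I₂ x)]

variable (I₁ I₂) in
/-- The variation of `√(det g₂) det(∂₀F, …, ∂ₙF)` in the direction of a vector field, in charts. -/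
def chartVariation (f : M₁ → M₂) (σ : ∀ p, TangentSpace I₂ (f p)) (x₀ : M₁) (q : M₂)
    (y : EuclideanSpace ℝ (Fin (n + 1))) : ℝ :=
  fderivWithin ℝ (density I₂ q) (range I₂) (chartMap I₁ I₂ f x₀ q y)
      (chartSection I₁ I₂ f σ x₀ q y) * stdVol n (fun j =>
      fderivWithin ℝ (chartMap I₁ I₂ f x₀ q) (range I₁) y (EuclideanSpace.single j 1)) +
    density I₂ q (chartMap I₁ I₂ f x₀ q y) * ∑ i, stdVol n (Function.update
      (fun j => fderivWithin ℝ (chartMap I₁ I₂ f x₀ q) (range I₁) y (EuclideanSpace.single j 1)) i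
      (fderivWithin ℝ (chartSection I₁ I₂ f σ x₀ q) (range I₁) y (EuclideanSpace.single i 1)))

/-- The pairing of `∇σ` with the cofactor of `df`, in charts. -/
theorem homInner_pullbackConnection_CofD (hf : ContMDiff I₁ I₂ ∞ f)
    (hσ : IsSmoothSection I₁ I₂ f σ) (hy : y ∈ (extChartAt I₁ x₀).target)
    (hp : (extChartAt I₁ x₀).symm y = p) {s : ℝ}
    (hs : (o₂ (f p)).volumeForm (coordVec I₂ (f p) (f p)) =
      s * density I₂ (f p) (extChartAt I₂ (f p) (f p))) :
    homInner (pullbackConnection I₁ I₂ f σ p) (CofD I₁ I₂ o₁ o₂ f p) *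
      (o₁ p).volumeForm (coordVec I₁ x₀ p) = s * chartVariation I₁ I₂ f σ x₀ (f p) y := by
  have hq : f p ∈ (extChartAt I₂ (f p)).source := mem_extChartAt_source _
  have hfp : MDifferentiableAt I₁ I₂ f p := hf.mdifferentiableAt (by simp)
  have hu := I₁.uniqueDiffOn.uniqueDiffWithinAt (extChartAt_target_subset_range x₀ hy)
  have hFy : chartMap I₁ I₂ f x₀ (f p) y = extChartAt I₂ (f p) (f p) := by rw [chartMap, hp]
  have hSy : chartSection I₁ I₂ f σ x₀ (f p) y = coords I₂ (f p) (f p) (σ p) := by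
    subst hp; rfl
  have hS : fderivWithin ℝ (chartSection I₁ I₂ f σ x₀ (f p)) (range I₁) y =
      mvfderiv I₁ (fun p' => coords I₂ (f p) (f p') (σ p')) p ∘L ofCoords I₁ x₀ p :=
    (hasFDerivWithinAt_comp_extChartAt_symm hy hp
      ((hσ.contMDiffAt_coords hq).mdifferentiableAt (by simp))).fderivWithin hu
  -- The factor `(o₁ p).volumeForm (coordVec I₁ x₀ p)` allows the pairing to be evaluated on the
  -- coordinate frame, which need not be orthonormal.
  rw [CofD, ← sum_volumeForm_update]
  set D := fun j => fderivWithin ℝ (chartMap I₁ I₂ f x₀ (f p)) (range I₁) y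
    (EuclideanSpace.single j 1) with hD
  set Γ := christoffelMap I₂ (f p) (coords I₂ (f p) (f p) (σ p)) with hΓ
  have hcoord : ∀ i, (o₂ (f p)).volumeForm (Function.update
      (differential I₁ I₂ f p ∘ coordVec I₁ x₀ p) i
      (pullbackConnection I₁ I₂ f σ p (coordVec I₁ x₀ p i))) =
      s * density I₂ (f p) (extChartAt I₂ (f p) (f p)) *
        (stdVol n (Function.update D i (fderivWithin ℝ (chartSection I₁ I₂ f σ x₀ (f p))
          (range I₁) y (EuclideanSpace.single i 1))) +
        stdVol n (Function.update D i (Γ (D i)))) := by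
    intro i
    rw [volumeForm_eq_stdVol hq, hs, ← AlternatingMap.map_update_add]
    congr 2
    funext j
    by_cases hij : j = i
    · subst hij
      rw [Function.update_self, Function.update_self, pullbackConnection_apply, coords_ofCoords hq,
        coords_mfderiv_coordVec hy hp hq hfp, hS]
      rfl
    · rw [Function.update_of_ne hij, Function.update_of_ne hij]
      exact coords_mfderiv_coordVec hy hp hq hfp j
  -- The Christoffel terms add up to the trace of `Γ` times `det DF`, and `fderivWithin_density`
  -- converts this trace into the derivative of the density. This is where parallelism of `dVol₂`
  -- enters.
  rw [Finset.sum_congr rfl fun i _ => hcoord i, ← Finset.mul_sum, Finset.sum_add_distrib,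
    show ∑ i, stdVol n (Function.update D i (Γ (D i))) = _ from sum_stdVol_update_clm Γ.toLinearMap D,
    chartVariation, hFy, hSy, fderivWithin_density]
  simp only [hΓ, ContinuousLinearMap.coe_coe]
  ring

end Pointwise

/-! ### The flux form of a vector field along a map -/

section Flux

variable {n : ℕ}
  {H₁ : Type*} [TopologicalSpace H₁] {I₁ : ModelWithCorners ℝ (EuclideanSpace ℝ (Fin (n + 1))) H₁}
  {M₁ : Type*} [TopologicalSpace M₁] [ChartedSpace H₁ M₁] [IsManifold I₁ ∞ M₁]
  {H₂ : Type*} [TopologicalSpace H₂] {I₂ : ModelWithCorners ℝ (EuclideanSpace ℝ (Fin (n + 1))) H₂}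
  {M₂ : Type*} [TopologicalSpace M₂] [ChartedSpace H₂ M₂] [IsManifold I₂ ∞ M₂]
  {f : M₁ → M₂} {σ : ∀ p, TangentSpace I₂ (f p)} {x₀ p : M₁} {q : M₂}
  {y : EuclideanSpace ℝ (Fin (n + 1))}

lemma two_le_infty : (2 : WithTop ℕ∞) ≤ ∞ := by
  exact WithTop.coe_le_coe.2 le_top

lemma extChartAt_mem_range (q p : M₂) : extChartAt I₂ q p ∈ range I₂ := by
  simp [extChartAt]

lemma chartMap_mem_range : chartMap I₁ I₂ f x₀ q y ∈ range I₂ := extChartAt_mem_range _ _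

lemma ContMDiffAt.contDiffWithinAt_comp_extChartAt_symm {F : Type*} [NormedAddCommGroup F]
    [NormedSpace ℝ F] {g : M₁ → F} (hy : y ∈ (extChartAt I₁ x₀).target)
    (hp : (extChartAt I₁ x₀).symm y = p) (hg : ContMDiffAt I₁ 𝓘(ℝ, F) ∞ g p) :
    ContDiffWithinAt ℝ ∞ (fun y => g ((extChartAt I₁ x₀).symm y)) (range I₁) y := by
  subst hp
  rw [← contMDiffWithinAt_iff_contDiffWithinAt]
  have h2 : ContMDiffWithinAt 𝓘(ℝ, EuclideanSpace ℝ (Fin (n + 1))) I₁ ∞ (extChartAt I₁ x₀).symm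
      (range I₁) y := by
    refine (contMDiffOn_extChartAt_symm x₀ y hy).mono_of_mem_nhdsWithin ?_
    rw [← (extChartAt I₁ x₀).right_inv hy]
    exact extChartAt_target_mem_nhdsWithin' ((extChartAt I₁ x₀).map_target hy)
  exact ContMDiffAt.comp_contMDiffWithinAt y hg h2

lemma contDiffWithinAt_chartMap (hf : ContMDiff I₁ I₂ ∞ f) (hy : y ∈ (extChartAt I₁ x₀).target)
    (hp : (extChartAt I₁ x₀).symm y = p) (hq : f p ∈ (extChartAt I₂ q).source) :
    ContDiffWithinAt ℝ ∞ (chartMap I₁ I₂ f x₀ q) (range I₁) y := by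
  refine ContMDiffAt.contDiffWithinAt_comp_extChartAt_symm (g := fun p => extChartAt I₂ q (f p))
    hy hp ?_
  exact (contMDiffAt_extChartAt' (by simpa using hq)).comp p (hf p)

lemma contDiffWithinAt_chartSection (hσ : IsSmoothSection I₁ I₂ f σ)
    (hy : y ∈ (extChartAt I₁ x₀).target)
    (hp : (extChartAt I₁ x₀).symm y = p) (hq : f p ∈ (extChartAt I₂ q).source) :
    ContDiffWithinAt ℝ ∞ (chartSection I₁ I₂ f σ x₀ q) (range I₁) y :=
  ContMDiffAt.contDiffWithinAt_comp_extChartAt_symm (g := fun p => coords I₂ q (f p) (σ p))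
    hy hp (hσ.contMDiffAt_coords hq)

lemma tendsto_extChartAt_symm (hy : y ∈ (extChartAt I₁ x₀).target)
    (hp : (extChartAt I₁ x₀).symm y = p) :
    Filter.Tendsto (extChartAt I₁ x₀).symm (𝓝[range I₁] y) (𝓝 p) := by
  subst hp
  have := (continuousAt_extChartAt_symm'' hy).tendsto
  exact this.mono_left nhdsWithin_le_nhds

lemma target_mem_nhdsWithin_range (hy : y ∈ (extChartAt I₁ x₀).target) :
    (extChartAt I₁ x₀).target ∈ 𝓝[range I₁] y := by
  rw [← (extChartAt I₁ x₀).right_inv hy]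
  exact extChartAt_target_mem_nhdsWithin' ((extChartAt I₁ x₀).map_target hy)

variable [RiemannianBundle (fun x : M₂ => TangentSpace I₂ x)]
  {o₂ : ∀ x : M₂, Orientation ℝ (TangentSpace I₂ x) (Fin (n + 1))}

variable (I₁ I₂) in
/-- The components `Xⁱ = dVol₂(df ∂₀, …, σ, …, df ∂ₙ)`, with `σ` at the place `i`, in the chart
centred at `x₀`. -/
def flux (o₂ : ∀ x : M₂, Orientation ℝ (TangentSpace I₂ x) (Fin (n + 1))) (f : M₁ → M₂)
    (σ : ∀ p, TangentSpace I₂ (f p)) (x₀ : M₁) (i : Fin (n + 1))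
    (y : EuclideanSpace ℝ (Fin (n + 1))) : ℝ :=
  (o₂ (f ((extChartAt I₁ x₀).symm y))).volumeForm (Function.update
    (fun j => mfderiv I₁ I₂ f ((extChartAt I₁ x₀).symm y)
      (coordVec I₁ x₀ ((extChartAt I₁ x₀).symm y) j)) i (σ ((extChartAt I₁ x₀).symm y)))

/-- The flux is defined without a chart of `M₂`. Near each point it can therefore be written in
whichever target chart suits that point, up to the sign `s`. -/
lemma flux_eventuallyEq (hf : ContMDiff I₁ I₂ ∞ f) (hy : y ∈ (extChartAt I₁ x₀).target)
    (hp : (extChartAt I₁ x₀).symm y = p) (hq : f p ∈ (extChartAt I₂ q).source) {s : ℝ}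
    (hs : ∀ᶠ x in 𝓝 (f p), (o₂ x).volumeForm (coordVec I₂ q x) = s * density I₂ q (extChartAt I₂ q x))
    (i : Fin (n + 1)) :
    flux I₁ I₂ o₂ f σ x₀ i =ᶠ[𝓝[range I₁] y] fun z => s * (density I₂ q (chartMap I₁ I₂ f x₀ q z) *
      stdVol n (Function.update
        (fun j => fderivWithin ℝ (chartMap I₁ I₂ f x₀ q) (range I₁) z (EuclideanSpace.single j 1)) i
        (chartSection I₁ I₂ f σ x₀ q z))) := by
  have htend : Filter.Tendsto (fun z => f ((extChartAt I₁ x₀).symm z)) (𝓝[range I₁] y) (𝓝 (f p)) :=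
    (hf.continuous.tendsto p).comp (tendsto_extChartAt_symm hy hp)
  filter_upwards [target_mem_nhdsWithin_range hy, htend.eventually hs,
    htend.eventually (extChartAt_source_mem_nhds' hq)] with z hz hzs hzq
  rw [flux, volumeForm_eq_stdVol hzq, hzs, mul_assoc]
  congr 3
  funext j
  by_cases hij : j = i
  · subst hij
    rw [Function.update_self, Function.update_self]
    rfl
  · rw [Function.update_of_ne hij, Function.update_of_ne hij]
    exact coords_mfderiv_coordVec hz rfl hzq (hf.mdifferentiableAt (by simp)) j

variable [IsContMDiffRiemannianBundle I₂ ∞ (EuclideanSpace ℝ (Fin (n + 1)))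
      (fun x : M₂ => TangentSpace I₂ x)]

lemma contDiffWithinAt_density {x : M₂} (hx : x ∈ (extChartAt I₂ q).source) :
    ContDiffWithinAt ℝ ∞ (density I₂ q) (range I₂) (extChartAt I₂ q x) :=
  (contDiffOn_density _ ((extChartAt I₂ q).map_source hx)).mono_of_mem_nhdsWithin
    (extChartAt_target_mem_nhdsWithin' hx)

lemma contDiffWithinAt_flux (ho₂ : IsOrientation I₂ o₂) (hf : ContMDiff I₁ I₂ ∞ f)
    (hσ : IsSmoothSection I₁ I₂ f σ) (hy : y ∈ (extChartAt I₁ x₀).target) (i : Fin (n + 1)) :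
    ContDiffWithinAt ℝ 1 (flux I₁ I₂ o₂ f σ x₀ i) (range I₁) y := by
  set p := (extChartAt I₁ x₀).symm y with hp
  have hq : f p ∈ (extChartAt I₂ (f p)).source := mem_extChartAt_source _
  obtain ⟨s, -, hs⟩ := exists_sign ho₂ (f p)
  have heq := flux_eventuallyEq (σ := σ) hf hy hp.symm hq hs i
  have hyr := extChartAt_target_subset_range x₀ hy
  refine ContDiffWithinAt.congr_of_eventuallyEq ?_ heq (heq.eq_of_nhdsWithin hyr)
  have hF := contDiffWithinAt_chartMap hf hy hp.symm hq
  have hS := contDiffWithinAt_chartSection hσ hy hp.symm hq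
  have hG : ContDiffWithinAt ℝ 1 (fun z => density I₂ (f p) (chartMap I₁ I₂ f x₀ (f p) z))
      (range I₁) y :=
    ((contDiffWithinAt_density hq).comp y hF fun z _ => chartMap_mem_range).of_le (by simp)
  have hDF : ContDiffWithinAt ℝ 1 (fderivWithin ℝ (chartMap I₁ I₂ f x₀ (f p)) (range I₁))
      (range I₁) y := hF.fderivWithin_right I₁.uniqueDiffOn
        (by rw [one_add_one_eq_two]; exact two_le_infty) hyr
  refine contDiffWithinAt_const.mul (hG.mul ?_)
  refine (stdVolCM n).contDiff.comp_contDiffWithinAt (contDiffWithinAt_pi.2 fun j => ?_)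
  by_cases hij : j = i
  · subst hij
    simpa using hS.of_le (by simp)
  · simp only [Function.update_of_ne hij]
    exact hDF.clm_apply contDiffWithinAt_const

/-- The divergence of the flux at interior points. -/
theorem sum_fderivWithin_flux (hf : ContMDiff I₁ I₂ ∞ f)
    (hσ : IsSmoothSection I₁ I₂ f σ) (hy : y ∈ (extChartAt I₁ x₀).target)
    (hp : (extChartAt I₁ x₀).symm y = p) (hyi : y ∈ interior (range I₁)) {s : ℝ}
    (hs : ∀ᶠ x in 𝓝 (f p), (o₂ x).volumeForm (coordVec I₂ (f p) x) =
      s * density I₂ (f p) (extChartAt I₂ (f p) x)) :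
    ∑ i, fderivWithin ℝ (flux I₁ I₂ o₂ f σ x₀ i) (range I₁) y (EuclideanSpace.single i 1) =
      s * chartVariation I₁ I₂ f σ x₀ (f p) y := by
  have hq : f p ∈ (extChartAt I₂ (f p)).source := mem_extChartAt_source _
  -- At an interior point the derivatives within the model range are ordinary ones, so the second
  -- derivative of the chart map is symmetric.
  have hn : range I₁ ∈ 𝓝 y := mem_interior_iff_mem_nhds.1 hyi
  have hF := (contDiffWithinAt_chartMap hf hy hp hq).contDiffAt hn
  have hS := (contDiffWithinAt_chartSection hσ hy hp hq).contDiffAt hn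
  have hG := (contDiffWithinAt_density hq).differentiableWithinAt (by simp)
  have hFy : chartMap I₁ I₂ f x₀ (f p) y = extChartAt I₂ (f p) (f p) := by rw [chartMap, hp]
  rw [← hFy] at hG
  have key := sum_fderiv_flux (hF.of_le two_le_infty) (hS.differentiableAt (by simp))
    hG.hasFDerivWithinAt (.of_forall fun z => chartMap_mem_range)
  have hev : ∀ᶠ z in 𝓝 y, fderivWithin ℝ (chartMap I₁ I₂ f x₀ (f p)) (range I₁) z =
      fderiv ℝ (chartMap I₁ I₂ f x₀ (f p)) z := by
    filter_upwards [isOpen_interior.mem_nhds hyi] with z hz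
    exact fderivWithin_of_mem_nhds (mem_interior_iff_mem_nhds.1 hz)
  rw [chartVariation, hev.self_of_nhds, fderivWithin_of_mem_nhds hn (f := chartSection _ _ _ _ _ _),
    ← key, Finset.mul_sum]
  refine Finset.sum_congr rfl fun i _ => ?_
  have heq := flux_eventuallyEq (σ := σ) hf hy hp hq hs i
  rw [nhdsWithin_eq_nhds.2 hn] at heq
  rw [fderivWithin_of_mem_nhds hn]
  have heq2 : flux I₁ I₂ o₂ f σ x₀ i =ᶠ[𝓝 y] fun z => s *
      (density I₂ (f p) (chartMap I₁ I₂ f x₀ (f p) z) *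
      stdVol n (Function.update
        (fun j => fderiv ℝ (chartMap I₁ I₂ f x₀ (f p)) z (EuclideanSpace.single j 1)) i
        (chartSection I₁ I₂ f σ x₀ (f p) z))) := by
    filter_upwards [heq, hev] with z hz hz'
    rw [hz, hz']
  rw [heq2.fderiv_eq]
  exact DFunLike.congr_fun (congrFun (fderiv_const_smul_field (𝕜 := ℝ)
    (f := fun z => density I₂ (f p) (chartMap I₁ I₂ f x₀ (f p) z) * stdVol n (Function.update
      (fun j => fderiv ℝ (chartMap I₁ I₂ f x₀ (f p)) z (EuclideanSpace.single j 1)) i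
      (chartSection I₁ I₂ f σ x₀ (f p) z))) s) y) (EuclideanSpace.single i 1)

end Flux

/-! ### The Riemannian volume in charts -/

section Volume

variable {n : ℕ} {H : Type*} [TopologicalSpace H]
  {I : ModelWithCorners ℝ (EuclideanSpace ℝ (Fin (n + 1))) H}
  {M : Type*} [TopologicalSpace M] [ChartedSpace H M] [IsManifold I ∞ M]
  [MeasurableSpace M] [BorelSpace M]

lemma measurableSet_extChartAt_target (q : M) : MeasurableSet (extChartAt I q).target := by
  rw [extChartAt_target]
  exact ((chartAt H q).open_target.preimage I.continuous_symm).measurableSet.inter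
    I.isClosed_range.measurableSet

lemma measurableSet_extChartAt_source (q : M) : MeasurableSet (extChartAt I q).source :=
  (isOpen_extChartAt_source q).measurableSet

lemma measurableSet_target_inter_preimage (q : M) {A : Set M} (hA : MeasurableSet A) :
    MeasurableSet ((extChartAt I q).target ∩ (extChartAt I q).symm ⁻¹' A) := by
  classical
  -- The inverse chart is continuous only on its target; outside it is replaced by a constant to
  -- obtain a globally measurable map.
  have h := (continuousOn_extChartAt_symm (I := I) q).measurable_piecewise
    (g := fun _ => q) continuousOn_const (measurableSet_extChartAt_target q)
  have h2 := (measurableSet_extChartAt_target (I := I) q).inter (h hA)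
  convert h2 using 1
  ext y
  simp only [mem_inter_iff, mem_preimage]
  refine and_congr_right fun hy => ?_
  rw [piecewise_eq_of_mem _ _ _ hy]

lemma aemeasurable_extChartAt_symm (q : M) :
    AEMeasurable (extChartAt I q).symm
      ((volume : Measure (EuclideanSpace ℝ (Fin (n + 1)))).restrict (extChartAt I q).target) :=
  (continuousOn_extChartAt_symm q).aemeasurable (measurableSet_extChartAt_target q)

variable [RiemannianBundle (fun x : M => TangentSpace I x)]

lemma chartVolume_apply (q : M) {A : Set M} (hA : MeasurableSet A) :
    chartVolume I q A = ∫⁻ y in (extChartAt I q).target ∩ (extChartAt I q).symm ⁻¹' A,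
      ENNReal.ofReal (density I q y) := by
  rw [chartVolume, Measure.map_apply_of_aemeasurable _ hA, withDensity_apply',
    Measure.restrict_restrict' (measurableSet_extChartAt_target q), inter_comm]
  · rfl
  · exact (aemeasurable_extChartAt_symm q).mono_ac (withDensity_absolutelyContinuous _ _)

lemma chartVolume_inter_source (q : M) {A : Set M} (hA : MeasurableSet A) :
    chartVolume I q (A ∩ (extChartAt I q).source) = chartVolume I q A := by
  rw [chartVolume_apply q hA, chartVolume_apply q (hA.inter (measurableSet_extChartAt_source q))]
  congr 2
  ext y
  simp only [mem_inter_iff, mem_preimage]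
  exact and_congr_right fun hy => and_iff_left ((extChartAt I q).map_target hy)

/-- The change of the density between two charts. -/
lemma density_eq_abs_det_mul {q q' p : M} (hp : p ∈ (extChartAt I q).source)
    (hp' : p ∈ (extChartAt I q').source) :
    density I q (extChartAt I q p) =
      |(coords I q' p ∘L ofCoords I q p).det| * density I q' (extChartAt I q' p) := by
  let o : Orientation ℝ (TangentSpace I p) (Fin (n + 1)) :=
    (stdOrthonormalBasis ℝ (TangentSpace I p)).toBasis.reindex (finCongr Fact.out) |>.orientation
  rw [← abs_volumeForm_coordVec hp o, ← abs_volumeForm_coordVec hp' o, volumeForm_eq_stdVol hp',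
    abs_mul, mul_comm]
  congr 2
  have h := (EuclideanSpace.basisFun (Fin (n + 1)) ℝ).toBasis.det_comp
    (coords I q' p ∘L ofCoords I q p).toLinearMap (fun i => EuclideanSpace.single i 1)
  rw [← stdVol_eq_det, stdVol_single, mul_one] at h
  exact h

/-- Change of variables along the transition map: its Jacobian is precisely the ratio of the two
densities. The derivative is taken within the image of `A`, so boundary charts are included. -/
lemma chartVolume_eq_of_subset {q q' : M} {A : Set M} (hA : MeasurableSet A)
    (hq : A ⊆ (extChartAt I q).source) (hq' : A ⊆ (extChartAt I q').source) :
    chartVolume I q A = chartVolume I q' A := by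
  rw [chartVolume_apply q hA, chartVolume_apply q' hA]
  set B := (extChartAt I q).target ∩ (extChartAt I q).symm ⁻¹' A
  have himage : (fun y => extChartAt I q' ((extChartAt I q).symm y)) '' B =
      (extChartAt I q').target ∩ (extChartAt I q').symm ⁻¹' A := by
    ext z
    constructor
    · rintro ⟨y, ⟨hy, hyA⟩, rfl⟩
      refine ⟨(extChartAt I q').map_source (hq' hyA), ?_⟩
      rw [mem_preimage, (extChartAt I q').left_inv (hq' hyA)]
      exact hyA
    · rintro ⟨hz, hzA⟩
      refine ⟨extChartAt I q ((extChartAt I q').symm z),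
        ⟨(extChartAt I q).map_source (hq hzA), ?_⟩, ?_⟩
      · rw [mem_preimage, (extChartAt I q).left_inv (hq hzA)]
        exact hzA
      · simp only [(extChartAt I q).left_inv (hq hzA), (extChartAt I q').right_inv hz]
  have hinj : InjOn (fun y => extChartAt I q' ((extChartAt I q).symm y)) B := by
    rintro y ⟨hy, hyA⟩ z ⟨hz, hzA⟩ h
    have := (extChartAt I q').injOn (hq' hyA) (hq' hzA) h
    exact (extChartAt I q).symm.injOn hy hz this
  have hder : ∀ y ∈ B, HasFDerivWithinAt (fun y => extChartAt I q' ((extChartAt I q).symm y))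
      (coords I q' ((extChartAt I q).symm y) ∘L ofCoords I q ((extChartAt I q).symm y)) B y := by
    rintro y ⟨hy, hyA⟩
    have h := hasFDerivWithinAt_chart (I₁ := I) (I₂ := I) (f := id) hy rfl (hq' hyA)
      mdifferentiableAt_id
    rw [mfderiv_id] at h
    exact h.mono fun z hz => extChartAt_target_subset_range q hz.1
  rw [← himage, lintegral_image_eq_lintegral_abs_det_fderiv_mul volume
    (measurableSet_target_inter_preimage q hA) hder hinj]
  refine setLIntegral_congr_fun (measurableSet_target_inter_preimage q hA) ?_
  rintro y ⟨hy, hyA⟩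
  have := density_eq_abs_det_mul (hq hyA) (hq' hyA)
  rw [(extChartAt I q).right_inv hy] at this
  simp only
  rw [this, ENNReal.ofReal_mul (abs_nonneg _)]

variable [SecondCountableTopology M]

/-- One inequality is built into the supremum. For the other, a countable cover by chart domains is
made disjoint and the chart measures are glued to a measure `ν`. By agreement on overlaps `ν`
dominates every `chartVolume`, hence their supremum, and on a chart domain it equals the measure of
that chart. -/
lemma riemannianVolume_apply (q : M) {A : Set M} (hA : MeasurableSet A)
    (hq : A ⊆ (extChartAt I q).source) :
    riemannianVolume I A = chartVolume I q A := by
  refine le_antisymm ?_ (Measure.le_iff'.1 (le_iSup (fun x : M => chartVolume I x) q) A)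
  obtain ⟨t, htc, ht⟩ := TopologicalSpace.countable_cover_nhds
    (fun x : M => extChartAt_source_mem_nhds (I := I) x)
  have htn : t.Nonempty := by
    have : q ∈ ⋃ x ∈ t, (extChartAt I x).source := by rw [ht]; trivial
    simp only [mem_iUnion] at this
    obtain ⟨x, hx, -⟩ := this
    exact ⟨x, hx⟩
  obtain ⟨u, rfl⟩ := htc.exists_eq_range htn
  set D : ℕ → Set M := disjointed fun k => (extChartAt I (u k)).source with hD
  have hDm : ∀ k, MeasurableSet (D k) :=
    MeasurableSet.disjointed fun k => measurableSet_extChartAt_source (u k)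
  have hDsub : ∀ k, D k ⊆ (extChartAt I (u k)).source := fun k => disjointed_subset _ k
  have hDdisj : Pairwise (Function.onFun Disjoint D) := disjoint_disjointed _
  have hDU : ⋃ k, D k = univ := by
    rw [hD, iUnion_disjointed, ← ht, biUnion_range]
  have hsplit : ∀ (μ : Measure M) {B : Set M}, MeasurableSet B → μ B = ∑' k, μ (B ∩ D k) := by
    intro μ B hB
    rw [← measure_iUnion (fun i j hij => (hDdisj hij).mono inter_subset_right inter_subset_right)
      fun k => hB.inter (hDm k), ← inter_iUnion, hDU, inter_univ]
  set ν : Measure M := Measure.sum fun k => (chartVolume I (u k)).restrict (D k) with hν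
  have hνapply : ∀ {B : Set M}, MeasurableSet B → ν B = ∑' k, chartVolume I (u k) (B ∩ D k) := by
    intro B hB
    rw [hν, Measure.sum_apply _ hB]
    exact tsum_congr fun k => Measure.restrict_apply hB
  have hle : ∀ x : M, chartVolume I x ≤ ν := by
    intro x
    refine Measure.le_iff.2 fun B hB => ?_
    have hBx := hB.inter (measurableSet_extChartAt_source (I := I) x)
    rw [← chartVolume_inter_source x hB, hsplit _ hBx, hνapply hB]
    refine ENNReal.tsum_le_tsum fun k => ?_
    rw [chartVolume_eq_of_subset (q' := u k) (hBx.inter (hDm k))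
      (fun p hp => hp.1.2) (fun p hp => hDsub k hp.2)]
    exact measure_mono fun p hp => ⟨hp.1.1, hp.2⟩
  calc riemannianVolume I A ≤ ν A := Measure.le_iff'.1 (iSup_le hle) A
    _ = ∑' k, chartVolume I q (A ∩ D k) := by
      rw [hνapply hA]
      exact tsum_congr fun k => chartVolume_eq_of_subset (hA.inter (hDm k))
        (fun p hp => hDsub k hp.2) (fun p hp => hq hp.1)
    _ = chartVolume I q A := (hsplit _ hA).symm

lemma riemannianVolume_restrict_source (q : M) :
    (riemannianVolume I : Measure M).restrict (extChartAt I q).source = chartVolume I q := by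
  ext A hA
  rw [Measure.restrict_apply hA, riemannianVolume_apply q
    (hA.inter (measurableSet_extChartAt_source q)) inter_subset_right, chartVolume_inter_source q hA]

/-- A property holds almost everywhere in a chart domain if it holds almost everywhere in the
chart. -/
lemma ae_chartVolume_of_forall_interior {q : M} {P : M → Prop}
    (h : ∀ y ∈ (extChartAt I q).target, y ∈ interior (range I) → P ((extChartAt I q).symm y)) :
    ∀ᵐ p ∂(chartVolume I q), P p := by
  have hm : AEMeasurable (extChartAt I q).symm
      (((volume : Measure (EuclideanSpace ℝ (Fin (n + 1)))).restrict
      (extChartAt I q).target).withDensity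
    fun y => ENNReal.ofReal (Real.sqrt (gram I q y).det)) :=
    (aemeasurable_extChartAt_symm q).mono_ac (withDensity_absolutelyContinuous _ _)
  have hopen : IsOpen ((extChartAt I q).source ∩ extChartAt I q ⁻¹' interior (range I)) :=
    isOpen_extChartAt_preimage' q isOpen_interior
  suffices hae : ∀ᵐ p ∂(chartVolume I q),
      p ∈ (extChartAt I q).source ∩ extChartAt I q ⁻¹' interior (range I) by
    filter_upwards [hae] with p hp
    have := h _ ((extChartAt I q).map_source hp.1) hp.2
    rwa [(extChartAt I q).left_inv hp.1] at this
  -- Pulled back to coordinates, the exceptional set lies in the frontier of the convex model range,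
  -- which is null.
  refine (ae_map_iff hm hopen.measurableSet).2 ?_
  refine (withDensity_absolutelyContinuous _ _).ae_le ?_
  have hnull : volume (frontier (range I)) = 0 := I.convex_range.addHaar_frontier volume
  filter_upwards [ae_restrict_mem (measurableSet_extChartAt_target q),
    ae_restrict_of_ae (compl_mem_ae_iff.2 hnull)] with y hy hyf
  refine ⟨(extChartAt I q).map_target hy, ?_⟩
  rw [mem_preimage, (extChartAt I q).right_inv hy]
  by_contra hyi
  exact hyf (by
    rw [I.isClosed_range.frontier_eq]
    exact ⟨extChartAt_target_subset_range q hy, hyi⟩)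

end Volume

/-! ### Integration in charts -/

section Integration

variable {n : ℕ} {H : Type*} [TopologicalSpace H]
  {I : ModelWithCorners ℝ (EuclideanSpace ℝ (Fin (n + 1))) H}
  {M : Type*} [TopologicalSpace M] [ChartedSpace H M] [IsManifold I ∞ M]
  [MeasurableSpace M] [BorelSpace M] [SecondCountableTopology M]
  [RiemannianBundle (fun x : M => TangentSpace I x)]
  [IsContMDiffRiemannianBundle I ∞ (EuclideanSpace ℝ (Fin (n + 1)))
      (fun x : M => TangentSpace I x)]

lemma integral_riemannianVolume_eq {q : M} {h : M → ℝ} (h0 : ∀ p ∉ (extChartAt I q).source, h p = 0)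
    (hm : AEStronglyMeasurable h (chartVolume I q)) :
    ∫ p, h p ∂(riemannianVolume I : Measure M) =
      ∫ y in (extChartAt I q).target, density I q y * h ((extChartAt I q).symm y) := by
  have hms : AEMeasurable (extChartAt I q).symm
      (((volume : Measure (EuclideanSpace ℝ (Fin (n + 1)))).restrict
      (extChartAt I q).target).withDensity
    fun y => ENNReal.ofReal (Real.sqrt (gram I q y).det)) :=
    (aemeasurable_extChartAt_symm q).mono_ac (withDensity_absolutelyContinuous _ _)
  have hd : AEMeasurable (fun y => ENNReal.ofReal (Real.sqrt (gram I q y).det))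
      ((volume : Measure (EuclideanSpace ℝ (Fin (n + 1)))).restrict (extChartAt I q).target) :=
    ((contDiffOn_density (I := I) (q := q)).continuousOn.aemeasurable
      (measurableSet_extChartAt_target q)).ennreal_ofReal
  rw [← setIntegral_eq_integral_of_forall_compl_eq_zero h0, riemannianVolume_restrict_source]
  rw [chartVolume] at hm ⊢
  rw [integral_map hms hm, integral_withDensity_eq_integral_toReal_smul₀ hd (by simp)]
  refine integral_congr_ae (.of_forall fun y => ?_)
  simp only [smul_eq_mul]
  rw [ENNReal.toReal_ofReal (Real.sqrt_nonneg _)]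
  rfl

instance riemannianVolume_isLocallyFinite :
    IsLocallyFiniteMeasure (riemannianVolume I : Measure M) := by
  refine ⟨fun q => ?_⟩
  have hc : ContinuousWithinAt (density I q) (extChartAt I q).target (extChartAt I q q) :=
    (contDiffOn_density (I := I) (q := q)).continuousOn _ (mem_extChartAt_target q)
  have hev : ∀ᶠ y in 𝓝[(extChartAt I q).target] (extChartAt I q q),
      density I q y < density I q (extChartAt I q q) + 1 :=
    hc.eventually_lt_const (by linarith)
  obtain ⟨r, hr, hball⟩ := Metric.mem_nhdsWithin_iff.1 hev
  refine ⟨(extChartAt I q).source ∩ extChartAt I q ⁻¹' Metric.ball (extChartAt I q q) r, ?_, ?_⟩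
  · exact (isOpen_extChartAt_preimage' q Metric.isOpen_ball).mem_nhds
      ⟨mem_extChartAt_source q, Metric.mem_ball_self hr⟩
  · have hm := (isOpen_extChartAt_preimage' (I := I) q
      (Metric.isOpen_ball (x := extChartAt I q q) (ε := r))).measurableSet
    rw [riemannianVolume_apply q hm inter_subset_left, chartVolume_apply q hm]
    calc ∫⁻ y in (extChartAt I q).target ∩ (extChartAt I q).symm ⁻¹'
          ((extChartAt I q).source ∩ extChartAt I q ⁻¹' Metric.ball (extChartAt I q q) r),
          ENNReal.ofReal (density I q y)
        ≤ ∫⁻ y in (extChartAt I q).target ∩ (extChartAt I q).symm ⁻¹'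
          ((extChartAt I q).source ∩ extChartAt I q ⁻¹' Metric.ball (extChartAt I q q) r),
          ENNReal.ofReal (density I q (extChartAt I q q) + 1) := by
          refine setLIntegral_mono' (measurableSet_target_inter_preimage q hm) fun y hy => ?_
          refine ENNReal.ofReal_le_ofReal (le_of_lt (hball ⟨?_, hy.1⟩))
          have := hy.2.2
          rwa [mem_preimage, (extChartAt I q).right_inv hy.1] at this
      _ ≤ ∫⁻ y in Metric.ball (extChartAt I q q) r,
          ENNReal.ofReal (density I q (extChartAt I q q) + 1) := by
          refine lintegral_mono_set fun y hy => ?_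
          have := hy.2.2
          rwa [mem_preimage, (extChartAt I q).right_inv hy.1] at this
      _ < ⊤ := by
          rw [setLIntegral_const]
          exact ENNReal.mul_lt_top ENNReal.ofReal_lt_top measure_ball_lt_top

instance riemannianVolume_isOpenPos :
    (riemannianVolume I : Measure M).IsOpenPosMeasure := by
  refine ⟨fun U hU ⟨q, hq⟩ h0 => ?_⟩
  set W := U ∩ (extChartAt I q).source with hW
  have hWo : IsOpen W := hU.inter (isOpen_extChartAt_source q)
  have h1 : chartVolume I q W = 0 := by
    rw [← riemannianVolume_apply q hWo.measurableSet inter_subset_right]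
    exact measure_mono_null inter_subset_left h0
  rw [chartVolume_apply q hWo.measurableSet] at h1
  set B := (extChartAt I q).target ∩ (extChartAt I q).symm ⁻¹' W
  have hBm : MeasurableSet B := measurableSet_target_inter_preimage q hWo.measurableSet
  have hy : extChartAt I q q ∈ (extChartAt I q).target := mem_extChartAt_target q
  have hBn : B ∈ 𝓝[range I] (extChartAt I q q) :=
    Filter.inter_mem (target_mem_nhdsWithin_range hy)
      (tendsto_extChartAt_symm hy (extChartAt_to_inv q)
        (hWo.mem_nhds ⟨hq, mem_extChartAt_source q⟩))
  obtain ⟨V, hVo, hyV, hVB⟩ := mem_nhdsWithin.1 hBn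
  -- The model range lies in the closure of its interior, so even a relative neighbourhood of a
  -- boundary point contains a nonempty open set, which has positive Lebesgue measure.
  have hcl : extChartAt I q q ∈ closure (interior (range I)) := by
    rw [I.convex_range.closure_interior_eq_closure_of_nonempty_interior I.nonempty_interior]
    exact subset_closure (extChartAt_target_subset_range q hy)
  have hne : (V ∩ interior (range I)).Nonempty := mem_closure_iff.1 hcl V hVo hyV
  have hpos : 0 < volume B :=
    lt_of_lt_of_le ((hVo.inter isOpen_interior).measure_pos volume hne)
      (measure_mono ((inter_subset_inter_right V interior_subset).trans hVB))
  have hdm : AEMeasurable (fun y => ENNReal.ofReal (density I q y))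
      ((volume : Measure (EuclideanSpace ℝ (Fin (n + 1)))).restrict B) :=
    (((contDiffOn_density (I := I) (q := q)).continuousOn.mono inter_subset_left).aemeasurable
      hBm).ennreal_ofReal
  rw [lintegral_eq_zero_iff' hdm, Filter.EventuallyEq, ae_restrict_iff' hBm] at h1
  refine hpos.ne' (measure_mono_null (fun y hyB => ?_) h1)
  simp only [mem_compl_iff, mem_ofPred_eq, not_forall]
  exact ⟨hyB, by simpa using density_pos hyB.1⟩

end Integration

/-! ### The integral of the divergence of the flux -/

lemma sum_mul_smul_add {n : ℕ} {F : Type*} [AddCommMonoid F] [Module ℝ F]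
    (c : Fin (n + 1) → Fin (n + 1) → Fin (n + 1) → ℝ) (A : Fin (n + 1) → Fin (n + 1) → F)
    (w w' : EuclideanSpace ℝ (Fin (n + 1))) :
    ∑ k, ∑ i, ∑ j, (c k i j * (w + w') j) • A k i =
      ∑ k, ∑ i, ∑ j, (c k i j * w j) • A k i + ∑ k, ∑ i, ∑ j, (c k i j * w' j) • A k i := by
  simp only [PiLp.add_apply, mul_add, add_smul, Finset.sum_add_distrib]

section Stokes

variable {n : ℕ}
  {H₁ : Type*} [TopologicalSpace H₁] {I₁ : ModelWithCorners ℝ (EuclideanSpace ℝ (Fin (n + 1))) H₁}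
  {M₁ : Type*} [TopologicalSpace M₁] [ChartedSpace H₁ M₁] [IsManifold I₁ ∞ M₁]
  {H₂ : Type*} [TopologicalSpace H₂] {I₂ : ModelWithCorners ℝ (EuclideanSpace ℝ (Fin (n + 1))) H₂}
  {M₂ : Type*} [TopologicalSpace M₂] [ChartedSpace H₂ M₂] [IsManifold I₂ ∞ M₂]
  [RiemannianBundle (fun x : M₁ => TangentSpace I₁ x)]
  [RiemannianBundle (fun x : M₂ => TangentSpace I₂ x)]
  {o₁ : ∀ x : M₁, Orientation ℝ (TangentSpace I₁ x) (Fin (n + 1))}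
  {o₂ : ∀ x : M₂, Orientation ℝ (TangentSpace I₂ x) (Fin (n + 1))}
  {f : M₁ → M₂} {σ : ∀ p, TangentSpace I₂ (f p)}

lemma christoffelMap_add (q : M₂) (w w' : EuclideanSpace ℝ (Fin (n + 1))) :
    christoffelMap I₂ q (w + w') = christoffelMap I₂ q w + christoffelMap I₂ q w' :=
  sum_mul_smul_add _ _ w w'

lemma christoffelMap_zero (q : M₂) : christoffelMap I₂ q 0 = 0 := by
  have h := christoffelMap_add (I₂ := I₂) q 0 0
  rw [add_zero] at h
  exact left_eq_add.1 h

lemma pullbackConnection_eq_zero {p : M₁} (h : ∀ᶠ p' in 𝓝 p, σ p' = 0) :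
    pullbackConnection I₁ I₂ f σ p = 0 := by
  ext v
  have h1 : (fun p' => coords I₂ (f p) (f p') (σ p')) =ᶠ[𝓝 p] fun _ => 0 := by
    filter_upwards [h] with p' hp'
    rw [hp', map_zero]
  have h2 : mvfderiv I₁ (fun p' => coords I₂ (f p) (f p') (σ p')) p = 0 := by
    rw [mvfderiv, h1.mfderiv_eq, mfderiv_const]
    exact ContinuousLinearMap.comp_zero _
  rw [pullbackConnection_apply, h2, h.self_of_nhds, map_zero, christoffelMap_zero]
  simp

lemma homInner_zero_left {V W : Type*} [NormedAddCommGroup V] [InnerProductSpace ℝ V]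
    [NormedAddCommGroup W] [InnerProductSpace ℝ W] [FiniteDimensional ℝ V] (B : V →ₗ[ℝ] W) :
    homInner 0 B = 0 := by
  simp [homInner]

lemma flux_eq_zero {x₀ : M₁} {y : EuclideanSpace ℝ (Fin (n + 1))}
    (h : σ ((extChartAt I₁ x₀).symm y) = 0) (i : Fin (n + 1)) : flux I₁ I₂ o₂ f σ x₀ i y = 0 := by
  rw [flux, h]
  exact AlternatingMap.map_coord_zero _ i (Function.update_self _ _ _)

variable [IsContMDiffRiemannianBundle I₁ ∞ (EuclideanSpace ℝ (Fin (n + 1)))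
      (fun x : M₁ => TangentSpace I₁ x)]
  [IsContMDiffRiemannianBundle I₂ ∞ (EuclideanSpace ℝ (Fin (n + 1)))
      (fun x : M₂ => TangentSpace I₂ x)]
  [T2Space M₁] [SecondCountableTopology M₁] [MeasurableSpace M₁] [BorelSpace M₁]

lemma symm_mem_boundary {x₀ : M₁} {y : EuclideanSpace ℝ (Fin (n + 1))}
    (hy : y ∈ (extChartAt I₁ x₀).target) (hyf : y ∈ frontier (range I₁)) :
    (extChartAt I₁ x₀).symm y ∈ I₁.boundary M₁ := by
  rw [← I₁.compl_interior]
  intro hi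
  have hsrc : (extChartAt I₁ x₀).symm y ∈ (chartAt H₁ x₀).source := by
    simpa using (extChartAt I₁ x₀).map_target hy
  have := (I₁.isInteriorPoint_iff_of_mem_atlas (n := ∞) (by simp) (chart_mem_atlas H₁ x₀) hsrc).1 hi
  change extChartAt I₁ x₀ ((extChartAt I₁ x₀).symm y) ∈ interior (extChartAt I₁ x₀).target at this
  rw [(extChartAt I₁ x₀).right_inv hy] at this
  exact hyf.2 (interior_mono (extChartAt_target_subset_range x₀) this)

/-- The divergence theorem for sections supported in a chart domain on which the coordinate frame
has constant orientation. -/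
theorem integral_homInner_eq_zero_of_chart (ho₂ : IsOrientation I₂ o₂) (hf : ContMDiff I₁ I₂ ∞ f)
    (hσ : IsSmoothSection I₁ I₂ f σ) (hσb : ∀ p ∈ I₁.boundary M₁, σ p = 0)
    {x₀ : M₁} {s₁ : ℝ} (hs₁ : s₁ = 1 ∨ s₁ = -1) {k : Set M₁} (hk : IsCompact k)
    (hkx : k ⊆ (extChartAt I₁ x₀).source)
    (hks : ∀ p ∈ k, (o₁ p).volumeForm (coordVec I₁ x₀ p) =
      s₁ * density I₁ x₀ (extChartAt I₁ x₀ p))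
    (hσk : ∀ p ∉ k, σ p = 0) :
    Integrable (fun p => homInner (pullbackConnection I₁ I₂ f σ p) (CofD I₁ I₂ o₁ o₂ f p))
      (riemannianVolume I₁ : Measure M₁) ∧
    ∫ p, homInner (pullbackConnection I₁ I₂ f σ p) (CofD I₁ I₂ o₁ o₂ f p)
      ∂(riemannianVolume I₁ : Measure M₁) = 0 := by
  set h : M₁ → ℝ := fun p => homInner (pullbackConnection I₁ I₂ f σ p) (CofD I₁ I₂ o₁ o₂ f p) with hh
  set T := (extChartAt I₁ x₀).target with hT
  have hh0 : ∀ p ∉ k, h p = 0 := by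
    intro p hp
    have : ∀ᶠ p' in 𝓝 p, σ p' = 0 := by
      filter_upwards [hk.isClosed.isOpen_compl.mem_nhds hp] with p' hp' using hσk p' hp'
    rw [hh]
    simp only
    rw [pullbackConnection_eq_zero this, homInner_zero_left]
  -- the flux, extended by zero
  set g : Fin (n + 1) → EuclideanSpace ℝ (Fin (n + 1)) → ℝ :=
    fun i => T.indicator (flux I₁ I₂ o₂ f σ x₀ i) with hg
  set k' := extChartAt I₁ x₀ '' k with hk'
  have hk'c : IsCompact k' := hk.image_of_continuousOn ((continuousOn_extChartAt x₀).mono hkx)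
  have hg0 : ∀ i, ∀ y ∉ k', g i y = 0 := by
    intro i y hy
    by_cases hyT : y ∈ T
    · rw [hg]
      simp only
      rw [indicator_of_mem hyT]
      refine flux_eq_zero (hσk _ fun hmem => hy ⟨_, hmem, (extChartAt I₁ x₀).right_inv hyT⟩) i
    · exact indicator_of_notMem hyT _
  have hgT : ∀ i, ∀ y ∈ T, g i =ᶠ[𝓝[range I₁] y] flux I₁ I₂ o₂ f σ x₀ i := by
    intro i y hy
    filter_upwards [target_mem_nhdsWithin_range hy] with z hz using indicator_of_mem hz _
  -- The support of `σ` has compact image inside the chart target, so extending the flux by zero to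
  -- the whole model range loses no regularity.
  have hgC : ∀ i, ContDiffOn ℝ 1 (g i) (range I₁) := by
    intro i y hy
    by_cases hyT : y ∈ T
    · exact (contDiffWithinAt_flux ho₂ hf hσ hyT i).congr_of_eventuallyEq (hgT i y hyT)
        (indicator_of_mem hyT _)
    · have hyk : y ∉ k' := by
        rintro ⟨p, hp, rfl⟩
        exact hyT ((extChartAt I₁ x₀).map_source (hkx hp))
      have : g i =ᶠ[𝓝[range I₁] y] fun _ => (0 : ℝ) := by
        filter_upwards [mem_nhdsWithin_of_mem_nhds (hk'c.isClosed.isOpen_compl.mem_nhds hyk)]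
          with z hz using hg0 i z hz
      exact contDiffWithinAt_const.congr_of_eventuallyEq this (hg0 i y hyk)
  -- Frontier points of the model range in the target correspond to points of `∂M₁`, where `σ` and
  -- hence every component of the flux vanish.
  have hgf : ∀ i, ∀ y ∈ frontier (range I₁), g i y = 0 := by
    intro i y hy
    by_cases hyT : y ∈ T
    · rw [hg]
      simp only
      rw [indicator_of_mem hyT]
      exact flux_eq_zero (hσb _ (symm_mem_boundary hyT hy)) i
    · exact indicator_of_notMem hyT _
  have hdiv : ∀ i, IntegrableOn (fun y => fderivWithin ℝ (g i) (range I₁) y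
      (EuclideanSpace.single i 1)) (range I₁) volume ∧
      ∫ y in range I₁, fderivWithin ℝ (g i) (range I₁) y (EuclideanSpace.single i 1) = 0 :=
    fun i => integral_fderivWithin_convex_eq_zero volume I₁.convex_range I₁.isClosed_range
      I₁.nonempty_interior hk'c (hgC i) (fun y _ hy => hg0 i y hy) (hgf i) _
  set div : EuclideanSpace ℝ (Fin (n + 1)) → ℝ := fun y =>
    ∑ i, fderivWithin ℝ (g i) (range I₁) y (EuclideanSpace.single i 1) with hdivdef
  have hdivint : ∫ y in range I₁, div y = 0 := by
    rw [hdivdef, integral_finsetSum _ fun i _ => (hdiv i).1]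
    exact Finset.sum_eq_zero fun i _ => (hdiv i).2
  have hdivc : ContinuousOn div (range I₁) := by
    refine continuousOn_finsetSum _ fun i _ => ?_
    exact ((hgC i).continuousOn_fderivWithin I₁.uniqueDiffOn le_rfl).clm_apply continuousOn_const
  have hdiv0 : ∀ y ∈ range I₁, y ∉ T → div y = 0 := by
    intro y hy hyT
    refine Finset.sum_eq_zero fun i _ => ?_
    have hyk : y ∉ k' := by
      rintro ⟨p, hp, rfl⟩
      exact hyT ((extChartAt I₁ x₀).map_source (hkx hp))
    have : g i =ᶠ[𝓝[range I₁] y] fun _ => (0 : ℝ) := by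
      filter_upwards [mem_nhdsWithin_of_mem_nhds (hk'c.isClosed.isOpen_compl.mem_nhds hyk)]
        with z hz using hg0 i z hz
    rw [this.fderivWithin_eq (hg0 i y hyk)]
    simp
  have hdivT : ∫ y in T, div y = 0 := by
    rw [← hdivint]
    exact (setIntegral_eq_of_subset_of_forall_sdiff_eq_zero I₁.isClosed_range.measurableSet
      (extChartAt_target_subset_range x₀) fun y hy => hdiv0 y hy.1 hy.2).symm
  -- the pointwise identity
  have hpt : ∀ y ∈ T, y ∈ interior (range I₁) →
      density I₁ x₀ y * h ((extChartAt I₁ x₀).symm y) = s₁ * div y := by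
    intro y hy hyi
    set p := (extChartAt I₁ x₀).symm y with hp
    -- The target chart and its sign depend on `y`. Both drop out, because the flux and `h` do not
    -- refer to them.
    obtain ⟨s, -, hs⟩ := exists_sign ho₂ (f p)
    have h1 := homInner_pullbackConnection_CofD (o₁ := o₁) hf hσ hy hp.symm hs.self_of_nhds
    rw [← sum_fderivWithin_flux hf hσ hy hp.symm hyi hs] at h1
    have h2 : div y = h p * (o₁ p).volumeForm (coordVec I₁ x₀ p) := by
      rw [h1]
      refine Finset.sum_congr rfl fun i _ => ?_
      rw [(hgT i y hy).fderivWithin_eq (indicator_of_mem hy _)]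
    by_cases hpk : p ∈ k
    · rw [h2, hks p hpk, hp, (extChartAt I₁ x₀).right_inv hy]
      rcases hs₁ with rfl | rfl <;> ring
    · rw [h2, hh0 p hpk]
      ring
  -- Measurability and integrability of `h` are obtained from almost everywhere equality with a
  -- function that is continuous on the chart domain.
  have hae : h =ᵐ[chartVolume I₁ x₀] fun p =>
      s₁ * div (extChartAt I₁ x₀ p) / density I₁ x₀ (extChartAt I₁ x₀ p) := by
    refine ae_chartVolume_of_forall_interior fun y hy hyi => ?_
    simp only
    rw [(extChartAt I₁ x₀).right_inv hy, ← hpt y hy hyi,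
      mul_div_cancel_left₀ _ (density_pos hy).ne']
  have hKc : ContinuousOn (fun p =>
      s₁ * div (extChartAt I₁ x₀ p) / density I₁ x₀ (extChartAt I₁ x₀ p))
      (extChartAt I₁ x₀).source := by
    refine (continuousOn_const.mul (hdivc.comp (continuousOn_extChartAt x₀)
      fun p _ => extChartAt_mem_range _ _)).div
      ((contDiffOn_density (I := I₁) (q := x₀)).continuousOn.comp (continuousOn_extChartAt x₀)
        fun p hp => (extChartAt I₁ x₀).map_source hp) fun p hp => ?_
    exact (density_pos ((extChartAt I₁ x₀).map_source hp)).ne'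
  have hms : AEStronglyMeasurable h (chartVolume I₁ x₀) := by
    refine AEStronglyMeasurable.congr ?_ hae.symm
    rw [← riemannianVolume_restrict_source]
    exact hKc.aestronglyMeasurable (measurableSet_extChartAt_source x₀)
  refine ⟨?_, ?_⟩
  · have h1 : IntegrableOn h k (riemannianVolume I₁ : Measure M₁) := by
      refine IntegrableOn.congr_fun_ae ((hKc.mono hkx).integrableOn_compact hk) ?_
      rw [← riemannianVolume_restrict_source] at hae
      exact Filter.EventuallyEq.symm (ae_mono (Measure.restrict_mono hkx le_rfl) hae)
    exact h1.integrable_of_forall_notMem_eq_zero hh0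
  · rw [integral_riemannianVolume_eq (fun p hp => hh0 p fun hpk => hp (hkx hpk)) hms]
    have hnull : volume (frontier (range I₁)) = 0 := I₁.convex_range.addHaar_frontier volume
    have : ∫ y in T, density I₁ x₀ y * h ((extChartAt I₁ x₀).symm y) = ∫ y in T, s₁ * div y := by
      refine integral_congr_ae ?_
      filter_upwards [ae_restrict_mem (measurableSet_extChartAt_target x₀),
        ae_restrict_of_ae (compl_mem_ae_iff.2 hnull)] with y hy hyf
      refine hpt y hy ?_
      by_contra hyi
      exact hyf (by
        rw [I₁.isClosed_range.frontier_eq]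
        exact ⟨extChartAt_target_subset_range x₀ hy, hyi⟩)
    rw [this, integral_const_mul, hdivT, mul_zero]

end Stokes

/-! ### The global divergence theorem -/

section GlobalStokes

variable {n : ℕ}
  {H₁ : Type*} [TopologicalSpace H₁] {I₁ : ModelWithCorners ℝ (EuclideanSpace ℝ (Fin (n + 1))) H₁}
  {M₁ : Type*} [TopologicalSpace M₁] [ChartedSpace H₁ M₁] [IsManifold I₁ ∞ M₁]
  {H₂ : Type*} [TopologicalSpace H₂] {I₂ : ModelWithCorners ℝ (EuclideanSpace ℝ (Fin (n + 1))) H₂}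
  {M₂ : Type*} [TopologicalSpace M₂] [ChartedSpace H₂ M₂] [IsManifold I₂ ∞ M₂]
  {f : M₁ → M₂} {σ σ' : ∀ p, TangentSpace I₂ (f p)}

lemma isSmoothSection_of_coords (hf : ContMDiff I₁ I₂ ∞ f)
    (h : ∀ p, ContMDiffAt I₁ 𝓘(ℝ, EuclideanSpace ℝ (Fin (n + 1))) ∞
      (fun p' => coords I₂ (f p) (f p') (σ p')) p) : IsSmoothSection I₁ I₂ f σ := by
  intro p
  set e := trivializationAt (EuclideanSpace ℝ (Fin (n + 1))) (TangentSpace I₂ : M₂ → Type _) (f p)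
  have hq : f p ∈ (extChartAt I₂ (f p)).source := mem_extChartAt_source _
  have hmem : (⟨f p, σ p⟩ : TangentBundle I₂ M₂) ∈ e.source := by
    rw [e.mem_source]; exact mem_baseSet hq
  refine (e.contMDiffAt_iff (f := fun p' => (⟨f p', σ p'⟩ : TangentBundle I₂ M₂)) hmem).2
    ⟨hf p, (h p).congr_of_eventuallyEq ?_⟩
  filter_upwards [hf.continuous.continuousAt.preimage_mem_nhds (extChartAt_source_mem_nhds' hq)]
    with p' hp'
  exact (coords_eq hp' _).symm

lemma isSmoothSection_zero (hf : ContMDiff I₁ I₂ ∞ f) : IsSmoothSection I₁ I₂ f (fun _ => 0) := by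
  refine isSmoothSection_of_coords hf fun p => ?_
  simp only [map_zero]
  exact contMDiffAt_const

lemma IsSmoothSection.add (hf : ContMDiff I₁ I₂ ∞ f) (hσ : IsSmoothSection I₁ I₂ f σ)
    (hσ' : IsSmoothSection I₁ I₂ f σ') : IsSmoothSection I₁ I₂ f (fun p => σ p + σ' p) := by
  refine isSmoothSection_of_coords hf fun p => ?_
  simp only [map_add]
  exact (hσ.contMDiffAt_coords (mem_extChartAt_source _)).add
    (hσ'.contMDiffAt_coords (mem_extChartAt_source _))

lemma IsSmoothSection.smul (hf : ContMDiff I₁ I₂ ∞ f) (hσ : IsSmoothSection I₁ I₂ f σ)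
    {χ : M₁ → ℝ} (hχ : ContMDiff I₁ 𝓘(ℝ, ℝ) ∞ χ) :
    IsSmoothSection I₁ I₂ f (fun p => χ p • σ p) := by
  refine isSmoothSection_of_coords hf fun p => ?_
  simp only [map_smul]
  exact (hχ p).smul (hσ.contMDiffAt_coords (mem_extChartAt_source _))

variable [RiemannianBundle (fun x : M₁ => TangentSpace I₁ x)]
  [RiemannianBundle (fun x : M₂ => TangentSpace I₂ x)]
  {o₁ : ∀ x : M₁, Orientation ℝ (TangentSpace I₁ x) (Fin (n + 1))}
  {o₂ : ∀ x : M₂, Orientation ℝ (TangentSpace I₂ x) (Fin (n + 1))}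

lemma pullbackConnection_add (hσ : IsSmoothSection I₁ I₂ f σ)
    (hσ' : IsSmoothSection I₁ I₂ f σ') (p : M₁) :
    pullbackConnection I₁ I₂ f (fun p => σ p + σ' p) p =
      pullbackConnection I₁ I₂ f σ p + pullbackConnection I₁ I₂ f σ' p := by
  have hq : f p ∈ (extChartAt I₂ (f p)).source := mem_extChartAt_source _
  ext1 v
  rw [LinearMap.add_apply, pullbackConnection_apply, pullbackConnection_apply,
    pullbackConnection_apply, ← map_add]
  simp only [map_add]
  rw [mvfderiv_fun_add ((hσ.contMDiffAt_coords hq).mdifferentiableAt (by simp))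
    ((hσ'.contMDiffAt_coords hq).mdifferentiableAt (by simp)), christoffelMap_add]
  simp only [add_apply, map_add]
  abel

lemma homInner_add_left {V W : Type*} [NormedAddCommGroup V] [InnerProductSpace ℝ V]
    [NormedAddCommGroup W] [InnerProductSpace ℝ W] [FiniteDimensional ℝ V] (A A' B : V →ₗ[ℝ] W) :
    homInner (A + A') B = homInner A B + homInner A' B := by
  simp [homInner, inner_add_left, Finset.sum_add_distrib]

variable [IsContMDiffRiemannianBundle I₁ ∞ (EuclideanSpace ℝ (Fin (n + 1)))
      (fun x : M₁ => TangentSpace I₁ x)]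
  [IsContMDiffRiemannianBundle I₂ ∞ (EuclideanSpace ℝ (Fin (n + 1)))
      (fun x : M₂ => TangentSpace I₂ x)]
  [T2Space M₁] [SecondCountableTopology M₁] [MeasurableSpace M₁] [BorelSpace M₁]

/-- The pairing of the cofactor of `df` with the covariant derivative of a compactly supported
section vanishing on the boundary has integral zero. -/
theorem integral_homInner_pullbackConnection_CofD (ho₁ : IsOrientation I₁ o₁)
    (ho₂ : IsOrientation I₂ o₂) (hf : ContMDiff I₁ I₂ ∞ f)
    (hσ : IsSmoothSection I₁ I₂ f σ) (hσc : IsCompact (closure {p | σ p ≠ 0}))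
    (hσb : ∀ p ∈ I₁.boundary M₁, σ p = 0) :
    ∫ p, homInner (pullbackConnection I₁ I₂ f σ p) (CofD I₁ I₂ o₁ o₂ f p)
      ∂(riemannianVolume I₁ : Measure M₁) = 0 := by
  classical
  have : LocallyCompactSpace M₁ := Manifold.locallyCompact_of_finiteDimensional I₁
  set k₀ := closure {p | σ p ≠ 0} with hk₀
  have hσ0 : ∀ p ∉ k₀, σ p = 0 := fun p hp => by
    by_contra h
    exact hp (subset_closure h)
  choose s hs1 hs2 using exists_sign ho₁
  have hU : ∀ q : M₁, ∃ U : Set M₁, IsOpen U ∧ q ∈ U ∧ U ⊆ (extChartAt I₁ q).source ∧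
      ∀ p ∈ U, (o₁ p).volumeForm (coordVec I₁ q p) = s q * density I₁ q (extChartAt I₁ q p) := by
    intro q
    obtain ⟨U, hU, hUo, hqU⟩ := mem_nhds_iff.1
      (Filter.inter_mem (extChartAt_source_mem_nhds (I := I₁) q) (hs2 q))
    exact ⟨U, hUo, hqU, fun p hp => (hU hp).1, fun p hp => (hU hp).2⟩
  choose U hUo hqU hUs hUv using hU
  -- The sets `U q` lie in chart domains on which the coordinate frame has one fixed sign; the
  -- partition is needed only over the support of `σ`.
  obtain ⟨χ, hχ⟩ := SmoothPartitionOfUnity.exists_isSubordinate I₁ hσc.isClosed U hUo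
    (fun p _ => mem_iUnion.2 ⟨p, hqU p⟩)
  have hfin := χ.locallyFinite.finite_nonempty_inter_compact hσc
  set S := hfin.toFinset with hS
  -- Smoothness and integrability are carried through the induction because additivity of the
  -- connection needs the former and additivity of the integral the latter.
  have hsum : ∀ S' : Finset M₁,
      IsSmoothSection I₁ I₂ f (fun p => (∑ i ∈ S', χ i p) • σ p) ∧
      Integrable (fun p => homInner (pullbackConnection I₁ I₂ f
        (fun p => (∑ i ∈ S', χ i p) • σ p) p) (CofD I₁ I₂ o₁ o₂ f p))
        (riemannianVolume I₁ : Measure M₁) ∧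
      ∫ p, homInner (pullbackConnection I₁ I₂ f (fun p => (∑ i ∈ S', χ i p) • σ p) p)
        (CofD I₁ I₂ o₁ o₂ f p) ∂(riemannianVolume I₁ : Measure M₁) = 0 := by
    intro S'
    induction S' using Finset.induction_on with
    | empty =>
      simp only [Finset.sum_empty, zero_smul]
      have : ∀ p, pullbackConnection I₁ I₂ f (fun _ => 0) p = 0 := fun p =>
        pullbackConnection_eq_zero (.of_forall fun _ => rfl)
      simp only [this, homInner_zero_left, integral_zero, and_true]
      exact ⟨isSmoothSection_zero hf, integrable_zero _ _ _⟩
    | insert i S' hi ih =>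
      have hsm : IsSmoothSection I₁ I₂ f (fun p => χ i p • σ p) := hσ.smul hf (χ i).contMDiff
      have hone := integral_homInner_eq_zero_of_chart (o₁ := o₁) ho₂ hf hsm
        (fun p hp => by rw [hσb p hp, smul_zero]) (hs1 i)
        (hσc.inter_left (isClosed_tsupport (χ i)))
        (fun p hp => hUs i (hχ i hp.1)) (fun p hp => hUv i p (hχ i hp.1)) (fun p hp => by
          by_cases h1 : p ∈ tsupport (χ i)
          · rw [hσ0 p fun h2 => hp ⟨h1, h2⟩, smul_zero]
          · rw [image_eq_zero_of_notMem_tsupport h1, zero_smul])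
      simp only [Finset.sum_insert hi, add_smul]
      refine ⟨hsm.add hf ih.1, ?_⟩
      simp only [pullbackConnection_add hsm ih.1, homInner_add_left]
      refine ⟨hone.1.add ih.2.1, ?_⟩
      rw [integral_add hone.1 ih.2.1, hone.2, ih.2.2, add_zero]
  -- Only finitely many `χ i` meet the compact support; their sum is `1` there, and elsewhere `σ` is
  -- zero.
  have hσS : (fun p => (∑ i ∈ S, χ i p) • σ p) = σ := by
    funext p
    by_cases hp : p ∈ k₀
    · rw [← finsum_eq_sum_of_support_subset, χ.sum_eq_one hp, one_smul]
      intro i hi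
      rw [hS, Finite.coe_toFinset]
      exact ⟨p, hi, hp⟩
    · rw [hσ0 p hp, smul_zero]
  rw [← hσS]
  exact (hsum S).2.2

end GlobalStokes

/-! ### Uniqueness of the coderivative -/

section Uniqueness

variable {n : ℕ}
  {H₁ : Type*} [TopologicalSpace H₁] {I₁ : ModelWithCorners ℝ (EuclideanSpace ℝ (Fin (n + 1))) H₁}
  {M₁ : Type*} [TopologicalSpace M₁] [ChartedSpace H₁ M₁] [IsManifold I₁ ∞ M₁]
  {H₂ : Type*} [TopologicalSpace H₂] {I₂ : ModelWithCorners ℝ (EuclideanSpace ℝ (Fin (n + 1))) H₂}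
  {M₂ : Type*} [TopologicalSpace M₂] [ChartedSpace H₂ M₂] [IsManifold I₂ ∞ M₂]
  {f : M₁ → M₂}
  [RiemannianBundle (fun x : M₁ => TangentSpace I₁ x)]
  [IsContMDiffRiemannianBundle I₁ ∞ (EuclideanSpace ℝ (Fin (n + 1)))
      (fun x : M₁ => TangentSpace I₁ x)]
  [SecondCountableTopology M₁] [MeasurableSpace M₁] [BorelSpace M₁]

lemma symm_mem_interior {x₀ : M₁} {y : EuclideanSpace ℝ (Fin (n + 1))}
    (hy : y ∈ (extChartAt I₁ x₀).target) (hyi : y ∈ interior (range I₁)) :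
    (extChartAt I₁ x₀).symm y ∈ I₁.interior M₁ := by
  have hsrc : (extChartAt I₁ x₀).symm y ∈ (chartAt H₁ x₀).source := by
    simpa using (extChartAt I₁ x₀).map_target hy
  refine (I₁.isInteriorPoint_iff_of_mem_atlas (n := ∞) (by simp) (chart_mem_atlas H₁ x₀) hsrc).2 ?_
  change extChartAt I₁ x₀ ((extChartAt I₁ x₀).symm y) ∈ interior (extChartAt I₁ x₀).target
  rw [(extChartAt I₁ x₀).right_inv hy, mem_interior_iff_mem_nhds]
  have h := target_mem_nhdsWithin_range hy
  rwa [nhdsWithin_eq_nhds.2 (mem_interior_iff_mem_nhds.1 hyi)] at h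

/-- Countably many charts cover `M₁`, and in each the boundary lies over the null frontier of the
convex model range. -/
lemma ae_mem_interior : ∀ᵐ p ∂(riemannianVolume I₁ : Measure M₁), p ∈ I₁.interior M₁ := by
  obtain ⟨t, htc, ht⟩ := TopologicalSpace.countable_cover_nhds
    (fun x : M₁ => extChartAt_source_mem_nhds (I := I₁) x)
  have h : ∀ᵐ p ∂(riemannianVolume I₁ : Measure M₁).restrict (⋃ x ∈ t, (extChartAt I₁ x).source),
      p ∈ I₁.interior M₁ := by
    rw [ae_restrict_biUnion_iff _ htc]
    intro x _
    rw [riemannianVolume_restrict_source]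
    exact ae_chartVolume_of_forall_interior fun y hy hyi => symm_mem_interior hy hyi
  rwa [ht, Measure.restrict_univ] at h

variable [T2Space M₁] [RiemannianBundle (fun x : M₂ => TangentSpace I₂ x)]
  [IsContMDiffRiemannianBundle I₂ ∞ (EuclideanSpace ℝ (Fin (n + 1)))
      (fun x : M₂ => TangentSpace I₂ x)]

/-- A smooth section is determined by its pairings with smooth sections that are compactly supported
and vanish on the boundary. -/
theorem eq_zero_of_integral_inner_eq_zero (hf : ContMDiff I₁ I₂ ∞ f)
    {τ : ∀ p, TangentSpace I₂ (f p)} (hτ : IsSmoothSection I₁ I₂ f τ)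
    (h : ∀ σ : ∀ p, TangentSpace I₂ (f p), IsSmoothSection I₁ I₂ f σ →
      IsCompact (closure {p | σ p ≠ 0}) → (∀ p ∈ I₁.boundary M₁, σ p = 0) →
      ∫ p, inner ℝ (σ p) (τ p) ∂(riemannianVolume I₁ : Measure M₁) = 0) : τ = fun _ => 0 := by
  have : LocallyCompactSpace M₁ := Manifold.locallyCompact_of_finiteDimensional I₁
  by_contra hne
  obtain ⟨p₀, hp₀⟩ := Function.ne_iff.1 hne
  set g : M₁ → ℝ := fun p => inner ℝ (τ p) (τ p) with hg
  have hgc : Continuous g := (ContMDiff.inner_bundle hτ hτ).continuous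
  have hgne : ∀ p, g p ≠ 0 ↔ τ p ≠ 0 := fun p => inner_self_ne_zero
  have hopen : IsOpen {p | g p ≠ 0} := isOpen_ne_fun hgc continuous_const
  -- A nonempty open set has positive measure and the interior has full measure, so they meet. A
  -- bump function `χ` supported in the interior then makes `χ • τ` an admissible test section.
  obtain ⟨p₁, hp₁, hp₁i⟩ : ∃ p, g p ≠ 0 ∧ p ∈ I₁.interior M₁ := by
    by_contra! hcon
    refine (hopen.measure_pos (riemannianVolume I₁) ⟨p₀, (hgne p₀).2 hp₀⟩).ne' ?_
    exact measure_mono_null (fun p hp => hcon p hp) ae_mem_interior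
  obtain ⟨χ, -, hχ⟩ := (SmoothBumpFunction.nhds_basis_tsupport (I := I₁) p₁).mem_iff.1
    ((I₁.isOpen_interior (n := ∞) (by simp)).mem_nhds hp₁i)
  have hb : ∀ p ∈ I₁.boundary M₁, χ p = 0 := by
    intro p hp
    refine image_eq_zero_of_notMem_tsupport fun hmem => ?_
    rw [← I₁.compl_interior] at hp
    exact hp (hχ hmem)
  have h0 := h (fun p => χ p • τ p) (hτ.smul hf χ.contMDiff)
    (χ.hasCompactSupport.of_isClosed_subset isClosed_closure
      (closure_mono fun p hp h0 => hp (by rw [h0, zero_smul])))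
    (fun p hp => by rw [hb p hp, zero_smul])
  have hpos : 0 < ∫ p, χ p * g p ∂(riemannianVolume I₁ : Measure M₁) := by
    refine Continuous.integral_pos_of_hasCompactSupport_nonneg_nonzero (x := p₁)
      (χ.continuous.mul hgc) χ.hasCompactSupport.mul_right
      (fun p => mul_nonneg χ.nonneg real_inner_self_nonneg) ?_
    rw [χ.eq_one, one_mul]
    exact hp₁
  refine hpos.ne' ?_
  rw [← h0]
  refine integral_congr_ae (.of_forall fun p => ?_)
  simp only [hg, real_inner_smul_left]

end Uniqueness

/-! ### Smooth families of maps -/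

section Families

variable {n : ℕ}

/-- A partial derivative on the product of the line with a set of unique differentiability. -/
lemma fderivWithin_slice {F : Type*} [NormedAddCommGroup F] [NormedSpace ℝ F]
    {E : Type*} [NormedAddCommGroup E] [NormedSpace ℝ E] {Φ : ℝ × E → F} {R : Set E}
    (hR : UniqueDiffOn ℝ R) {t : ℝ} {y : E} (hy : y ∈ R)
    (h : DifferentiableWithinAt ℝ Φ (univ ×ˢ R) (t, y)) (v : E) :
    fderivWithin ℝ (fun z => Φ (t, z)) R y v = fderivWithin ℝ Φ (univ ×ˢ R) (t, y) (0, v) := by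
  have h1 : HasFDerivWithinAt (fun z : E => (t, z)) (ContinuousLinearMap.inr ℝ ℝ E) R y :=
    (hasFDerivAt_prodMk_right t y).hasFDerivWithinAt
  have h2 := h.hasFDerivWithinAt.comp y h1 (fun z hz => ⟨trivial, hz⟩)
  have h3 := h2.fderivWithin (hR y hy)
  simpa [Function.comp_def] using DFunLike.congr_fun h3 v

/-- The time direction is unrestricted, so the derivative in time is two-sided even when `y` lies on
the frontier of `R`. -/
lemma hasDerivAt_slice {F : Type*} [NormedAddCommGroup F] [NormedSpace ℝ F]
    {E : Type*} [NormedAddCommGroup E] [NormedSpace ℝ E] {Φ : ℝ × E → F} {R : Set E}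
    {t : ℝ} {y : E} (hy : y ∈ R) (h : DifferentiableWithinAt ℝ Φ (univ ×ˢ R) (t, y)) :
    HasDerivAt (fun s => Φ (s, y)) (fderivWithin ℝ Φ (univ ×ˢ R) (t, y) (1, 0)) t := by
  have h1 : HasFDerivWithinAt (fun s : ℝ => (s, y)) (ContinuousLinearMap.inl ℝ ℝ E) univ t :=
    (hasFDerivAt_prodMk_left t y).hasFDerivWithinAt
  have h2 := h.hasFDerivWithinAt.comp t h1 (fun z _ => show (z, y) ∈ univ ×ˢ R from ⟨trivial, hy⟩)
  rw [hasFDerivWithinAt_univ] at h2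
  simpa [Function.comp_def] using h2.hasDerivAt

variable
  {H₁ : Type*} [TopologicalSpace H₁] {I₁ : ModelWithCorners ℝ (EuclideanSpace ℝ (Fin (n + 1))) H₁}
  {M₁ : Type*} [TopologicalSpace M₁] [ChartedSpace H₁ M₁] [IsManifold I₁ ∞ M₁]
  {H₂ : Type*} [TopologicalSpace H₂] {I₂ : ModelWithCorners ℝ (EuclideanSpace ℝ (Fin (n + 1))) H₂}
  {M₂ : Type*} [TopologicalSpace M₂] [ChartedSpace H₂ M₂] [IsManifold I₂ ∞ M₂]
  {ψ : ℝ → M₁ → M₂} {x₀ p : M₁} {q : M₂} {t : ℝ}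
  {y : EuclideanSpace ℝ (Fin (n + 1))}

/-- A smooth family of maps in the charts centred at `x₀` and `q`. -/
lemma contDiffWithinAt_chartMap_family
    (hψ : ContMDiffAt (𝓘(ℝ, ℝ).prod I₁) I₂ ∞ (fun z : ℝ × M₁ => ψ z.1 z.2) (t, p))
    (hy : y ∈ (extChartAt I₁ x₀).target)
    (hp : (extChartAt I₁ x₀).symm y = p) (hq : ψ t p ∈ (extChartAt I₂ q).source) :
    ContDiffWithinAt ℝ ∞ (fun z : ℝ × EuclideanSpace ℝ (Fin (n + 1)) =>
      chartMap I₁ I₂ (ψ z.1) x₀ q z.2) (univ ×ˢ range I₁) (t, y) := by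
  subst hp
  rw [← contMDiffWithinAt_iff_contDiffWithinAt]
  have h2 : ContMDiffWithinAt 𝓘(ℝ, EuclideanSpace ℝ (Fin (n + 1))) I₁ ∞ (extChartAt I₁ x₀).symm
      (range I₁) y :=
    (contMDiffOn_extChartAt_symm x₀ y hy).mono_of_mem_nhdsWithin (target_mem_nhdsWithin_range hy)
  have h3 : ContMDiffWithinAt 𝓘(ℝ, ℝ × EuclideanSpace ℝ (Fin (n + 1))) (𝓘(ℝ, ℝ).prod I₁) ∞
      (fun z : ℝ × EuclideanSpace ℝ (Fin (n + 1)) => (z.1, (extChartAt I₁ x₀).symm z.2))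
      (univ ×ˢ range I₁) (t, y) := by
    refine ContMDiffWithinAt.prodMk contDiff_fst.contDiffWithinAt.contMDiffWithinAt ?_
    exact h2.comp (t, y) contDiff_snd.contDiffWithinAt.contMDiffWithinAt fun z hz => hz.2
  have h4 : ContMDiffAt (𝓘(ℝ, ℝ).prod I₁) 𝓘(ℝ, EuclideanSpace ℝ (Fin (n + 1))) ∞
      (fun z : ℝ × M₁ => extChartAt I₂ q (ψ z.1 z.2)) (t, (extChartAt I₁ x₀).symm y) :=
    (contMDiffAt_extChartAt' (by simpa using hq)).comp _ hψ
  exact ContMDiffAt.comp_contMDiffWithinAt (g := fun z : ℝ × M₁ => extChartAt I₂ q (ψ z.1 z.2))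
    (t, y) h4 h3

lemma tendsto_prodMk_extChartAt (t : ℝ) (p : M₁) :
    Filter.Tendsto (fun z : ℝ × M₁ => (z.1, extChartAt I₁ p z.2)) (𝓝 (t, p))
      (𝓝[univ ×ˢ range I₁] (t, extChartAt I₁ p p)) := by
  refine tendsto_nhdsWithin_iff.2 ⟨?_, .of_forall fun z => ⟨trivial, extChartAt_mem_range _ _⟩⟩
  rw [nhds_prod_eq, nhds_prod_eq]
  exact Filter.tendsto_id.prodMap (continuousAt_extChartAt p)

lemma contMDiffAt_slice
    (hψ : ContMDiffAt (𝓘(ℝ, ℝ).prod I₁) I₂ ∞ (fun z : ℝ × M₁ => ψ z.1 z.2) (t, p)) :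
    ContMDiffAt I₁ I₂ ∞ (ψ t) p :=
  ContMDiffAt.comp (g := fun z : ℝ × M₁ => ψ z.1 z.2) p hψ
    (contMDiffAt_const.prodMk contMDiffAt_id)

lemma contMDiffAt_curve
    (hψ : ContMDiffAt (𝓘(ℝ, ℝ).prod I₁) I₂ ∞ (fun z : ℝ × M₁ => ψ z.1 z.2) (t, p)) :
    ContMDiffAt 𝓘(ℝ, ℝ) I₂ ∞ (fun s => ψ s p) t :=
  ContMDiffAt.comp (g := fun z : ℝ × M₁ => ψ z.1 z.2) t hψ
    (contMDiffAt_id.prodMk contMDiffAt_const)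

variable [RiemannianBundle (fun x : M₁ => TangentSpace I₁ x)]
  [RiemannianBundle (fun x : M₂ => TangentSpace I₂ x)]
  {o₁ : ∀ x : M₁, Orientation ℝ (TangentSpace I₁ x) (Fin (n + 1))}
  {o₂ : ∀ x : M₂, Orientation ℝ (TangentSpace I₂ x) (Fin (n + 1))}

/-- The determinant of the differential in charts. -/
lemma DetD_mul_volumeForm {f : M₁ → M₂} (hy : y ∈ (extChartAt I₁ x₀).target)
    (hp : (extChartAt I₁ x₀).symm y = p) (hq : f p ∈ (extChartAt I₂ q).source)
    (hf : MDifferentiableAt I₁ I₂ f p) :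
    DetD I₁ I₂ o₁ o₂ f p * (o₁ p).volumeForm (coordVec I₁ x₀ p) =
      (o₂ (f p)).volumeForm (coordVec I₂ q (f p)) * stdVol n (fun j =>
        fderivWithin ℝ (chartMap I₁ I₂ f x₀ q) (range I₁) y (EuclideanSpace.single j 1)) := by
  have h := DFunLike.congr_fun (volumeForm_compLinearMap (o₁ p) (o₂ (f p))
    (differential I₁ I₂ f p)) (coordVec I₁ x₀ p)
  rw [AlternatingMap.smul_apply, smul_eq_mul] at h
  rw [DetD, ← h, AlternatingMap.compLinearMap_apply, volumeForm_eq_stdVol hq]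
  congr 2
  funext j
  exact coords_mfderiv_coordVec hy hp hq hf j

variable [IsContMDiffRiemannianBundle I₁ ∞ (EuclideanSpace ℝ (Fin (n + 1)))
      (fun x : M₁ => TangentSpace I₁ x)]
  [IsContMDiffRiemannianBundle I₂ ∞ (EuclideanSpace ℝ (Fin (n + 1)))
      (fun x : M₂ => TangentSpace I₂ x)]

/-- The determinants of a smooth family of maps are given in a chart by a continuously
differentiable function. -/
lemma exists_contDiffWithinAt_DetD (ho₁ : IsOrientation I₁ o₁) (ho₂ : IsOrientation I₂ o₂)
    {J : Set ℝ} (hJ : IsOpen J)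
    (hψ : ContMDiffOn (𝓘(ℝ, ℝ).prod I₁) I₂ ∞ (fun z : ℝ × M₁ => ψ z.1 z.2) (J ×ˢ univ))
    (ht : t ∈ J) (p : M₁) :
    ∃ Θ : ℝ × EuclideanSpace ℝ (Fin (n + 1)) → ℝ,
      ContDiffWithinAt ℝ 1 Θ (univ ×ˢ range I₁) (t, extChartAt I₁ p p) ∧
      ∀ᶠ z in 𝓝 (t, p), DetD I₁ I₂ o₁ o₂ (ψ z.1) z.2 = Θ (z.1, extChartAt I₁ p z.2) := by
  have hψ' : ∀ z : ℝ × M₁, z.1 ∈ J →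
      ContMDiffAt (𝓘(ℝ, ℝ).prod I₁) I₂ ∞ (fun z : ℝ × M₁ => ψ z.1 z.2) z := fun z hz =>
    hψ.contMDiffAt ((hJ.prod isOpen_univ).mem_nhds ⟨hz, trivial⟩)
  set q := ψ t p with hqdef
  have hq : ψ t p ∈ (extChartAt I₂ q).source := mem_extChartAt_source _
  obtain ⟨s₁, hs₁, hv₁⟩ := exists_sign ho₁ p
  obtain ⟨s₂, hs₂, hv₂⟩ := exists_sign ho₂ q
  have hy := mem_extChartAt_target (I := I₁) p
  have hyr := extChartAt_mem_range (I₂ := I₁) p p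
  set Φ : ℝ × EuclideanSpace ℝ (Fin (n + 1)) → EuclideanSpace ℝ (Fin (n + 1)) :=
    fun z => chartMap I₁ I₂ (ψ z.1) p q z.2 with hΦ
  have hΦC : ContDiffWithinAt ℝ ∞ Φ (univ ×ˢ range I₁) (t, extChartAt I₁ p p) :=
    contDiffWithinAt_chartMap_family (hψ' (t, p) ht) hy (extChartAt_to_inv p) hq
  have hU : UniqueDiffOn ℝ ((univ : Set ℝ) ×ˢ range I₁) := uniqueDiffOn_univ.prod I₁.uniqueDiffOn
  -- This is `Det df = ± √det g₂(F) det DF / √det g₁`. Multiplying by `s₁` replaces dividing by it,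
  -- as `s₁² = 1`. Differentiating within `univ ×ˢ range I₁` includes boundary points of `M₁`.
  refine ⟨fun z => s₁ * s₂ * (density I₂ q (Φ z) * stdVol n (fun j =>
    fderivWithin ℝ Φ (univ ×ˢ range I₁) z (0, EuclideanSpace.single j 1))) / density I₁ p z.2,
    ?_, ?_⟩
  · have hG : ContDiffWithinAt ℝ 1 (fun z => density I₂ q (Φ z))
        (univ ×ˢ range I₁) (t, extChartAt I₁ p p) := by
      have h1 : Φ (t, extChartAt I₁ p p) = extChartAt I₂ q (ψ t p) := by
        simp [hΦ, chartMap]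
      have h2 := contDiffWithinAt_density (I₂ := I₂) hq
      rw [← h1] at h2
      exact (h2.comp (t, extChartAt I₁ p p) hΦC fun z _ => extChartAt_mem_range _ _).of_le (by simp)
    have hDF : ContDiffWithinAt ℝ 1 (fderivWithin ℝ Φ (univ ×ˢ range I₁))
        (univ ×ˢ range I₁) (t, extChartAt I₁ p p) := hΦC.fderivWithin_right hU
          (by rw [one_add_one_eq_two]; exact two_le_infty) ⟨trivial, hyr⟩
    have hd : ContDiffWithinAt ℝ 1 (fun z : ℝ × EuclideanSpace ℝ (Fin (n + 1)) =>
        density I₁ p z.2) (univ ×ˢ range I₁) (t, extChartAt I₁ p p) :=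
      ((contDiffWithinAt_density (mem_extChartAt_source (I := I₁) p)).comp
        (t, extChartAt I₁ p p) contDiffWithinAt_snd fun z hz => hz.2).of_le (by simp)
    refine ContDiffWithinAt.div (contDiffWithinAt_const.mul (hG.mul ?_)) hd (density_pos hy).ne'
    exact (stdVolCM n).contDiff.comp_contDiffWithinAt (contDiffWithinAt_pi.2 fun j =>
      hDF.clm_apply contDiffWithinAt_const)
  · have hcont : ContinuousAt (fun z : ℝ × M₁ => ψ z.1 z.2) (t, p) := (hψ' (t, p) ht).continuousAt
    filter_upwards [(hJ.preimage continuous_fst).mem_nhds ht,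
      hcont.eventually (extChartAt_source_mem_nhds (I := I₂) q), hcont.eventually hv₂,
      continuous_snd.continuousAt.eventually hv₁,
      continuous_snd.continuousAt.eventually (extChartAt_source_mem_nhds (I := I₁) p)]
      with z hzJ hzq hz2 hz1 hzp
    have hzp : z.2 ∈ (extChartAt I₁ p).source := hzp
    have hzt := (extChartAt I₁ p).map_source hzp
    have hinv := (extChartAt I₁ p).left_inv hzp
    have hsm := hψ' z hzJ
    have h := DetD_mul_volumeForm (o₁ := o₁) (o₂ := o₂) hzt hinv hzq
      ((contMDiffAt_slice (t := z.1) (p := z.2) hsm).mdifferentiableAt (by simp))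
    have hdiff : DifferentiableWithinAt ℝ Φ (univ ×ˢ range I₁) (z.1, extChartAt I₁ p z.2) :=
      (contDiffWithinAt_chartMap_family (t := z.1) (p := z.2) hsm hzt hinv
        hzq).differentiableWithinAt (by simp)
    have hsl : ∀ j, fderivWithin ℝ (chartMap I₁ I₂ (ψ z.1) p q) (range I₁) (extChartAt I₁ p z.2)
        (EuclideanSpace.single j 1) = fderivWithin ℝ Φ (univ ×ˢ range I₁) (z.1, extChartAt I₁ p z.2)
          (0, EuclideanSpace.single j 1) := fun j =>
      fderivWithin_slice I₁.uniqueDiffOn (extChartAt_mem_range _ _) hdiff _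
    simp only [hsl] at h
    have hΦz : Φ (z.1, extChartAt I₁ p z.2) = extChartAt I₂ q (ψ z.1 z.2) := by
      simp only [hΦ, chartMap, hinv]
    have hz1 : (o₁ z.2).volumeForm (coordVec I₁ p z.2) =
      s₁ * density I₁ p (extChartAt I₁ p z.2) := hz1
    have hz2 : (o₂ (ψ z.1 z.2)).volumeForm (coordVec I₂ q (ψ z.1 z.2)) =
      s₂ * density I₂ q (extChartAt I₂ q (ψ z.1 z.2)) := hz2
    rw [hz1, hz2, ← hΦz] at h
    rw [eq_div_iff (density_pos hzt).ne']
    have hss : s₁ * s₁ = 1 := by rcases hs₁ with rfl | rfl <;> norm_num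
    linear_combination s₁ * h - DetD I₁ I₂ o₁ o₂ (ψ z.1) z.2 * density I₁ p (extChartAt I₁ p z.2) * hss

variable {J : Set ℝ}

lemma continuousAt_DetD_family (ho₁ : IsOrientation I₁ o₁) (ho₂ : IsOrientation I₂ o₂)
    (hJ : IsOpen J)
    (hψ : ContMDiffOn (𝓘(ℝ, ℝ).prod I₁) I₂ ∞ (fun z : ℝ × M₁ => ψ z.1 z.2) (J ×ˢ univ))
    (ht : t ∈ J) (p : M₁) :
    ContinuousAt (fun z : ℝ × M₁ => DetD I₁ I₂ o₁ o₂ (ψ z.1) z.2) (t, p) := by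
  obtain ⟨Θ, hΘ, hev⟩ := exists_contDiffWithinAt_DetD ho₁ ho₂ hJ hψ ht p
  refine ContinuousAt.congr ?_ (hev.mono fun z hz => hz.symm)
  exact hΘ.continuousWithinAt.tendsto.comp (tendsto_prodMk_extChartAt t p)

/-- Joint continuity of the time derivative, also over boundary points, provides the uniform bound
on compact sets used for differentiating under the integral. -/
lemma continuousAt_deriv_DetD_family (ho₁ : IsOrientation I₁ o₁) (ho₂ : IsOrientation I₂ o₂)
    (hJ : IsOpen J)
    (hψ : ContMDiffOn (𝓘(ℝ, ℝ).prod I₁) I₂ ∞ (fun z : ℝ × M₁ => ψ z.1 z.2) (J ×ˢ univ))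
    (ht : t ∈ J) (p : M₁) :
    DifferentiableAt ℝ (fun s => DetD I₁ I₂ o₁ o₂ (ψ s) p) t ∧
    ContinuousAt (fun z : ℝ × M₁ => deriv (fun s => DetD I₁ I₂ o₁ o₂ (ψ s) z.2) z.1) (t, p) := by
  obtain ⟨Θ, hΘ, hev⟩ := exists_contDiffWithinAt_DetD ho₁ ho₂ hJ hψ ht p
  have hyr := extChartAt_mem_range (I₂ := I₁) p p
  have hU : UniqueDiffOn ℝ ((univ : Set ℝ) ×ˢ range I₁) := uniqueDiffOn_univ.prod I₁.uniqueDiffOn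
  have htend := tendsto_prodMk_extChartAt (I₁ := I₁) t p
  have hdiff : ∀ᶠ z in 𝓝 (t, p), DifferentiableWithinAt ℝ Θ (univ ×ˢ range I₁)
      (z.1, extChartAt I₁ p z.2) := by
    have h1 := hΘ.eventually (by simp)
    rw [insert_eq_of_mem (show (t, extChartAt I₁ p p) ∈ (univ : Set ℝ) ×ˢ range I₁ from
      ⟨trivial, hyr⟩)] at h1
    filter_upwards [htend.eventually h1] with z hz using hz.differentiableWithinAt (by simp)
  have hder : ∀ᶠ z in 𝓝 (t, p), HasDerivAt (fun s => DetD I₁ I₂ o₁ o₂ (ψ s) z.2)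
      (fderivWithin ℝ Θ (univ ×ˢ range I₁) (z.1, extChartAt I₁ p z.2) (1, 0)) z.1 := by
    filter_upwards [hdiff, hev.eventually_nhds] with z hz hzev
    refine (hasDerivAt_slice (extChartAt_mem_range _ _) hz).congr_of_eventuallyEq ?_
    have hl : Filter.Tendsto (fun s : ℝ => (s, z.2)) (𝓝 z.1) (𝓝 z) :=
      (Continuous.prodMk_left z.2).tendsto z.1
    exact hl.eventually hzev
  refine ⟨hder.self_of_nhds.differentiableAt, ContinuousAt.congr ?_
    (hder.mono fun z hz => hz.deriv.symm)⟩
  have hD : ContinuousWithinAt (fderivWithin ℝ Θ (univ ×ˢ range I₁)) (univ ×ˢ range I₁)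
      (t, extChartAt I₁ p p) :=
    (hΘ.fderivWithin_right (m := 0) hU (by simp) ⟨trivial, hyr⟩).continuousWithinAt
  exact ContinuousAt.clm_apply (hD.tendsto.comp htend) continuousAt_const

/-- The determinant of the differential of a smooth map is continuous. -/
lemma continuous_DetD (ho₁ : IsOrientation I₁ o₁) (ho₂ : IsOrientation I₂ o₂) {f : M₁ → M₂}
    (hf : ContMDiff I₁ I₂ ∞ f) : Continuous (DetD I₁ I₂ o₁ o₂ f) := by
  refine continuous_iff_continuousAt.2 fun p => ?_
  -- A single map is treated as a constant family.
  have hsm : ContMDiffOn (𝓘(ℝ, ℝ).prod I₁) I₂ ∞ (fun z : ℝ × M₁ => f z.2) (univ ×ˢ univ) :=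
    (ContMDiff.comp hf contMDiff_snd).contMDiffOn
  have h := continuousAt_DetD_family (ψ := fun _ => f) (t := 0) ho₁ ho₂ isOpen_univ hsm trivial p
  have h2 : Filter.Tendsto (fun p' : M₁ => ((0 : ℝ), p')) (𝓝 p) (𝓝 (0, p)) :=
    (Continuous.prodMk_right (0 : ℝ)).tendsto p
  have h3 := h.tendsto.comp h2
  simp only [Function.comp_def] at h3
  exact h3

end Families

/-! ### The first variation -/

section FirstVariation

variable {n : ℕ}
  {H₁ : Type*} [TopologicalSpace H₁] {I₁ : ModelWithCorners ℝ (EuclideanSpace ℝ (Fin (n + 1))) H₁}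
  {M₁ : Type*} [TopologicalSpace M₁] [ChartedSpace H₁ M₁] [IsManifold I₁ ∞ M₁]
  {H₂ : Type*} [TopologicalSpace H₂] {I₂ : ModelWithCorners ℝ (EuclideanSpace ℝ (Fin (n + 1))) H₂}
  {M₂ : Type*} [TopologicalSpace M₂] [ChartedSpace H₂ M₂] [IsManifold I₂ ∞ M₂]
  {ψ : ℝ → M₁ → M₂} {x₀ p : M₁} {q : M₂} {J : Set ℝ}

variable (I₂) in
/-- The velocity of a family of maps at time zero. -/
def variationField (ψ : ℝ → M₁ → M₂) (p : M₁) : TangentSpace I₂ (ψ 0 p) :=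
  mfderiv 𝓘(ℝ, ℝ) I₂ (fun t => ψ t p) 0 (1 : ℝ)

lemma variationField_eq_zero (h : ∀ᶠ t in 𝓝 (0 : ℝ), ψ t p = ψ 0 p) :
    variationField I₂ ψ p = 0 := by
  have h1 : (fun t => ψ t p) =ᶠ[𝓝 (0 : ℝ)] fun _ => ψ 0 p := h
  rw [variationField, h1.mfderiv_eq, mfderiv_const]
  rfl

lemma hasDerivAt_extChartAt_family
    (hψ : ContMDiffAt (𝓘(ℝ, ℝ).prod I₁) I₂ ∞ (fun z : ℝ × M₁ => ψ z.1 z.2) (0, p))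
    (hq : ψ 0 p ∈ (extChartAt I₂ q).source) :
    HasDerivAt (fun t => extChartAt I₂ q (ψ t p))
      (coords I₂ q (ψ 0 p) (variationField I₂ ψ p)) 0 := by
  have h1 := ((contMDiffAt_curve hψ).mdifferentiableAt (by simp)).hasMFDerivAt
  have h2 := HasMFDerivAt.comp (0 : ℝ) (hasMFDerivAt_extChartAt_coords hq) h1
  have h3 : HasFDerivAt (𝕜 := ℝ) (E := ℝ) (F := EuclideanSpace ℝ (Fin (n + 1)))
      (fun t => extChartAt I₂ q (ψ t p)) _ 0 := hasMFDerivAt_iff_hasFDerivAt.1 h2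
  exact h3.hasDerivAt

lemma isSmoothSection_variationField (hJ : IsOpen J) (h0 : (0 : ℝ) ∈ J)
    (hψ : ContMDiffOn (𝓘(ℝ, ℝ).prod I₁) I₂ ∞ (fun z : ℝ × M₁ => ψ z.1 z.2) (J ×ˢ univ)) :
    IsSmoothSection I₁ I₂ (ψ 0) (variationField I₂ ψ) := by
  have hψ' : ∀ p : M₁, ContMDiffAt (𝓘(ℝ, ℝ).prod I₁) I₂ ∞ (fun z : ℝ × M₁ => ψ z.1 z.2) (0, p) :=
    fun p => hψ.contMDiffAt ((hJ.prod isOpen_univ).mem_nhds ⟨h0, trivial⟩)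
  refine isSmoothSection_of_coords (fun p => contMDiffAt_slice (hψ' p)) fun p => ?_
  set q := ψ 0 p with hqdef
  set Φ : ℝ × EuclideanSpace ℝ (Fin (n + 1)) → EuclideanSpace ℝ (Fin (n + 1)) :=
    fun z => chartMap I₁ I₂ (ψ z.1) p q z.2 with hΦ
  have hU : UniqueDiffOn ℝ ((univ : Set ℝ) ×ˢ range I₁) := uniqueDiffOn_univ.prod I₁.uniqueDiffOn
  have hΦC : ContDiffWithinAt ℝ ∞ Φ (univ ×ˢ range I₁) (0, extChartAt I₁ p p) :=
    contDiffWithinAt_chartMap_family (hψ' p) (mem_extChartAt_target p) (extChartAt_to_inv p)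
      (mem_extChartAt_source _)
  have hD : ContDiffWithinAt ℝ ∞
      (fun y => fderivWithin ℝ Φ (univ ×ˢ range I₁) (0, y) (1, 0)) (range I₁)
      (extChartAt I₁ p p) := by
    have h1 : ContDiffWithinAt ℝ ∞ (fderivWithin ℝ Φ (univ ×ˢ range I₁)) (univ ×ˢ range I₁)
      (0, extChartAt I₁ p p) :=
      hΦC.fderivWithin_right hU (by simp) ⟨trivial, extChartAt_mem_range _ _⟩
    have h2 : ContDiffWithinAt ℝ ∞ (fun y : EuclideanSpace ℝ (Fin (n + 1)) => ((0 : ℝ), y))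
      (range I₁) (extChartAt I₁ p p) := contDiffWithinAt_const.prodMk contDiffWithinAt_id
    exact (ContDiffWithinAt.comp (extChartAt I₁ p p) h1 h2 fun y hy => ⟨trivial, hy⟩).clm_apply
      contDiffWithinAt_const
  have hcomp : ContMDiffAt I₁ 𝓘(ℝ, EuclideanSpace ℝ (Fin (n + 1))) ∞
      (fun p' => fderivWithin ℝ Φ (univ ×ˢ range I₁) (0, extChartAt I₁ p p') (1, 0)) p := by
    have h1 : ContMDiffWithinAt I₁ 𝓘(ℝ, EuclideanSpace ℝ (Fin (n + 1))) ∞ (extChartAt I₁ p) univ p :=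
      contMDiffAt_extChartAt
    exact ContMDiffWithinAt.comp
      (g := fun y => fderivWithin ℝ Φ (univ ×ˢ range I₁) (0, y) (1, 0)) p
      hD.contMDiffWithinAt h1 fun p' _ => extChartAt_mem_range _ _
  refine hcomp.congr_of_eventuallyEq ?_
  have hc : ContinuousAt (ψ 0) p := (contMDiffAt_slice (hψ' p)).continuousAt
  filter_upwards [hc.preimage_mem_nhds (extChartAt_source_mem_nhds (I := I₂) q),
    extChartAt_source_mem_nhds (I := I₁) p] with p' hp'q hp'
  have hinv := (extChartAt I₁ p).left_inv hp'
  have h1 := hasDerivAt_extChartAt_family (hψ' p') hp'q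
  have hdiff : DifferentiableWithinAt ℝ Φ (univ ×ˢ range I₁) (0, extChartAt I₁ p p') :=
    (contDiffWithinAt_chartMap_family (hψ' p') ((extChartAt I₁ p).map_source hp') hinv
      hp'q).differentiableWithinAt (by simp)
  have h2 := hasDerivAt_slice (extChartAt_mem_range _ _) hdiff
  simp only [hΦ, chartMap, hinv] at h2
  -- Near `p` the coordinates of the velocity are the time derivative of the chart map, which is
  -- smooth in the base point.
  exact h1.unique h2

variable [RiemannianBundle (fun x : M₁ => TangentSpace I₁ x)]
  [RiemannianBundle (fun x : M₂ => TangentSpace I₂ x)]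
  {o₁ : ∀ x : M₁, Orientation ℝ (TangentSpace I₁ x) (Fin (n + 1))}
  {o₂ : ∀ x : M₂, Orientation ℝ (TangentSpace I₂ x) (Fin (n + 1))}
  [IsContMDiffRiemannianBundle I₂ ∞ (EuclideanSpace ℝ (Fin (n + 1)))
      (fun x : M₂ => TangentSpace I₂ x)]

/-- The variation of the determinant of the differential at an interior point. -/
theorem hasDerivAt_DetD_family (ho₂ : IsOrientation I₂ o₂) (hJ : IsOpen J) (h0 : (0 : ℝ) ∈ J)
    (hψ : ContMDiffOn (𝓘(ℝ, ℝ).prod I₁) I₂ ∞ (fun z : ℝ × M₁ => ψ z.1 z.2) (J ×ˢ univ))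
    (hp : p ∈ I₁.interior M₁) :
    HasDerivAt (fun t => DetD I₁ I₂ o₁ o₂ (ψ t) p)
      (homInner (pullbackConnection I₁ I₂ (ψ 0) (variationField I₂ ψ) p)
        (CofD I₁ I₂ o₁ o₂ (ψ 0) p)) 0 := by
  have hψ' : ∀ z : ℝ × M₁, z.1 ∈ J →
      ContMDiffAt (𝓘(ℝ, ℝ).prod I₁) I₂ ∞ (fun z : ℝ × M₁ => ψ z.1 z.2) z := fun z hz =>
    hψ.contMDiffAt ((hJ.prod isOpen_univ).mem_nhds ⟨hz, trivial⟩)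
  have hψ0 : ContMDiff I₁ I₂ ∞ (ψ 0) := fun p => contMDiffAt_slice (hψ' (0, p) h0)
  have hV := isSmoothSection_variationField hJ h0 hψ
  set q := ψ 0 p with hqdef
  set y := extChartAt I₁ p p with hydef
  have hy : y ∈ (extChartAt I₁ p).target := mem_extChartAt_target p
  have hsy : (extChartAt I₁ p).symm y = p := extChartAt_to_inv p
  have hq : ψ 0 p ∈ (extChartAt I₂ q).source := mem_extChartAt_source _
  have hn : range I₁ ∈ 𝓝 y := mem_interior_iff_mem_nhds.1 hp
  obtain ⟨s, -, hs⟩ := exists_sign ho₂ q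
  have hF : ContDiffAt ℝ 2 (fun z : ℝ × EuclideanSpace ℝ (Fin (n + 1)) =>
      chartMap I₁ I₂ (ψ z.1) p q z.2) (0, y) :=
    ((contDiffWithinAt_chartMap_family (hψ' (0, p) h0) hy hsy hq).contDiffAt
      (prod_mem_nhds Filter.univ_mem hn)).of_le two_le_infty
  have hsymm : Filter.Tendsto (extChartAt I₁ p).symm (𝓝 y) (𝓝 p) := by
    have := tendsto_extChartAt_symm hy hsy
    rwa [nhdsWithin_eq_nhds.2 hn] at this
  have hS : ∀ᶠ z in 𝓝 y, HasDerivAt (fun t => chartMap I₁ I₂ (ψ t) p q z)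
      (chartSection I₁ I₂ (ψ 0) (variationField I₂ ψ) p q z) 0 := by
    have h1 : Filter.Tendsto (fun z => ψ 0 ((extChartAt I₁ p).symm z)) (𝓝 y) (𝓝 q) :=
      (hψ0.continuous.tendsto p).comp hsymm
    filter_upwards [h1.eventually (extChartAt_source_mem_nhds (I := I₂) q)] with z hz
    exact hasDerivAt_extChartAt_family (hψ' (0, _) h0) hz
  have hG := (contDiffWithinAt_density (I₂ := I₂) hq).differentiableWithinAt (by simp)
  have hFy : chartMap I₁ I₂ (ψ 0) p q y = extChartAt I₂ q (ψ 0 p) := by rw [chartMap, hsy]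
  rw [← hFy] at hG
  have key := hasDerivAt_mul_stdVol_family (F := fun t => chartMap I₁ I₂ (ψ t) p q) hF hS
    hG.hasFDerivWithinAt (.of_forall fun t => chartMap_mem_range)
  -- The derivative found in `key` is the same coordinate expression as the pairing with the
  -- cofactor, up to the sign `s` and the source factor `c`.
  have hpt := homInner_pullbackConnection_CofD (o₁ := o₁) hψ0 hV hy hsy hs.self_of_nhds
  rw [chartVariation, fderivWithin_of_mem_nhds hn, fderivWithin_of_mem_nhds hn] at hpt
  set c := (o₁ p).volumeForm (coordVec I₁ p p) with hc
  have hc0 : c ≠ 0 := volumeForm_coordVec_ne_zero (mem_extChartAt_source p) _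
  have h1 := (key.const_mul s).div_const c
  rw [← hpt, mul_div_cancel_right₀ _ hc0] at h1
  refine h1.congr_of_eventuallyEq ?_
  have hcurve : ContinuousAt (fun t => ψ t p) 0 := (contMDiffAt_curve (hψ' (0, p) h0)).continuousAt
  filter_upwards [hJ.mem_nhds h0, hcurve.eventually hs,
    hcurve.eventually (extChartAt_source_mem_nhds (I := I₂) q)] with t ht hts htq
  have h2 := DetD_mul_volumeForm (o₁ := o₁) (o₂ := o₂) hy hsy htq
    ((contMDiffAt_slice (hψ' (t, p) ht)).mdifferentiableAt (by simp))
  rw [eq_div_iff hc0, h2, hts, fderivWithin_of_mem_nhds hn, mul_assoc, chartMap, hsy]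

lemma volumeFunctional_eq [MeasurableSpace M₁] (K : Set M₁) (f : M₁ → M₂) :
    volumeFunctional I₁ I₂ o₁ o₂ K f =
      ∫ p in K, DetD I₁ I₂ o₁ o₂ f p ∂(riemannianVolume I₁ : Measure M₁) := by
  rw [volumeFunctional, integralTopForm]
  congr 1
  funext p
  rw [pullbackVolume, volumeForm_compLinearMap (o₁ p), AlternatingMap.smul_apply,
    volumeForm_orientedBasis, smul_eq_mul, mul_one]
  rfl

variable [IsContMDiffRiemannianBundle I₁ ∞ (EuclideanSpace ℝ (Fin (n + 1)))
      (fun x : M₁ => TangentSpace I₁ x)]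
  [T2Space M₁] [SecondCountableTopology M₁] [MeasurableSpace M₁] [BorelSpace M₁]

/-- The volume functional is constant to first order along every variation relative to the
boundary. -/
theorem hasDerivAt_volumeFunctional (ho₁ : IsOrientation I₁ o₁) (ho₂ : IsOrientation I₂ o₂)
    {φ : M₁ → M₂} {K : Set M₁} {ε : ℝ} (hK : IsCompact K) (hε : 0 < ε)
    (h : IsVariation I₁ I₂ φ K ε ψ) :
    HasDerivAt (fun t => volumeFunctional I₁ I₂ o₁ o₂ K (ψ t)) 0 0 := by
  obtain ⟨hψ, rfl, hb, hoff⟩ := h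
  set J := Ioo (-ε) ε with hJdef
  have hJ : IsOpen J := isOpen_Ioo
  have h0 : (0 : ℝ) ∈ J := ⟨by linarith, hε⟩
  have hψ0 : ContMDiff I₁ I₂ ∞ (ψ 0) := fun p =>
    contMDiffAt_slice (hψ.contMDiffAt ((hJ.prod isOpen_univ).mem_nhds ⟨h0, trivial⟩))
  have hV := isSmoothSection_variationField hJ h0 hψ
  have hVoff : ∀ p ∉ K, variationField I₂ ψ p = 0 := fun p hp =>
    variationField_eq_zero (by filter_upwards [hJ.mem_nhds h0] with t ht using hoff t ht p hp)
  have hVb : ∀ p ∈ I₁.boundary M₁, variationField I₂ ψ p = 0 := fun p hp =>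
    variationField_eq_zero (by filter_upwards [hJ.mem_nhds h0] with t ht using hb t ht p hp)
  have hsupp : closure {p | variationField I₂ ψ p ≠ 0} ⊆ K :=
    closure_minimal (fun p hp => by_contra fun hpK => hp (hVoff p hpK)) hK.isClosed
  set μ := (riemannianVolume I₁ : Measure M₁) with hμ
  set D : ℝ → M₁ → ℝ := fun t p => DetD I₁ I₂ o₁ o₂ (ψ t) p with hD
  set D' : ℝ → M₁ → ℝ := fun t p => deriv (fun s => D s p) t with hD'
  have hDc : ∀ t ∈ J, Continuous (D t) := fun t ht => by
    refine continuous_DetD ho₁ ho₂ fun p => ?_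
    exact contMDiffAt_slice (hψ.contMDiffAt ((hJ.prod isOpen_univ).mem_nhds ⟨ht, trivial⟩))
  have hD'c : ∀ t ∈ J, ∀ p, DifferentiableAt ℝ (fun s => D s p) t ∧
      ContinuousAt (fun z : ℝ × M₁ => D' z.1 z.2) (t, p) := fun t ht p =>
    continuousAt_deriv_DetD_family ho₁ ho₂ hJ hψ ht p
  -- Halving the interval gives a compact set of times, and the bound `C` is the maximum principle
  -- for a continuous function on `Icc × K`.
  have hIcc : Icc (-(ε / 2)) (ε / 2) ⊆ J := fun t ht =>
    ⟨by linarith [ht.1], by linarith [ht.2]⟩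
  obtain ⟨C, hC⟩ := (isCompact_Icc.prod hK).exists_bound_of_continuousOn
    (f := fun z : ℝ × M₁ => D' z.1 z.2) (s := Icc (-(ε / 2)) (ε / 2) ×ˢ K)
    fun z hz => (hD'c z.1 (hIcc hz.1) z.2).2.continuousWithinAt
  have hnhds : Ioo (-(ε / 2)) (ε / 2) ∈ 𝓝 (0 : ℝ) := Ioo_mem_nhds (by linarith) (by linarith)
  have hfin : μ K ≠ ⊤ := hK.measure_lt_top.ne
  have hD'0 : Continuous (D' 0) := continuous_iff_continuousAt.2 fun p => by
    have h2 : Filter.Tendsto (fun p' : M₁ => ((0 : ℝ), p')) (𝓝 p) (𝓝 (0, p)) :=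
      (Continuous.prodMk_right (0 : ℝ)).tendsto p
    exact ((hD'c 0 h0 p).2.tendsto.comp h2 :)
  have key := (hasDerivAt_integral_of_dominated_loc_of_deriv_le (μ := μ.restrict K) (F := D)
    (F' := D') (x₀ := (0 : ℝ)) (bound := fun _ => C) hnhds
    (by filter_upwards [hJ.mem_nhds h0] with t ht using (hDc t ht).aestronglyMeasurable)
    ((hDc 0 h0).continuousOn.integrableOn_compact hK) hD'0.aestronglyMeasurable
    (by
      filter_upwards [ae_restrict_mem hK.measurableSet] with p hp t ht
      exact hC (t, p) ⟨Ioo_subset_Icc_self ht, hp⟩)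
    (integrableOn_const hfin)
    (.of_forall fun p t ht => (hD'c t (hIcc (Ioo_subset_Icc_self ht)) p).1.hasDerivAt)).2
  -- Almost every point is interior, where `D' 0` is the pairing of the cofactor with `∇V`. The
  -- pairing vanishes off `K`, so the divergence theorem on all of `M₁` applies.
  have hzero : ∫ p in K, D' 0 p ∂μ = 0 := by
    refine Eq.trans ?_ (integral_homInner_pullbackConnection_CofD (o₁ := o₁) ho₁ ho₂ hψ0 hV
      (hK.of_isClosed_subset isClosed_closure hsupp) hVb)
    rw [← setIntegral_eq_integral_of_forall_compl_eq_zero (s := K)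
      (f := fun p => homInner (pullbackConnection I₁ I₂ (ψ 0) (variationField I₂ ψ) p)
        (CofD I₁ I₂ o₁ o₂ (ψ 0) p))]
    · refine integral_congr_ae (ae_restrict_of_ae ?_)
      filter_upwards [ae_mem_interior (I₁ := I₁)] with p hp
      exact (hasDerivAt_DetD_family ho₂ hJ h0 hψ hp).deriv
    · intro p hp
      have : ∀ᶠ p' in 𝓝 p, variationField I₂ ψ p' = 0 := by
        filter_upwards [hK.isClosed.isOpen_compl.mem_nhds hp] with p' hp' using hVoff p' hp'
      rw [pullbackConnection_eq_zero this, homInner_zero_left]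
  rw [hzero] at key
  simp only [volumeFunctional_eq]
  exact key

/-- The coderivative of the cofactor of `df` vanishes. -/
theorem isCoderivative_CofD_zero (ho₁ : IsOrientation I₁ o₁) (ho₂ : IsOrientation I₂ o₂)
    {f : M₁ → M₂} (hf : ContMDiff I₁ I₂ ∞ f) :
    IsCoderivative I₁ I₂ f (CofD I₁ I₂ o₁ o₂ f) (fun _ => 0) := by
  refine ⟨isSmoothSection_zero hf, fun σ hσ hσc hσb => ?_⟩
  rw [integral_homInner_pullbackConnection_CofD ho₁ ho₂ hf hσ hσc hσb]
  simp

/-- The defining identity and the divergence theorem make `τ` orthogonal to all test sections, and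
these separate smooth sections. -/
theorem IsCoderivative.eq_zero (ho₁ : IsOrientation I₁ o₁) (ho₂ : IsOrientation I₂ o₂)
    {f : M₁ → M₂} (hf : ContMDiff I₁ I₂ ∞ f) {τ : ∀ p, TangentSpace I₂ (f p)}
    (hτ : IsCoderivative I₁ I₂ f (CofD I₁ I₂ o₁ o₂ f) τ) : τ = fun _ => 0 :=
  eq_zero_of_integral_inner_eq_zero hf hτ.1 fun σ hσ hσc hσb => by
    rw [hτ.2 σ hσ hσc hσb, integral_homInner_pullbackConnection_CofD ho₁ ho₂ hf hσ hσc hσb]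

end FirstVariation

end Piola

end

/-! ### The null-Lagrangian property and the Riemannian Piola identity. -/

theorem mainTheorem3 {n : ℕ}
    {H₁ : Type*} [TopologicalSpace H₁]
    (I₁ : ModelWithCorners ℝ (EuclideanSpace ℝ (Fin (n + 1))) H₁)
    {M₁ : Type*} [TopologicalSpace M₁] [ChartedSpace H₁ M₁] [IsManifold I₁ ∞ M₁]
    [T2Space M₁] [SecondCountableTopology M₁] [MeasurableSpace M₁] [BorelSpace M₁]
    [RiemannianBundle (fun x : M₁ => TangentSpace I₁ x)]
    [IsContMDiffRiemannianBundle I₁ ∞ (EuclideanSpace ℝ (Fin (n + 1)))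
      (fun x : M₁ => TangentSpace I₁ x)]
    (o₁ : ∀ x : M₁, Orientation ℝ (TangentSpace I₁ x) (Fin (n + 1)))
    (ho₁ : Piola.IsOrientation I₁ o₁)
    {H₂ : Type*} [TopologicalSpace H₂]
    (I₂ : ModelWithCorners ℝ (EuclideanSpace ℝ (Fin (n + 1))) H₂)
    {M₂ : Type*} [TopologicalSpace M₂] [ChartedSpace H₂ M₂] [IsManifold I₂ ∞ M₂]
    [T2Space M₂] [SecondCountableTopology M₂]
    [RiemannianBundle (fun x : M₂ => TangentSpace I₂ x)]
    [IsContMDiffRiemannianBundle I₂ ∞ (EuclideanSpace ℝ (Fin (n + 1)))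
      (fun x : M₂ => TangentSpace I₂ x)]
    (o₂ : ∀ x : M₂, Orientation ℝ (TangentSpace I₂ x) (Fin (n + 1)))
    (ho₂ : Piola.IsOrientation I₂ o₂) :
    -- `f^*dVol₂ = Det df dVol₁`, and the two expressions of the functional `E` agree
    (∀ f : M₁ → M₂, ContMDiff I₁ I₂ ∞ f →
      (∀ p, Piola.pullbackVolume I₁ I₂ o₂ f p =
        Piola.DetD I₁ I₂ o₁ o₂ f p • (o₁ p).volumeForm) ∧
      ∀ K : Set M₁, IsCompact K →
        IntegrableOn (Piola.DetD I₁ I₂ o₁ o₂ f) K (Piola.riemannianVolume I₁) ∧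
        Piola.volumeFunctional I₁ I₂ o₁ o₂ K f =
          ∫ p in K, Piola.DetD I₁ I₂ o₁ o₂ f p ∂(Piola.riemannianVolume I₁)) ∧
    -- the Euler–Lagrange equation of `E` is `δ Cof dφ = 0`
    (∀ φ : M₁ → M₂, ContMDiff I₁ I₂ ∞ φ →
      ∃ τ : ∀ p, TangentSpace I₂ (φ p),
        Piola.IsCoderivative I₁ I₂ φ (Piola.CofD I₁ I₂ o₁ o₂ φ) τ ∧
        (∀ τ', Piola.IsCoderivative I₁ I₂ φ (Piola.CofD I₁ I₂ o₁ o₂ φ) τ' → τ' = τ) ∧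
        (∀ (K : Set M₁) (ε : ℝ) (ψ : ℝ → M₁ → M₂) (V : ∀ p, TangentSpace I₂ (φ p)),
          IsCompact K → 0 < ε → Piola.IsVariation I₁ I₂ φ K ε ψ →
          Piola.IsVariationField I₂ φ ψ V →
          HasDerivAt (fun t => Piola.volumeFunctional I₁ I₂ o₁ o₂ K (ψ t))
            (∫ p, inner ℝ (τ p) (V p) ∂(Piola.riemannianVolume I₁)) 0) ∧
        (Piola.IsCritical I₁ I₂ (Piola.volumeFunctional I₁ I₂ o₁ o₂) φ ↔ ∀ p, τ p = 0)) ∧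
    -- `E` is a null-Lagrangian
    Piola.IsNullLagrangian I₁ I₂ (Piola.volumeFunctional I₁ I₂ o₁ o₂) ∧
    -- the Riemannian Piola identity `δ Cof df = 0`
    (∀ f : M₁ → M₂, ContMDiff I₁ I₂ ∞ f →
      Piola.IsCoderivative I₁ I₂ f (Piola.CofD I₁ I₂ o₁ o₂ f) (fun _ => 0)) := by
  have hmain : ∀ φ : M₁ → M₂, ContMDiff I₁ I₂ ∞ φ →
      Piola.IsCritical I₁ I₂ (Piola.volumeFunctional I₁ I₂ o₁ o₂) φ :=
    fun φ _ K ε ψ hK hε hψ => Piola.hasDerivAt_volumeFunctional ho₁ ho₂ hK hε hψ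
  -- The coderivative is exhibited as `0`. Both sides of the Euler–Lagrange equivalence are then
  -- true, and the first variation formula says that the derivative of `E` is zero.
  refine ⟨fun f hf => ⟨fun p => Piola.volumeForm_compLinearMap _ _ _, fun K hK =>
    ⟨(Piola.continuous_DetD ho₁ ho₂ hf).continuousOn.integrableOn_compact hK,
      Piola.volumeFunctional_eq K f⟩⟩, fun φ hφ => ⟨fun _ => 0,
    Piola.isCoderivative_CofD_zero ho₁ ho₂ hφ, fun τ' hτ' => hτ'.eq_zero ho₁ ho₂ hφ, ?_,
    fun _ _ => rfl, fun _ => hmain φ hφ⟩, hmain,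
    fun f hf => Piola.isCoderivative_CofD_zero ho₁ ho₂ hf⟩
  intro K ε ψ V hK hε hψ _
  simpa using Piola.hasDerivAt_volumeFunctional ho₁ ho₂ hK hε hψ
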